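/- Let $n\ge 1$, let $\Omega\subset\mathbb R^n$ be a bounded Lipschitz domain, $\gamma\in[0,1)$, and let $M:\Omega\times\mathbb R^n\to[0,\infty)$ be a weak $N$-function: $M$ is measurable in $x$ and, for a.e. $x\in\Omega$, $\xi\mapsto M(x,\xi)$ is continuous, convex and even with $M(x,0)=0$, and there are convex $m_1,m_2:[0,\infty)\to[0,\infty)$ with $m_1(0)=0$, $m_1(s)>0$ for $s>0$, and $m_1(|\xi|)\le M(x,\xi)\le m_2(|\xi|)$ for a.e. $x\in\Omega$ and all $\xi\in\mathbb R^n$. Let $F:\Omega\times\mathbb R\times\mathbb R^n\to\mathbb R$ be measurable in $x$ and continuous in $(z,\xi)$, and assume that for some constants $0<\nu,\beta<1<L$ $$\nu M(x,\beta\xi)\le F(x,z,\xi)\le L\,(M(x,\xi)+1)\qquad\text{for all }x\in\Omega,\ z\in\mathbb R,\ \xi\in\mathbb R^n .$$ Put $\mathcal F[u]=\int_\Omega F(x,u,\nabla u)\,dx$. *Notation.* $L_M(\Omega;\mathbb R^n)$ is the smallest linear space containing all measurable $\eta:\Omega\to\mathbb R^n$ with $\int_\Omega M(x,\eta(x))\,dx<\infty$;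 $V^1L_M(\Omega)=\{u\in W^{1,1}(\Omega):\nabla u\in L_M(\Omega;\mathbb R^n)\}$; $V^{1,M}_0(\Omega)=\{u\in W^{1,1}_0(\Omega):\nabla u\in L_M(\Omega;\mathbb R^n)\}$, where $W^{1,1}_0(\Omega)$ is the closure of $C_c^\infty(\Omega)$ in $W^{1,1}(\Omega)$. For $\gamma\in(0,1]$, $h\in C^{0,\gamma}(\Omega)$ means $\sup_{x\neq y\in\Omega}|h(x)-h(y)|/|x-y|^\gamma<\infty$; $C^{0,0}(\Omega)$ is the set of continuous $h$ with $\sup_{x,y\in\Omega}|h(x)-h(y)|<\infty$. We write $p\in\mathcal P^{\log}(\Omega)$ if there are $c>0$ and $\delta\in(0,1)$ with $|p(x)-p(y)|\le c/\log(1/|x-y|)$ for all $x,y\in\Omega$ with $0<|x-y|<\delta$. A modulus of continuity of $a$ on $\Omega$ is a nondecreasing $\omega_a:[0,\infty)\to\mathbb R$, with $\omega_a(t)\to0=\omega_a(0)$ as $t\to0^+$ and $|a(x)-a(y)|\le\omega_a(|x-y|)$ for $x,y\in\Omega$. A Young function is a convex $\phi:[0,\infty)\to[0,\infty)$ with $\phi(0)=0$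 and $\phi(t)>0$ for $t>0$; it satisfies $\Delta_2$ if there are $c,C>0$ and $h\ge0$ with $\phi(2t)\le c\,\phi(t)+h$ for all $t>C$. Say that (A) holds if for every $u_0\in V^1L_M(\Omega)$ $$\inf_{u_0+V^{1,M}_0(\Omega)}\mathcal F=\inf_{u_0+C_c^\infty(\Omega)}\mathcal F ,$$ and that (B) holds if for every $u_0\in V^1L_M(\Omega)\cap C^{0,\gamma}(\Omega)$ $$\inf_{u_0+(V^{1,M}_0(\Omega)\cap C^{0,\gamma}(\Omega))}\mathcal F=\inf_{u_0+C_c^\infty(\Omega)}\mathcal F .$$ *Isotropic cases.* 1. (variable exponent) If $M(x,\xi)=|\xi|^{p(x)}$ with $p\in\mathcal P^{\log}(\Omega)$, $1\le p(\cdot)<\infty$, then (A) and (B) hold. 2. (mild double phase) If $M(x,\xi)=|\xi|^p+a(x)|\xi|^p\log(e+|\xi|)$ with $0\le a\in\mathcal P^{\log}(\Omega)$, $1\le p<\infty$, then (A) and (B) hold. 3. (double phase) If $M(x,\xi)=|\xi|^p+a(x)|\xi|^q$ with $0\le a\in C^{0,\alpha}(\Omega)$, $\alpha\in(0,1]$,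 $1\le p\le q$, then (A) holds whenever $q\le p+\alpha$, and (B) holds whenever $q\le p+\alpha/(1-\gamma)$. 4. (variable exponent double phase) If $M(x,\xi)=|\xi|^{p(x)}+a(x)|\xi|^{q(x)}$ with $0\le a\in C^{0,\alpha}(\Omega)$, $\alpha\in(0,1]$, $p,q\in\mathcal P^{\log}(\Omega)$, $1\le p(x)\le q(x)$, then (A) holds whenever $\sup_\Omega(q-p)\le\alpha$, and (B) holds whenever $\sup_\Omega(q-p)\le\alpha/(1-\gamma)$. 5. (multi-phase) If $M(x,\xi)=|\xi|^p+\sum_{i=1}^n a_i(x)|\xi|^{q_i}$ with $0\le a_i\in C^{0,\alpha_i}(\Omega)$, $\alpha_i\in(0,1]$, $1\le p\le q_i$, then (A) holds whenever $q_i\le p+\alpha_i$ for all $i$, and (B) holds whenever $q_i\le p+\alpha_i/(1-\gamma)$ for all $i$. 6. (Orlicz double phase) If $M(x,\xi)=\phi(|\xi|)+a(x)\psi(|\xi|)$ with Young functions $\phi,\psi\in\Delta_2$, $\psi(t)/\phi(t)\to\infty$ as $t\to\infty$, and $0\le a\in C(\Omega)$ with modulus of continuity $\omega_a$, then (A) holds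 whenever $\omega_a(t)\le\phi(t^{-1})/\psi(t^{-1})$ for all sufficiently small $t>0$, and (B) holds whenever $\omega_a(t)\le\phi(t^{\gamma-1})/\psi(t^{\gamma-1})$ for all sufficiently small $t>0$. 7. (logarithmic instance of 6) If $M(x,\xi)=|\xi|^p\log^{-\beta}(e+|\xi|)+a(x)|\xi|^p\log^{\alpha}(e+|\xi|)$ with $1<p<\infty$, $\alpha,\beta\ge0$ (here $\beta$ is unrelated to the constant in the growth condition), and $0\le a\in C(\Omega)$ has a modulus of continuity with $\omega_a(t)\le\log^{-(\alpha+\beta)}(e+1/t)$ for all sufficiently small $t>0$, then (A) and (B) hold. *Orthotropic cases.* 8. If $M(x,\xi)=\sum_{i=1}^n|\xi_i|^{p_i(x)}$ with $p_i\in\mathcal P^{\log}(\Omega)$, $1\le p_i(\cdot)<\infty$, then (A) and (B) hold. 9. If $M(x,\xi)=\sum_{i=1}^n|\xi_i|^{p_i}+\sum_{i=1}^n a_i(x)|\xi_i|^{q_i}$ with $0\le a_i\in C^{0,\alpha_i}(\Omega)$, $\alpha_i\in(0,1]$, $1\le p_i\le q_i$, then (A) holds whenever $q_i\le p_i+\alpha_i$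 for all $i$, and (B) holds whenever $q_i\le p_i+\alpha_i/(1-\gamma)$ for all $i$. 10. If $M(x,\xi)=\sum_{i=1}^n|\xi_i|^{p_i}+\sum_{i=1}^n a_i(x)|\xi_i|^{p_i}\log(e+|\xi_i|)$ with $0\le a_i\in\mathcal P^{\log}(\Omega)$, $1\le p_i<\infty$, then (A) and (B) hold. 11. If $M(x,\xi)=\sum_{i=1}^n|\xi_i|^{p_i(x)}+\sum_{i=1}^n a_i(x)|\xi_i|^{q_i(x)}$ with $0\le a_i\in C^{0,\alpha_i}(\Omega)$, $\alpha_i\in(0,1]$, $p_i,q_i\in\mathcal P^{\log}(\Omega)$, $1\le p_i(\cdot)\le q_i(\cdot)$, then (A) holds whenever $\sup_\Omega(q_i-p_i)\le\alpha_i$ for all $i$, and (B) holds whenever $\sup_\Omega(q_i-p_i)\le\alpha_i/(1-\gamma)$ for all $i$. -/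

import Mathlib

open Set Filter Topology MeasureTheory
open scoped ENNReal NNReal

namespace Lavrentiev

/-- The Euclidean space `ℝⁿ`. -/
abbrev Space (n : ℕ) : Type := EuclideanSpace ℝ (Fin n)

/-- A bounded Lipschitz domain: a bounded, nonempty, connected open set which, near each of its
boundary points, is the part lying strictly above the graph of a Lipschitz function, in a suitable
orthonormal frame. Here `e` is the vertical unit vector, `inner ℝ e y` the height of `y` and
`y - (inner ℝ e y) • e` its orthogonal projection onto the horizontal hyperplane. -/
structure IsBoundedLipschitzDomain {n : ℕ} (Ω : Set (Space n)) : Prop where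
  isOpen : IsOpen Ω
  isConnected : IsConnected Ω
  isBounded : Bornology.IsBounded Ω
  locally_graph : ∀ x₀ ∈ frontier Ω, ∃ (e : Space n) (g : Space n → ℝ) (K : ℝ≥0) (r : ℝ),
    ‖e‖ = 1 ∧ LipschitzWith K g ∧ 0 < r ∧
      ∀ y ∈ Metric.ball x₀ r, (y ∈ Ω ↔ g (y - (inner ℝ e y) • e) < inner ℝ e y)

/-- `φ ∈ C_c^∞(Ω)`. -/
def IsTestFunction {n : ℕ} (Ω : Set (Space n)) (φ : Space n → ℝ) : Prop :=
  ContDiff ℝ (⊤ : ℕ∞) φ ∧ HasCompactSupport φ ∧ tsupport φ ⊆ Ω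

/-- `u ∈ C^{0,γ}(Ω)`: finiteness of the Hölder seminorm over `Ω`. Continuity is automatic for
`0 < γ`; for `γ = 0` the definition describes the continuous functions of bounded oscillation. -/
def IsHolder {n : ℕ} (γ : ℝ) (Ω : Set (Space n)) (u : Space n → ℝ) : Prop :=
  ContinuousOn u Ω ∧ ∃ C : ℝ, ∀ x ∈ Ω, ∀ y ∈ Ω, |u x - u y| ≤ C * dist x y ^ γ

/-- `p ∈ 𝒫^log(Ω)`: log-Hölder continuity. -/
def IsLogHolder {n : ℕ} (Ω : Set (Space n)) (p : Space n → ℝ) : Prop :=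
  ∃ c > 0, ∃ δ ∈ Ioo (0 : ℝ) 1, ∀ x ∈ Ω, ∀ y ∈ Ω, dist x y < δ →
    |p x - p y| ≤ c / Real.log (1 / dist x y)

/-- `ω` is a modulus of continuity of `a` on `Ω`. -/
structure IsModulusOfContinuity {n : ℕ} (Ω : Set (Space n)) (a : Space n → ℝ) (ω : ℝ → ℝ) :
    Prop where
  mono : MonotoneOn ω (Ici 0)
  tendsto_zero : Tendsto ω (𝓝[≥] 0) (𝓝 0)
  bound : ∀ x ∈ Ω, ∀ y ∈ Ω, |a x - a y| ≤ ω (dist x y)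

/-- Weak `N`-functions `M : Ω × ℝⁿ → [0, ∞)`. -/
structure IsWeakNFunction {n : ℕ} (Ω : Set (Space n)) (M : Space n → Space n → ℝ) : Prop where
  nonneg : ∀ x ∈ Ω, ∀ ξ, 0 ≤ M x ξ
  measurable : ∀ ξ, AEMeasurable (fun x => M x ξ) (volume.restrict Ω)
  continuous : ∀ᵐ x ∂volume.restrict Ω, Continuous (M x)
  zero : ∀ᵐ x ∂volume.restrict Ω, M x 0 = 0
  convex : ∀ᵐ x ∂volume.restrict Ω, ConvexOn ℝ univ (M x)
  even : ∀ᵐ x ∂volume.restrict Ω, ∀ ξ, M x ξ = M x (-ξ)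
  bounds : ∃ m₁ m₂ : ℝ → ℝ, ConvexOn ℝ (Ici 0) m₁ ∧ ConvexOn ℝ (Ici 0) m₂ ∧
    m₁ 0 = 0 ∧ (∀ s > 0, 0 < m₁ s) ∧ (∀ s ≥ 0, 0 ≤ m₂ s) ∧
    ∀ᵐ x ∂volume.restrict Ω, ∀ ξ, m₁ ‖ξ‖ ≤ M x ξ ∧ M x ξ ≤ m₂ ‖ξ‖

/-- Young functions `φ : [0, ∞) → [0, ∞)`, i.e. weak `N`-functions of one variable `t = |ξ|`
(only the values at `t ≥ 0` matter). -/
def IsYoungFunction (φ : ℝ → ℝ) : Prop :=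
  ConvexOn ℝ (Ici 0) φ ∧ φ 0 = 0 ∧ ∀ t > 0, 0 < φ t

/-- The `Δ₂` condition close to infinity for a function of one variable. -/
def IsDoubling (φ : ℝ → ℝ) : Prop :=
  ∃ c > 0, ∃ C > 0, ∃ h ≥ 0, ∀ t > C, φ (2 * t) ≤ c * φ t + h

/-- The Musielak-Orlicz class of measurable fields `ξ` on `Ω` with `∫_Ω M(x, ξ(x)) dx < ∞`. -/
def orliczClass {n : ℕ} (Ω : Set (Space n)) (M : Space n → Space n → ℝ) :
    Set (Space n → Space n) :=
  {ξ | AEStronglyMeasurable ξ (volume.restrict Ω) ∧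
    ∫⁻ x in Ω, ENNReal.ofReal (M x (ξ x)) < ∞}

/-- The Musielak-Orlicz space `L_M(Ω; ℝⁿ)`, the smallest linear space containing the class. -/
def orliczSpace {n : ℕ} (Ω : Set (Space n)) (M : Space n → Space n → ℝ) :
    Submodule ℝ (Space n → Space n) :=
  Submodule.span ℝ (orliczClass Ω M)

/-- `u ∈ W^{1,1}(Ω)` with distributional gradient `G` (functions on `Ω` are represented by
functions on `ℝⁿ` whose values outside `Ω` are irrelevant). -/
structure MemW11 {n : ℕ} (Ω : Set (Space n)) (u : Space n → ℝ) (G : Space n → Space n) :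
    Prop where
  integrable : IntegrableOn u Ω
  integrable_grad : IntegrableOn G Ω
  weak_grad : ∀ φ, IsTestFunction Ω φ → ∀ i : Fin n,
    ∫ x in Ω, u x * gradient φ x i = -∫ x in Ω, G x i * φ x

/-- `u ∈ W^{1,1}_0(Ω)`, the closure of `C_c^∞(Ω)` in `W^{1,1}(Ω)`, with gradient `G`. -/
def MemW11Zero {n : ℕ} (Ω : Set (Space n)) (u : Space n → ℝ) (G : Space n → Space n) : Prop :=
  MemW11 Ω u G ∧ ∃ φ : ℕ → Space n → ℝ, (∀ k, IsTestFunction Ω (φ k)) ∧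
    Tendsto (fun k => ∫⁻ x in Ω, ‖φ k x - u x‖ₑ) atTop (𝓝 0) ∧
    Tendsto (fun k => ∫⁻ x in Ω, ‖gradient (φ k) x - G x‖ₑ) atTop (𝓝 0)

/-- `u ∈ V^1 L_M(Ω)` with gradient `G`. -/
def MemV {n : ℕ} (Ω : Set (Space n)) (M : Space n → Space n → ℝ)
    (u : Space n → ℝ) (G : Space n → Space n) : Prop :=
  MemW11 Ω u G ∧ G ∈ orliczSpace Ω M

/-- `u ∈ V^1_0 L_M(Ω)` with gradient `G`. -/
def MemVZero {n : ℕ} (Ω : Set (Space n)) (M : Space n → Space n → ℝ)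
    (u : Space n → ℝ) (G : Space n → Space n) : Prop :=
  MemW11Zero Ω u G ∧ G ∈ orliczSpace Ω M

/-- `F` is measurable in the first variable and jointly continuous in the other two. -/
structure IsCaratheodory {n : ℕ} (Ω : Set (Space n)) (F : Space n → ℝ → Space n → ℝ) :
    Prop where
  measurable : ∀ z ξ, AEMeasurable (fun x => F x z ξ) (volume.restrict Ω)
  continuous : ∀ x ∈ Ω, Continuous (fun w : ℝ × Space n => F x w.1 w.2)

/-- The growth condition `ν M(x, βξ) ≤ F(x, z, ξ) ≤ L (M(x, ξ) + 1)`. -/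
def HasGrowth {n : ℕ} (Ω : Set (Space n)) (M : Space n → Space n → ℝ)
    (F : Space n → ℝ → Space n → ℝ) : Prop :=
  ∃ ν ∈ Ioo (0 : ℝ) 1, ∃ β ∈ Ioo (0 : ℝ) 1, ∃ L > (1 : ℝ), ∀ x ∈ Ω, ∀ z ξ,
    ν * M x (β • ξ) ≤ F x z ξ ∧ F x z ξ ≤ L * (M x ξ + 1)

/-- `∫_Ω F(x, u, G) dx`, for integrands that are nonnegative on `Ω` (which the growth condition
guarantees). -/
noncomputable def energy {n : ℕ} (Ω : Set (Space n)) (F : Space n → ℝ → Space n → ℝ)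
    (u : Space n → ℝ) (G : Space n → Space n) : ℝ≥0∞ :=
  ∫⁻ x in Ω, ENNReal.ofReal (F x (u x) (G x))

/-- The infimum of the functional over `u₀ + C_c^∞(Ω)`, where `G₀ = ∇u₀`. -/
noncomputable def smoothInf {n : ℕ} (Ω : Set (Space n)) (F : Space n → ℝ → Space n → ℝ)
    (u₀ : Space n → ℝ) (G₀ : Space n → Space n) : ℝ≥0∞ :=
  ⨅ (φ : Space n → ℝ) (_ : IsTestFunction Ω φ),
    energy Ω F (fun x => u₀ x + φ x) (fun x => G₀ x + gradient φ x)

/-- Absence of Lavrentiev's phenomenon between `V^{1,M}_0(Ω)` and `C_c^∞(Ω)`: for every boundary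
datum `u₀ ∈ V^1 L_M(Ω)` the infima over `u₀ + V^1_0 L_M(Ω)` and `u₀ + C_c^∞(Ω)` agree. -/
def NoGap {n : ℕ} (Ω : Set (Space n)) (M : Space n → Space n → ℝ)
    (F : Space n → ℝ → Space n → ℝ) : Prop :=
  ∀ u₀ G₀, MemV Ω M u₀ G₀ →
    (⨅ (v : Space n → ℝ) (H : Space n → Space n) (_ : MemVZero Ω M v H),
      energy Ω F (fun x => u₀ x + v x) (fun x => G₀ x + H x)) = smoothInf Ω F u₀ G₀

/-- Absence of Lavrentiev's phenomenon between `V^{1,M}_0(Ω) ∩ C^{0,γ}(Ω)` and `C_c^∞(Ω)`, for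
every boundary datum `u₀ ∈ V^1 L_M(Ω) ∩ C^{0,γ}(Ω)`. -/
def NoGapHolder {n : ℕ} (γ : ℝ) (Ω : Set (Space n)) (M : Space n → Space n → ℝ)
    (F : Space n → ℝ → Space n → ℝ) : Prop :=
  ∀ u₀ G₀, MemV Ω M u₀ G₀ → IsHolder γ Ω u₀ →
    (⨅ (v : Space n → ℝ) (H : Space n → Space n) (_ : MemVZero Ω M v H ∧ IsHolder γ Ω v),
      energy Ω F (fun x => u₀ x + v x) (fun x => G₀ x + H x)) = smoothInf Ω F u₀ G₀

end Lavrentiev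

open Lavrentiev

/-! Test functions are admissible competitors, so only one inequality is at stake: a competitor `v`
with gradient `H` has to be approximated by test functions `w k` such that `w k → v` and `∇(w k) →
H` almost everywhere, while the modulars `M x (∇(w k) x)` stay below one integrable function. The
growth condition and dominated convergence (`tendsto_energy`) then carry the energies to the limit.
The doubling condition absorbs the gradient of the boundary datum (`smoothInf_le_energy`).

The `w k` are mollifications, at scale `δ`, of the zero extension of `v`. They are localised by a
partition of unity, and each kernel is shifted so that near the boundary it samples only points
outside `Ω`; this gives compact support in `Ω`. If the zero extension is `γ`-Hölder, the mollified
gradient has size at most a constant times `δ ^ (γ - 1)` (`norm_mollify_grad_le`). Hence `M` needs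
to be controlled on balls of radius comparable to `δ` only for `ξ` in that range, which is the
content of `IsBalanced`: up to constants, a convex `m` lies below every `M y` on the ball and above
`M x` in the range. Jensen's inequality for `m` bounds `M x` of the mollified gradient by the
mollification of `y ↦ M y (H y)`, and the latter converges in `L¹` (`map_mollify_grad_le`,
`exists_test_approx`).

For (B), a Hölder function in `W^{1,1}_0` has a Hölder zero extension
(`MemW11Zero.exists_holder_indicator`). For (A), the truncations `k * arctan (v / k)` reduce to
bounded functions, whose zero extensions have bounded oscillation; this is the case `γ = 0` of the
same approximation.

In the models, `m` is obtained by freezing exponents and coefficients at their infima over the ball.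
The condition `q - p ≤ α / (1 - γ)` is what keeps `δ ^ α * t ^ (q - p)` bounded for `1 ≤ t ≤ R * δ ^
(γ - 1)`, and log-Hölder continuity keeps `t` to the power of the oscillation of the exponent
bounded. Regularity passes to sums and to compositions with seminorms, so the multi-phase and
orthotropic cases reduce to the scalar results `isRegularFun_power`, `isRegularFun_orlicz` and
`isRegularFun_log`. -/

namespace Lavrentiev

/-! ### Shifted mollification: Jensen's inequality and gradient bounds. -/

section Kernel

variable {n : ℕ}

/-- A smooth nonnegative function of integral one supported in the closed unit ball. -/
noncomputable def bump (n : ℕ) : Space n → ℝ :=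
  (⟨1 / 2, 1, by norm_num, by norm_num⟩ : ContDiffBump (0 : Space n)).normed volume

lemma bump_nonneg (x : Space n) : 0 ≤ bump n x := ContDiffBump.nonneg_normed _ _

lemma bump_contDiff : ContDiff ℝ (⊤ : ℕ∞) (bump n) := ContDiffBump.contDiff_normed _

lemma bump_integral : ∫ x, bump n x = 1 := ContDiffBump.integral_normed _

lemma bump_tsupport : tsupport (bump n) = Metric.closedBall 0 1 :=
  ContDiffBump.tsupport_normed_eq _

/-- The mollification kernel of radius `δ`, shifted by `δ • e`. -/
noncomputable def kernel (δ : ℝ) (e : Space n) (u : Space n) : ℝ :=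
  (δ ^ n)⁻¹ * bump n (δ⁻¹ • u - e)

lemma kernel_nonneg {δ : ℝ} (hδ : 0 < δ) (e u : Space n) : 0 ≤ kernel δ e u :=
  mul_nonneg (by positivity) (bump_nonneg _)

lemma kernel_contDiff (δ : ℝ) (e : Space n) : ContDiff ℝ (⊤ : ℕ∞) (kernel δ e) := by
  unfold kernel
  exact contDiff_const.mul (bump_contDiff.comp (by fun_prop))

lemma integral_rescale {F : Type*} [NormedAddCommGroup F] [NormedSpace ℝ F] (f : Space n → F)
    {δ : ℝ} (hδ : 0 < δ) (e : Space n) :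
    ∫ u, f (δ⁻¹ • u - e) = δ ^ n • ∫ z, f z := by
  have h := Measure.integral_comp_smul_of_nonneg (volume : Measure (Space n))
    (fun u => f (u - e)) δ⁻¹ (hR := by positivity)
  rw [h, integral_sub_right_eq_self f e]
  simp

lemma kernel_integral {δ : ℝ} (hδ : 0 < δ) (e : Space n) : ∫ u, kernel δ e u = 1 := by
  unfold kernel
  rw [integral_const_mul, integral_rescale (bump n) hδ e, bump_integral]
  have : δ ^ n ≠ 0 := by positivity
  simp [this]

lemma norm_le_of_rescale {δ : ℝ} (hδ : 0 < δ) {e u : Space n} (h : ‖δ⁻¹ • u - e‖ ≤ 1) :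
    ‖u - δ • e‖ ≤ δ := by
  have : u - δ • e = δ • (δ⁻¹ • u - e) := by
    rw [smul_sub, smul_inv_smul₀ hδ.ne']
  rw [this, norm_smul, Real.norm_of_nonneg hδ.le]
  nlinarith

/-- Consequently `mollify δ e f x` averages `f` over the ball of radius `δ` about `x - δ • e`; the
direction `e` decides which side of `x` is sampled. -/
lemma kernel_support {δ : ℝ} (hδ : 0 < δ) {e u : Space n} (h : kernel δ e u ≠ 0) :
    ‖u - δ • e‖ ≤ δ := by
  have h1 : bump n (δ⁻¹ • u - e) ≠ 0 := right_ne_zero_of_mul h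
  have h2 := subset_tsupport _ (Function.mem_support.2 h1)
  rw [bump_tsupport, mem_closedBall_zero_iff] at h2
  exact norm_le_of_rescale hδ h2

lemma kernel_hasCompactSupport {δ : ℝ} (hδ : 0 < δ) (e : Space n) :
    HasCompactSupport (kernel δ e) := by
  refine HasCompactSupport.intro (isCompact_closedBall (δ • e) δ) fun x hx => ?_
  by_contra h
  exact hx (by simpa [Metric.mem_closedBall, dist_eq_norm] using kernel_support hδ h)

lemma kernel_continuous (δ : ℝ) (e : Space n) : Continuous (kernel δ e) :=
  (kernel_contDiff δ e).continuous

lemma kernel_bounded {δ : ℝ} (hδ : 0 < δ) (e : Space n) : ∃ B, ∀ u, ‖kernel δ e u‖ ≤ B :=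
  (kernel_hasCompactSupport hδ e).exists_bound_of_continuous (kernel_continuous δ e)

lemma kernel_integrable {δ : ℝ} (hδ : 0 < δ) (e : Space n) : Integrable (kernel δ e) :=
  (kernel_continuous δ e).integrable_of_hasCompactSupport (kernel_hasCompactSupport hδ e)

/-- The shifted mollification of `f`. -/
noncomputable def mollify {F : Type*} [NormedAddCommGroup F] [NormedSpace ℝ F]
    (δ : ℝ) (e : Space n) (f : Space n → F) (x : Space n) : F :=
  ∫ y, kernel δ e (x - y) • f y

variable {F : Type*} [NormedAddCommGroup F] [NormedSpace ℝ F]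

lemma integrable_kernel_smul {δ : ℝ} (hδ : 0 < δ) (e x : Space n) {f : Space n → F}
    (hf : Integrable f) : Integrable (fun y => kernel δ e (x - y) • f y) := by
  obtain ⟨B, hB⟩ := kernel_bounded hδ e
  exact hf.bdd_smul B ((kernel_continuous δ e).comp (by fun_prop)).aestronglyMeasurable
    (ae_of_all _ fun y => hB _)

lemma integral_kernel_sub {δ : ℝ} (hδ : 0 < δ) (e x : Space n) :
    ∫ y, kernel δ e (x - y) = 1 := by
  rw [integral_sub_left_eq_self (kernel δ e) volume x, kernel_integral hδ]

lemma lintegral_kernel {δ : ℝ} (hδ : 0 < δ) (e : Space n) :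
    ∫⁻ u, ENNReal.ofReal (kernel δ e u) = 1 := by
  rw [← ofReal_integral_eq_lintegral_ofReal (kernel_integrable hδ e)
    (ae_of_all _ (kernel_nonneg hδ e)), kernel_integral hδ, ENNReal.ofReal_one]

lemma mollify_eq_zero {δ : ℝ} (hδ : 0 < δ) (e x : Space n) {f : Space n → F}
    (h : ∀ y, ‖x - y - δ • e‖ ≤ δ → f y = 0) : mollify δ e f x = 0 := by
  unfold mollify
  rw [← integral_zero (Space n) F]
  congr 1
  ext y
  by_cases hk : kernel δ e (x - y) = 0
  · simp [hk]
  · simp [h y (kernel_support hδ hk)]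

lemma mollify_eq_of_eqOn {δ : ℝ} (hδ : 0 < δ) (e x : Space n) [CompleteSpace F]
    {f : Space n → F} {c : F}
    (h : ∀ y, ‖x - y - δ • e‖ ≤ δ → f y = c) : mollify δ e f x = c := by
  unfold mollify
  have : (fun y => kernel δ e (x - y) • f y) = fun y => kernel δ e (x - y) • c := by
    ext y
    by_cases hk : kernel δ e (x - y) = 0
    · simp [hk]
    · simp [h y (kernel_support hδ hk)]
  rw [this, integral_smul_const, integral_kernel_sub hδ, one_smul]

lemma norm_mollify_le {δ : ℝ} (hδ : 0 < δ) (e x : Space n) {f : Space n → F} {B : ℝ}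
    (h : ∀ y, ‖f y‖ ≤ B) : ‖mollify δ e f x‖ ≤ B := by
  unfold mollify
  have hi : Integrable (fun y => kernel δ e (x - y)) := (kernel_integrable hδ e).comp_sub_left x
  calc _ ≤ ∫ y, kernel δ e (x - y) * B := by
        refine norm_integral_le_of_norm_le (hi.mul_const B) (ae_of_all _ fun y => ?_)
        rw [norm_smul, Real.norm_of_nonneg (kernel_nonneg hδ e _)]
        exact mul_le_mul_of_nonneg_left (h y) (kernel_nonneg hδ e _)
    _ = B := by rw [integral_mul_const, integral_kernel_sub hδ, one_mul]

/-- Jensen's inequality for mollifications. -/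
lemma map_mollify_le {δ : ℝ} (hδ : 0 < δ) (e x : Space n) {H : Space n → Space n}
    (hH : Integrable H) {m : Space n → ℝ} (hm : ConvexOn ℝ univ m) (hm0 : ∀ ξ, 0 ≤ m ξ)
    {g : Space n → ℝ} (hg : Integrable g) {C : ℝ}
    (h : ∀ y, ‖x - y - δ • e‖ ≤ δ → m (H y) ≤ C * (g y + 1)) :
    m (mollify δ e H x) ≤ C * (mollify δ e g x + 1) := by
  have hc : Continuous m := hm.locallyLipschitz.continuous
  set κ : Space n → ℝ≥0 := fun y => (kernel δ e (x - y)).toNNReal with hκ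
  have hκm : Measurable κ :=
    ((kernel_continuous δ e).comp (by fun_prop : Continuous fun y => x - y)).measurable.real_toNNReal
  have hκr : ∀ y, (κ y : ℝ) = kernel δ e (x - y) := fun y =>
    Real.coe_toNNReal _ (kernel_nonneg hδ e _)
  have hki : Integrable (fun y => kernel δ e (x - y)) := (kernel_integrable hδ e).comp_sub_left x
  -- The kernel is the density of a probability measure, for which the mollification is a mean.
  let μ : Measure (Space n) := volume.withDensity fun y => (κ y : ℝ≥0∞)
  have hprob : IsProbabilityMeasure μ := by
    refine ⟨?_⟩
    rw [withDensity_apply _ MeasurableSet.univ, Measure.restrict_univ]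
    have := lintegral_sub_left_eq_self (μ := (volume : Measure (Space n)))
      (fun u => ENNReal.ofReal (kernel δ e u)) x
    exact this.trans (lintegral_kernel hδ e)
  -- The hypothesis `h` covers only the support of the kernel; elsewhere both sides vanish. This
  -- bound also yields the integrability of `m ∘ H` against the kernel, which Jensen's inequality
  -- requires.
  have hd : ∀ y, ‖(kernel δ e (x - y)) • m (H y)‖ ≤
      C * (kernel δ e (x - y) * g y) + C * kernel δ e (x - y) := by
    intro y
    rw [norm_smul, Real.norm_of_nonneg (kernel_nonneg hδ e _), Real.norm_of_nonneg (hm0 _)]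
    by_cases hk : kernel δ e (x - y) = 0
    · simp [hk]
    · nlinarith [mul_le_mul_of_nonneg_left (h y (kernel_support hδ hk)) (kernel_nonneg hδ e (x - y))]
  have hdi : Integrable fun y =>
      C * (kernel δ e (x - y) * g y) + C * kernel δ e (x - y) :=
    ((integrable_kernel_smul hδ e x hg).const_mul C).add (hki.const_mul C)
  have hmi : Integrable fun y => kernel δ e (x - y) • m (H y) :=
    hdi.mono' (((kernel_continuous δ e).comp (by fun_prop)).aestronglyMeasurable.smul
      (hc.comp_aestronglyMeasurable hH.1)) (ae_of_all _ hd)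
  have e1 : mollify δ e H x = ∫ y, H y ∂μ := by
    rw [integral_withDensity_eq_integral_smul hκm]
    simp only [NNReal.smul_def, hκr, mollify]
  have e2 : ∫ y, kernel δ e (x - y) • m (H y) = ∫ y, m (H y) ∂μ := by
    rw [integral_withDensity_eq_integral_smul hκm]
    simp only [NNReal.smul_def, hκr]
  have h1 : m (∫ y, H y ∂μ) ≤ ∫ y, m (H y) ∂μ := by
    refine hm.map_integral_le hc.continuousOn isClosed_univ (by simp) ?_ ?_
    · rw [integrable_withDensity_iff_integrable_smul hκm]
      simpa only [NNReal.smul_def, hκr] using integrable_kernel_smul hδ e x hH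
    · rw [integrable_withDensity_iff_integrable_smul hκm]
      simp only [NNReal.smul_def, hκr]
      exact hmi
  rw [e1]
  refine h1.trans ?_
  rw [← e2]
  calc _ ≤ ∫ y, (C * (kernel δ e (x - y) * g y) + C * kernel δ e (x - y)) :=
        integral_mono hmi hdi fun y => (le_abs_self _).trans (hd y)
    _ = C * (mollify δ e g x + 1) := by
        have hkg : Integrable fun y => kernel δ e (x - y) * g y := integrable_kernel_smul hδ e x hg
        rw [integral_add (hkg.const_mul C) (hki.const_mul C), integral_const_mul, integral_const_mul, integral_kernel_sub hδ]
        simp only [mollify, smul_eq_mul]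
        ring

lemma mollify_eq_convolution (δ : ℝ) (e : Space n) (f : Space n → ℝ) :
    mollify δ e f = convolution f (kernel δ e) (ContinuousLinearMap.mul ℝ ℝ) volume := by
  ext x
  simp [mollify, convolution, mul_comm]

lemma mollify_contDiff {δ : ℝ} (hδ : 0 < δ) (e : Space n) {f : Space n → ℝ}
    (hf : Integrable f) : ContDiff ℝ (⊤ : ℕ∞) (mollify δ e f) := by
  have := (kernel_hasCompactSupport hδ e).contDiff_convolution_right
    (ContinuousLinearMap.mul ℝ ℝ) (μ := volume) hf.locallyIntegrable (kernel_contDiff δ e)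
  rwa [mollify_eq_convolution]

lemma mollify_hasFDerivAt {δ : ℝ} (hδ : 0 < δ) (e : Space n) {f : Space n → ℝ}
    (hf : Integrable f) (x : Space n) :
    ∃ A : Space n →L[ℝ] ℝ, HasFDerivAt (mollify δ e f) A x ∧
      ∀ h, A h = ∫ y, f y * fderiv ℝ (kernel δ e) (x - y) h := by
  have hk : ContDiff ℝ 1 (kernel δ e) := (kernel_contDiff δ e).of_le (by exact_mod_cast le_top)
  have := (kernel_hasCompactSupport hδ e).hasFDerivAt_convolution_right
    (ContinuousLinearMap.mul ℝ ℝ) (μ := volume) hf.locallyIntegrable hk x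
  refine ⟨_, ?_, fun h => convolution_precompR_apply (ContinuousLinearMap.mul ℝ ℝ)
    hf.locallyIntegrable ((kernel_hasCompactSupport hδ e).fderiv ℝ)
    (hk.continuous_fderiv one_ne_zero) x h⟩
  rwa [mollify_eq_convolution]

/-- `G` is the distributional gradient of `f` on the whole space. -/
def IsWeakGrad (f : Space n → ℝ) (G : Space n → Space n) : Prop :=
  ∀ ψ : Space n → ℝ, ContDiff ℝ (⊤ : ℕ∞) ψ → HasCompactSupport ψ → ∀ h : Space n,
    ∫ y, f y * fderiv ℝ ψ y h = -∫ y, inner ℝ (G y) h * ψ y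

/-- The derivative falls on the kernel; testing the weak gradient with `y ↦ kernel δ e (x - y)`
moves it to `f`. The sign from the reflection cancels the one from integration by parts. -/
lemma mollify_hasGradientAt {δ : ℝ} (hδ : 0 < δ) (e : Space n) {f : Space n → ℝ}
    {G : Space n → Space n} (hf : Integrable f) (hG : Integrable G) (h : IsWeakGrad f G)
    (x : Space n) : HasGradientAt (mollify δ e f) (mollify δ e G x) x := by
  obtain ⟨A, hA, hAv⟩ := mollify_hasFDerivAt hδ e hf x
  rw [hasGradientAt_iff_hasFDerivAt]
  suffices hs : InnerProductSpace.toDual ℝ (Space n) (mollify δ e G x) = A by rwa [hs]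
  ext v
  rw [InnerProductSpace.toDual_apply_apply, hAv, mollify,
    real_inner_comm, ← integral_inner (integrable_kernel_smul hδ e x hG)]
  have hd : Differentiable ℝ (kernel δ e) := (kernel_contDiff δ e).differentiable (by simp)
  have := h (fun y => kernel δ e (x - y)) ((kernel_contDiff δ e).comp (by fun_prop))
    ((kernel_hasCompactSupport hδ e).comp_homeomorph (Homeomorph.subLeft x)) v
  have e1 : ∀ y, fderiv ℝ (fun y => kernel δ e (x - y)) y v =
      -(fderiv ℝ (kernel δ e) (x - y) v) := by
    intro y
    have h1 : HasFDerivAt (fun y => x - y) (-(ContinuousLinearMap.id ℝ (Space n))) y :=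
      (hasFDerivAt_id y).const_sub x
    have h2 := ((hd (x - y)).hasFDerivAt.comp y h1).fderiv
    rw [show (fun y => kernel δ e (x - y)) = kernel δ e ∘ fun y => x - y from rfl, h2]
    simp
  simp only [e1, mul_neg, integral_neg, neg_inj] at this
  rw [this]
  congr 1
  ext y
  rw [real_inner_smul_right, mul_comm, real_inner_comm]

/-- The `L¹` norm of the derivative of the standard bump. -/
noncomputable def bumpConst (n : ℕ) : ℝ := ∫ z, ‖fderiv ℝ (bump n) z‖

lemma bumpConst_nonneg : 0 ≤ bumpConst n := integral_nonneg fun _ => norm_nonneg _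

lemma fderiv_kernel (δ : ℝ) (e u : Space n) :
    fderiv ℝ (kernel δ e) u = ((δ ^ n)⁻¹ * δ⁻¹) • fderiv ℝ (bump n) (δ⁻¹ • u - e) := by
  have hd : Differentiable ℝ (bump n) := bump_contDiff.differentiable (by simp)
  have h1 : HasFDerivAt (fun u : Space n => δ⁻¹ • u - e)
      (δ⁻¹ • ContinuousLinearMap.id ℝ (Space n)) u :=
    ((hasFDerivAt_id u).const_smul δ⁻¹).sub_const e
  have h2 := (((hd (δ⁻¹ • u - e)).hasFDerivAt.comp u h1).const_mul (δ ^ n)⁻¹).fderiv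
  rw [show kernel δ e = fun u => (δ ^ n)⁻¹ * (bump n ∘ fun u => δ⁻¹ • u - e) u from rfl, h2]
  ext v
  simp
  ring

lemma fderiv_kernel_support {δ : ℝ} (hδ : 0 < δ) {e u : Space n}
    (h : fderiv ℝ (kernel δ e) u ≠ 0) : ‖u - δ • e‖ ≤ δ := by
  rw [fderiv_kernel] at h
  have h2 := support_fderiv_subset ℝ (Function.mem_support.2 (right_ne_zero_of_smul h))
  rw [bump_tsupport, mem_closedBall_zero_iff] at h2
  exact norm_le_of_rescale hδ h2

lemma integral_norm_fderiv_kernel {δ : ℝ} (hδ : 0 < δ) (e x : Space n) :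
    ∫ y, ‖fderiv ℝ (kernel δ e) (x - y)‖ = δ⁻¹ * bumpConst n := by
  rw [integral_sub_left_eq_self (fun u => ‖fderiv ℝ (kernel δ e) u‖) volume x]
  simp_rw [fderiv_kernel, norm_smul, Real.norm_of_nonneg
    (show 0 ≤ (δ ^ n)⁻¹ * δ⁻¹ by positivity)]
  rw [integral_const_mul, integral_rescale (fun z => ‖fderiv ℝ (bump n) z‖) hδ e, smul_eq_mul,
    bumpConst]
  have : δ ^ n ≠ 0 := by positivity
  field_simp

/-- Integration by parts against the constant `1`. It permits subtracting a constant from `f` in the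
gradient estimate. -/
lemma integral_fderiv_kernel {δ : ℝ} (hδ : 0 < δ) (e x v : Space n) :
    ∫ y, fderiv ℝ (kernel δ e) (x - y) v = 0 := by
  rw [integral_sub_left_eq_self (fun u => fderiv ℝ (kernel δ e) u v) volume x]
  have hk : ContDiff ℝ 1 (kernel δ e) := (kernel_contDiff δ e).of_le (by exact_mod_cast le_top)
  have h := integral_mul_fderiv_eq_neg_fderiv_mul_of_integrable (μ := volume)
    (f := fun _ : Space n => (1 : ℝ)) (g := kernel δ e) (v := v) (by simp)
    (by
      simp only [one_mul]
      refine Continuous.integrable_of_hasCompactSupport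
        ((hk.continuous_fderiv one_ne_zero).clm_apply continuous_const) ?_
      exact ((kernel_hasCompactSupport hδ e).fderiv ℝ).comp_left
        (g := fun A : Space n →L[ℝ] ℝ => A v) (by simp))
    (by simpa using kernel_integrable hδ e) (by fun_prop)
    (fun x _ => hk.differentiable one_ne_zero x)
  simpa using h

/-- A `γ`-Hölder bound on `f` gives a `δ ^ (γ - 1)` bound on the gradient of its mollification. -/
lemma norm_mollify_grad_le {δ : ℝ} (hδ : 0 < δ) (e : Space n) {f : Space n → ℝ}
    {G : Space n → Space n} (hf : Integrable f) (hG : Integrable G) (h : IsWeakGrad f G)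
    {γ C : ℝ} (hγ : 0 ≤ γ) (hC : 0 ≤ C) (hfh : ∀ x y, |f x - f y| ≤ C * dist x y ^ γ)
    (x : Space n) : ‖mollify δ e G x‖ ≤ C * bumpConst n * δ ^ (γ - 1) := by
  obtain ⟨A, hA, hAv⟩ := mollify_hasFDerivAt hδ e hf x
  have hk : ContDiff ℝ 1 (kernel δ e) := (kernel_contDiff δ e).of_le (by exact_mod_cast le_top)
  have hfc : Continuous (fderiv ℝ (kernel δ e)) := hk.continuous_fderiv one_ne_zero
  have hcs := (kernel_hasCompactSupport hδ e).fderiv ℝ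
  have hfi : Integrable fun y => fderiv ℝ (kernel δ e) (x - y) :=
    (hfc.integrable_of_hasCompactSupport hcs).comp_sub_left x
  have hgr : InnerProductSpace.toDual ℝ (Space n) (mollify δ e G x) = A :=
    (hasGradientAt_iff_hasFDerivAt.1 (mollify_hasGradientAt hδ e hf hG h x)).unique hA
  have hn : ‖mollify δ e G x‖ = ‖A‖ := by
    rw [← hgr, LinearIsometryEquiv.norm_map]
  rw [hn]
  have hB := bumpConst_nonneg (n := n)
  refine A.opNorm_le_bound (by positivity) fun v => ?_
  have hvi : Integrable fun y => fderiv ℝ (kernel δ e) (x - y) v := hfi.apply_continuousLinearMap v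
  obtain ⟨B, hBd⟩ := hcs.exists_bound_of_continuous hfc
  have hfvi : Integrable fun y => f y * fderiv ℝ (kernel δ e) (x - y) v := by
    refine hf.mul_bdd (c := B * ‖v‖) hvi.1 (ae_of_all _ fun y => ?_)
    exact (ContinuousLinearMap.le_opNorm _ _).trans
      (mul_le_mul_of_nonneg_right (hBd _) (norm_nonneg _))
  -- The value at the centre of the sampled ball is subtracted for free. On the support the Hölder
  -- bound contributes `δ ^ γ`, and the derivative of the kernel has `L¹` norm `δ⁻¹ * bumpConst n`.
  have e1 : A v = ∫ y, (f y - f (x - δ • e)) * fderiv ℝ (kernel δ e) (x - y) v := by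
    simp_rw [sub_mul]
    rw [integral_sub hfvi (hvi.const_mul _), integral_const_mul, integral_fderiv_kernel hδ, hAv]
    simp
  rw [e1]
  calc _ ≤ ∫ y, C * δ ^ γ * ‖v‖ * ‖fderiv ℝ (kernel δ e) (x - y)‖ := by
        refine norm_integral_le_of_norm_le (hfi.norm.const_mul _) (ae_of_all _ fun y => ?_)
        by_cases hz : fderiv ℝ (kernel δ e) (x - y) = 0
        · simp [hz]
        have hs := fderiv_kernel_support hδ hz
        have hd : dist y (x - δ • e) ≤ δ := by
          rw [dist_comm, dist_eq_norm]
          rwa [sub_right_comm]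
        rw [norm_mul]
        have h1 : ‖f y - f (x - δ • e)‖ ≤ C * δ ^ γ :=
          (hfh _ _).trans (mul_le_mul_of_nonneg_left (Real.rpow_le_rpow dist_nonneg hd hγ) hC)
        calc _ ≤ (C * δ ^ γ) * (‖fderiv ℝ (kernel δ e) (x - y)‖ * ‖v‖) := by
              gcongr
              exact ContinuousLinearMap.le_opNorm _ _
          _ = _ := by ring
    _ = _ := by
        rw [integral_const_mul, integral_norm_fderiv_kernel hδ, Real.rpow_sub_one hδ.ne']
        ring

end Kernel
end Lavrentiev

namespace Lavrentiev

/-! ### `L¹` convergence of mollifications, dominated subsequences, Carathéodory measurability. -/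

section Convergence

variable {n : ℕ} {F : Type*} [NormedAddCommGroup F] [NormedSpace ℝ F]

/-- A continuous compactly supported approximation is uniformly continuous, and for shifts of norm
at most `1` it and its translates live in one compact set `K` of finite measure. -/
lemma exists_translate_le {f : Space n → F} (hf : Integrable f) {ε : ℝ≥0∞} (hε : ε ≠ 0) :
    ∃ r > 0, ∀ u : Space n, ‖u‖ ≤ r → ∫⁻ x, ‖f (x - u) - f x‖ₑ ≤ ε := by
  have hε3 : ε / 3 ≠ 0 := by simp [hε]
  obtain ⟨g, hgs, hfg, hgc, hgi⟩ := hf.exists_hasCompactSupport_lintegral_sub_le hε3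
  set K := Metric.cthickening 1 (tsupport g)
  have hK : IsCompact K := hgs.isCompact.cthickening
  have hfin : volume K ≠ ∞ := hK.measure_lt_top.ne
  obtain ⟨η, hη0, hη⟩ : ∃ η : ℝ≥0, 0 < η ∧ (η : ℝ≥0∞) * volume K ≤ ε / 3 := by
    obtain ⟨η, h0, h⟩ := ENNReal.exists_nnreal_pos_mul_lt hfin hε3
    exact ⟨η, h0, h.le⟩
  obtain ⟨r, hr, hru⟩ := Metric.uniformContinuous_iff.1 (hgs.uniformContinuous_of_continuous hgc)
    η (by exact_mod_cast hη0)
  refine ⟨min (r / 2) 1, by positivity, fun u hu => ?_⟩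
  have hu1 : ‖u‖ ≤ 1 := hu.trans (min_le_right _ _)
  have hur : ‖u‖ < r := lt_of_le_of_lt (hu.trans (min_le_left _ _)) (by linarith)
  have hg : ∫⁻ x, ‖g (x - u) - g x‖ₑ ≤ ε / 3 := by
    refine le_trans ?_ hη
    rw [← lintegral_indicator_const hK.measurableSet]
    refine lintegral_mono fun x => ?_
    by_cases hx : x ∈ K
    · rw [indicator_of_mem hx]
      have := hru (a := x - u) (b := x) (by simpa [dist_eq_norm] using hur)
      rw [dist_eq_norm] at this
      rw [enorm_eq_nnnorm]
      exact ENNReal.coe_le_coe.2 (NNReal.coe_le_coe.1 this.le)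
    · have h1 : g x = 0 := by
        by_contra h
        exact hx (Metric.self_subset_cthickening _ (subset_tsupport _ h))
      have h2 : g (x - u) = 0 := by
        by_contra h
        exact hx (Metric.mem_cthickening_of_dist_le x (x - u) 1 _ (subset_tsupport _ h)
          (by simpa [dist_eq_norm] using hu1))
      simp [h1, h2]
  have hfg' : ∫⁻ x, ‖f (x - u) - g (x - u)‖ₑ ≤ ε / 3 := by
    rwa [lintegral_sub_right_eq_self (fun x => ‖f x - g x‖ₑ) u]
  have hm : ∀ {p q : Space n → F}, AEStronglyMeasurable p volume → AEStronglyMeasurable q volume →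
      AEMeasurable (fun x => ‖p x - q x‖ₑ) volume := fun hp hq => (hp.sub hq).enorm
  have hfu := (hf.comp_sub_right u).1
  have hgu := (hgi.comp_sub_right u).1
  calc ∫⁻ x, ‖f (x - u) - f x‖ₑ
      ≤ ∫⁻ x, (‖f (x - u) - g (x - u)‖ₑ + ‖g (x - u) - g x‖ₑ + ‖f x - g x‖ₑ) := by
        refine lintegral_mono fun x => ?_
        have : f (x - u) - f x =
          (f (x - u) - g (x - u)) + (g (x - u) - g x) + -(f x - g x) := by abel
        rw [this, ← enorm_neg (f x - g x)]
        exact (enorm_add_le _ _).trans (add_le_add_left (enorm_add_le _ _) _)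
    _ ≤ ε / 3 + ε / 3 + ε / 3 := by
        rw [lintegral_add_right' _ (hm hf.1 hgi.1), lintegral_add_right' _ (hm hgu hgi.1)]
        gcongr
    _ = ε := ENNReal.add_thirds ε

/-- The error is a kernel average of translation errors; after exchanging the integrals, only shifts
with `‖u‖ ≤ δ * (1 + ‖e‖)` contribute. -/
lemma tendsto_mollify [CompleteSpace F] {f : Space n → F} (hf : Integrable f) (e : Space n) :
    Tendsto (fun δ : ℝ => ∫⁻ x, ‖mollify δ e f x - f x‖ₑ) (𝓝[>] 0) (𝓝 0) := by
  rw [ENNReal.tendsto_nhds_zero]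
  intro ε hε
  obtain ⟨r, hr, hru⟩ := exists_translate_le hf hε.ne'
  have h1 : ∀ᶠ δ : ℝ in 𝓝[>] 0, δ * (1 + ‖e‖) < r := by
    have : Tendsto (fun δ : ℝ => δ * (1 + ‖e‖)) (𝓝[>] 0) (𝓝 0) := by
      refine Tendsto.mono_left ?_ nhdsWithin_le_nhds
      have : Continuous fun δ : ℝ => δ * (1 + ‖e‖) := by fun_prop
      simpa using this.tendsto 0
    exact this.eventually_lt_const hr
  filter_upwards [h1, self_mem_nhdsWithin] with δ hδr hδ
  have hδ : 0 < δ := hδ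
  have hki : ∀ x, Integrable fun y => kernel δ e (x - y) := fun x =>
    (kernel_integrable hδ e).comp_sub_left x
  have hpt : ∀ x, ‖mollify δ e f x - f x‖ₑ ≤
      ∫⁻ u, ENNReal.ofReal (kernel δ e u) * ‖f (x - u) - f x‖ₑ := by
    intro x
    have e1 : mollify δ e f x - f x = ∫ y, kernel δ e (x - y) • (f y - f x) := by
      simp_rw [smul_sub]
      rw [integral_sub (integrable_kernel_smul hδ e x hf) ((hki x).smul_const _),
        integral_smul_const, integral_kernel_sub hδ, one_smul, mollify]
    rw [e1]
    refine (enorm_integral_le_lintegral_enorm _).trans ?_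
    rw [← lintegral_sub_left_eq_self
      (fun u => ENNReal.ofReal (kernel δ e u) * ‖f (x - u) - f x‖ₑ) x]
    refine lintegral_mono fun y => ?_
    rw [enorm_smul, Real.enorm_eq_ofReal (kernel_nonneg hδ e _), sub_sub_cancel]
  have hmeas : AEMeasurable (fun p : Space n × Space n =>
      ENNReal.ofReal (kernel δ e p.2) * ‖f (p.1 - p.2) - f p.1‖ₑ) (volume.prod volume) := by
    refine AEMeasurable.mul ?_ (AEStronglyMeasurable.enorm (AEStronglyMeasurable.sub ?_ ?_))
    · exact ((kernel_continuous δ e).measurable.comp measurable_snd).ennreal_ofReal.aemeasurable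
    · exact hf.1.comp_quasiMeasurePreserving
        (quasiMeasurePreserving_sub_of_right_invariant volume volume)
    · exact hf.1.comp_fst
  calc _ ≤ ∫⁻ x, ∫⁻ u, ENNReal.ofReal (kernel δ e u) * ‖f (x - u) - f x‖ₑ := lintegral_mono hpt
    _ = ∫⁻ u, ∫⁻ x, ENNReal.ofReal (kernel δ e u) * ‖f (x - u) - f x‖ₑ :=
        lintegral_lintegral_swap hmeas
    _ ≤ ∫⁻ u, ENNReal.ofReal (kernel δ e u) * ε := by
        refine lintegral_mono fun u => ?_
        rw [lintegral_const_mul' _ _ ENNReal.ofReal_ne_top]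
        by_cases hk : kernel δ e u = 0
        · simp [hk]
        refine mul_le_mul_right (hru u ?_) _
        have h2 := kernel_support hδ hk
        have h3 : ‖u‖ ≤ ‖u - δ • e‖ + ‖δ • e‖ := by
          simpa using norm_add_le (u - δ • e) (δ • e)
        rw [norm_smul, Real.norm_of_nonneg hδ.le] at h3
        nlinarith
    _ = ε := by
        rw [lintegral_mul_const _ (kernel_continuous δ e).measurable.ennreal_ofReal,
          lintegral_kernel hδ, one_mul]

/-- Along a subsequence the integrals are summable, so the pointwise sum is an integrable majorant;
where this sum is finite its terms tend to zero. -/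
lemma exists_dominated_subseq {α : Type*} [MeasurableSpace α] {μ : Measure α}
    {d : ℕ → α → ℝ≥0∞} (hd : ∀ k, AEMeasurable (d k) μ)
    (h : Tendsto (fun k => ∫⁻ x, d k x ∂μ) atTop (𝓝 0)) :
    ∃ ns : ℕ → ℕ, StrictMono ns ∧ ∃ D : α → ℝ≥0∞, AEMeasurable D μ ∧ ∫⁻ x, D x ∂μ ≠ ∞ ∧
      (∀ k x, d (ns k) x ≤ D x) ∧ ∀ᵐ x ∂μ, Tendsto (fun k => d (ns k) x) atTop (𝓝 0) := by
  obtain ⟨ε, hε0, hε⟩ := ENNReal.exists_pos_sum_of_countable (ε := 1) one_ne_zero ℕ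
  obtain ⟨ns, hns, hle⟩ := extraction_forall_of_eventually
    (P := fun k m => ∫⁻ x, d m x ∂μ ≤ ε k)
    (fun k => (ENNReal.tendsto_nhds_zero.1 h) (ε k) (by exact_mod_cast hε0 k))
  have hfin : ∫⁻ x, ∑' k, d (ns k) x ∂μ ≠ ∞ := by
    rw [lintegral_tsum fun k => hd _]
    exact ((ENNReal.tsum_le_tsum hle).trans hε.le).trans_lt ENNReal.one_lt_top |>.ne
  have hm : AEMeasurable (fun x => ∑' k, d (ns k) x) μ := AEMeasurable.tsum fun k => hd _
  refine ⟨ns, hns, _, hm, hfin, fun k x => ENNReal.le_tsum k, ?_⟩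
  filter_upwards [ae_lt_top' hm hfin] with x hx
  exact ENNReal.tendsto_atTop_zero_of_tsum_ne_top hx.ne

/-- Off a measurable null set `T`, `f x` is continuous and agrees on a dense sequence with
measurable representatives. Setting `f` to zero on `T` makes all sections measurable as limits,
hence the uncurried function jointly measurable. -/
lemma aemeasurable_caratheodory {α X : Type*} [MeasurableSpace α] {μ : Measure α}
    [TopologicalSpace X] [TopologicalSpace.MetrizableSpace X] [SecondCountableTopology X]
    [MeasurableSpace X] [BorelSpace X] [Nonempty X] {f : α → X → ℝ}
    (hf : ∀ w, AEMeasurable (fun x => f x w) μ) (hc : ∀ᵐ x ∂μ, Continuous (f x)) {w : α → X}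
    (hw : AEMeasurable w μ) : AEMeasurable (fun x => f x (w x)) μ := by
  let d := TopologicalSpace.denseSeq X
  have hae : ∀ᵐ x ∂μ, Continuous (f x) ∧ ∀ k, f x (d k) = (hf (d k)).mk _ x :=
    hc.and (ae_all_iff.2 fun k => (hf (d k)).ae_eq_mk)
  obtain ⟨T, hTsub, hTm, hTnull⟩ := exists_measurable_superset_of_null hae
  classical
  let g : X → α → ℝ := fun z x => if x ∈ T then 0 else f x z
  have hgood : ∀ x ∉ T, Continuous (f x) ∧ ∀ k, f x (d k) = (hf (d k)).mk _ x := by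
    intro x hx
    by_contra h
    exact hx (hTsub h)
  have hgc : ∀ x, Continuous fun z => g z x := by
    intro x
    by_cases hx : x ∈ T
    · simpa [g, hx] using continuous_const
    · simpa [g, hx] using (hgood x hx).1
  have hgd : ∀ k, Measurable (g (d k)) := by
    intro k
    have : g (d k) = fun x => if x ∈ T then 0 else (hf (d k)).mk _ x := by
      ext x
      by_cases hx : x ∈ T
      · simp [g, hx]
      · simp [g, hx, (hgood x hx).2 k]
    rw [this]
    exact Measurable.ite hTm measurable_const (hf (d k)).measurable_mk
  have hgm : ∀ z, Measurable (g z) := by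
    intro z
    obtain ⟨s, hs, hsz⟩ := mem_closure_iff_seq_limit.1
      ((TopologicalSpace.denseRange_denseSeq X).closure_eq ▸ mem_univ z)
    choose k hk using hs
    refine measurable_of_tendsto_metrizable (fun j => hgd (k j)) (tendsto_pi_nhds.2 fun x => ?_)
    have : Tendsto (fun j => g (s j) x) atTop (𝓝 (g z x)) := ((hgc x).tendsto z).comp hsz
    simpa only [d, hk] using this
  have hu := measurable_uncurry_of_continuous_of_measurable hgc hgm
  refine ⟨fun x => g (hw.mk w x) x, hu.comp (hw.measurable_mk.prodMk measurable_id), ?_⟩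
  have hT : ∀ᵐ x ∂μ, x ∉ T := measure_eq_zero_iff_ae_notMem.1 hTnull
  filter_upwards [hT, hw.ae_eq_mk] with x hx hwx
  simp [g, hx, hwx]

end Convergence
end Lavrentiev

namespace Lavrentiev

/-! ### Zero extension and the chain rule in `W^{1,1}_0`. -/

section SobolevZero

variable {n : ℕ} {Ω : Set (Space n)}

lemma IsTestFunction.eq_zero {φ : Space n → ℝ} (h : IsTestFunction Ω φ) {x : Space n}
    (hx : x ∉ Ω) : φ x = 0 :=
  image_eq_zero_of_notMem_tsupport fun h' => hx (h.2.2 h')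

lemma IsTestFunction.gradient_eq_zero {φ : Space n → ℝ} (h : IsTestFunction Ω φ) {x : Space n}
    (hx : x ∉ Ω) : gradient φ x = 0 := by
  have : fderiv ℝ φ x = 0 := by
    by_contra h'
    exact hx (h.2.2 (support_fderiv_subset ℝ h'))
  simp [gradient, this]

lemma IsTestFunction.differentiable {φ : Space n → ℝ} (h : IsTestFunction Ω φ) :
    Differentiable ℝ φ := h.1.differentiable (by simp)

lemma IsTestFunction.continuous_fderiv {φ : Space n → ℝ} (h : IsTestFunction Ω φ) :
    Continuous (fderiv ℝ φ) := h.1.continuous_fderiv (by simp)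

lemma IsTestFunction.continuous_gradient {φ : Space n → ℝ} (h : IsTestFunction Ω φ) :
    Continuous (gradient φ) :=
  (InnerProductSpace.toDual ℝ (Space n)).symm.continuous.comp h.continuous_fderiv

lemma IsTestFunction.hasCompactSupport_gradient {φ : Space n → ℝ} (h : IsTestFunction Ω φ) :
    HasCompactSupport (gradient φ) :=
  (h.2.1.fderiv ℝ).comp_left (g := (InnerProductSpace.toDual ℝ (Space n)).symm) (map_zero _)

lemma IsTestFunction.integrable {φ : Space n → ℝ} (h : IsTestFunction Ω φ) : Integrable φ :=
  h.1.continuous.integrable_of_hasCompactSupport h.2.1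

lemma IsTestFunction.integrable_gradient {φ : Space n → ℝ} (h : IsTestFunction Ω φ) :
    Integrable (gradient φ) :=
  h.continuous_gradient.integrable_of_hasCompactSupport h.hasCompactSupport_gradient

lemma gradient_apply (φ : Space n → ℝ) (x : Space n) (i : Fin n) :
    gradient φ x i = fderiv ℝ φ x (EuclideanSpace.single i 1) := by
  rw [← inner_gradient_left, EuclideanSpace.inner_single_right]
  simp

lemma lintegral_sub_indicator {F : Type*} [NormedAddCommGroup F] (hΩ : MeasurableSet Ω)
    {f g : Space n → F} (hf : ∀ x ∉ Ω, f x = 0) :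
    ∫⁻ x, ‖f x - Ω.indicator g x‖ₑ = ∫⁻ x in Ω, ‖f x - g x‖ₑ := by
  rw [← lintegral_indicator hΩ]
  congr 1
  ext x
  by_cases hx : x ∈ Ω
  · simp [hx]
  · simp [hx, hf x hx]

lemma IsTestFunction.isWeakGrad {φ : Space n → ℝ} (h : IsTestFunction Ω φ) :
    IsWeakGrad φ (gradient φ) := by
  intro ψ hψ hψc v
  have hψd : Differentiable ℝ ψ := hψ.differentiable (by simp)
  have hψf : Continuous (fderiv ℝ ψ) := hψ.continuous_fderiv (by simp)
  have hφc := h.1.continuous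
  have hφf := h.continuous_fderiv
  simp_rw [inner_gradient_left]
  refine integral_mul_fderiv_eq_neg_fderiv_mul_of_integrable ?_ ?_ ?_
    (fun x _ => h.differentiable x) (fun x _ => hψd x)
  · exact Continuous.integrable_of_hasCompactSupport
      ((hφf.clm_apply continuous_const).mul hψ.continuous) hψc.mul_left
  · exact Continuous.integrable_of_hasCompactSupport
      (hφc.mul (hψf.clm_apply continuous_const)) h.2.1.mul_right
  · exact Continuous.integrable_of_hasCompactSupport (hφc.mul hψ.continuous) hψc.mul_left

/-- The zero extension of an `L¹`-limit of test functions whose gradients converge is weakly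
differentiable on the whole space. -/
lemma isWeakGrad_indicator (hΩ : MeasurableSet Ω) {v : Space n → ℝ} {H : Space n → Space n}
    (hv : IntegrableOn v Ω) (hH : IntegrableOn H Ω) {φ : ℕ → Space n → ℝ}
    (hφ : ∀ k, IsTestFunction Ω (φ k))
    (h1 : Tendsto (fun k => ∫⁻ x in Ω, ‖φ k x - v x‖ₑ) atTop (𝓝 0))
    (h2 : Tendsto (fun k => ∫⁻ x in Ω, ‖gradient (φ k) x - H x‖ₑ) atTop (𝓝 0)) :
    IsWeakGrad (Ω.indicator v) (Ω.indicator H) := by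
  intro ψ hψ hψc w
  have hψf : Continuous (fderiv ℝ ψ) := hψ.continuous_fderiv (by simp)
  obtain ⟨B, hB⟩ := hψc.exists_bound_of_continuous hψ.continuous
  have hψfc : Continuous fun y => fderiv ℝ ψ y w := hψf.clm_apply continuous_const
  obtain ⟨B', hB'⟩ := ((hψc.fderiv ℝ).comp_left (g := fun A : Space n →L[ℝ] ℝ => A w)
    (by simp)).exists_bound_of_continuous hψfc
  have hv' : Integrable (Ω.indicator v) := (integrable_indicator_iff hΩ).2 hv
  have hH' : Integrable (Ω.indicator H) := (integrable_indicator_iff hΩ).2 hH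
  have i1 : ∀ f : Space n → ℝ, Integrable f → Integrable fun y => f y * fderiv ℝ ψ y w :=
    fun f hf => hf.mul_bdd (c := B') hψfc.aestronglyMeasurable (ae_of_all _ hB')
  have i2 : ∀ f : Space n → Space n, Integrable f → Integrable fun y => inner ℝ (f y) w * ψ y :=
    fun f hf => (hf.inner_const w).mul_bdd (c := B) hψ.continuous.aestronglyMeasurable
      (ae_of_all _ hB)
  have t1 : Tendsto (fun k => ∫ y, φ k y * fderiv ℝ ψ y w) atTop
      (𝓝 (∫ y, Ω.indicator v y * fderiv ℝ ψ y w)) := by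
    refine tendsto_integral_of_L1 _ (i1 _ hv').1 (Eventually.of_forall fun k => i1 _ (hφ k).integrable) ?_
    have hz : Tendsto (fun k => ENNReal.ofReal B' * ∫⁻ x, ‖φ k x - Ω.indicator v x‖ₑ) atTop
        (𝓝 0) := by
      simp_rw [lintegral_sub_indicator hΩ fun x hx => (hφ _).eq_zero hx]
      simpa using ENNReal.Tendsto.const_mul h1 (Or.inr ENNReal.ofReal_ne_top)
    refine tendsto_of_tendsto_of_tendsto_of_le_of_le tendsto_const_nhds hz (fun _ => zero_le)
      fun k => ?_
    dsimp only
    rw [← lintegral_const_mul' _ _ ENNReal.ofReal_ne_top]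
    refine lintegral_mono fun x => ?_
    rw [← sub_mul, enorm_mul, mul_comm]
    gcongr
    rw [← ofReal_norm]
    exact ENNReal.ofReal_le_ofReal (hB' x)
  have t2 : Tendsto (fun k => ∫ y, inner ℝ (gradient (φ k) y) w * ψ y) atTop
      (𝓝 (∫ y, inner ℝ (Ω.indicator H y) w * ψ y)) := by
    refine tendsto_integral_of_L1 _ (i2 _ hH').1
      (Eventually.of_forall fun k => i2 _ (hφ k).integrable_gradient) ?_
    have hz : Tendsto (fun k => ENNReal.ofReal (‖w‖ * B) *
        ∫⁻ x, ‖gradient (φ k) x - Ω.indicator H x‖ₑ) atTop (𝓝 0) := by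
      simp_rw [lintegral_sub_indicator hΩ fun x hx => (hφ _).gradient_eq_zero hx]
      simpa using ENNReal.Tendsto.const_mul (a := ENNReal.ofReal (‖w‖ * B)) h2
        (Or.inr ENNReal.ofReal_ne_top)
    refine tendsto_of_tendsto_of_tendsto_of_le_of_le tendsto_const_nhds hz (fun _ => zero_le)
      fun k => ?_
    dsimp only
    rw [← lintegral_const_mul' _ _ ENNReal.ofReal_ne_top]
    refine lintegral_mono fun x => ?_
    rw [← sub_mul, ← inner_sub_left, ← ofReal_norm, ← ofReal_norm,
      ← ENNReal.ofReal_mul (mul_nonneg (norm_nonneg _) ((norm_nonneg _).trans (hB x))), norm_mul]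
    refine ENNReal.ofReal_le_ofReal ?_
    calc _ ≤ (‖gradient (φ k) x - Ω.indicator H x‖ * ‖w‖) * B :=
          mul_le_mul (norm_inner_le_norm _ _) (hB x) (norm_nonneg _) (by positivity)
      _ = _ := by ring
  -- For each `φ k` the identity is an integration by parts over the whole space: the test function
  -- `ψ` may cross the boundary of `Ω`, since `φ k` vanishes near it. Both sides pass to the limit.
  refine tendsto_nhds_unique t1 ?_
  convert t2.neg using 2 with k
  exact (hφ k).isWeakGrad ψ hψ hψc w

lemma memW11Zero_of_tendsto (hΩ : MeasurableSet Ω) {v : Space n → ℝ} {H : Space n → Space n}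
    (hv : IntegrableOn v Ω) (hH : IntegrableOn H Ω) {φ : ℕ → Space n → ℝ}
    (hφ : ∀ k, IsTestFunction Ω (φ k))
    (h1 : Tendsto (fun k => ∫⁻ x in Ω, ‖φ k x - v x‖ₑ) atTop (𝓝 0))
    (h2 : Tendsto (fun k => ∫⁻ x in Ω, ‖gradient (φ k) x - H x‖ₑ) atTop (𝓝 0)) :
    MemW11Zero Ω v H := by
  refine ⟨⟨hv, hH, fun ψ hψ i => ?_⟩, φ, hφ, h1, h2⟩
  have := isWeakGrad_indicator hΩ hv hH hφ h1 h2 ψ hψ.1 hψ.2.1 (EuclideanSpace.single i 1)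
  simp_rw [gradient_apply]
  rw [← integral_indicator hΩ, ← integral_indicator hΩ]
  have e1 : (Ω.indicator fun x => v x * fderiv ℝ ψ x (EuclideanSpace.single i 1)) =
      fun x => Ω.indicator v x * fderiv ℝ ψ x (EuclideanSpace.single i 1) := by
    ext x
    by_cases hx : x ∈ Ω <;> simp [hx]
  have e2 : (Ω.indicator fun x => H x i * ψ x) =
      fun x => inner ℝ (Ω.indicator H x) (EuclideanSpace.single i 1) * ψ x := by
    ext x
    by_cases hx : x ∈ Ω <;> simp [hx, EuclideanSpace.inner_single_right]
  rw [e1, e2, this]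

lemma IsTestFunction.memW11Zero (hΩ : MeasurableSet Ω) {φ : Space n → ℝ}
    (h : IsTestFunction Ω φ) : MemW11Zero Ω φ (gradient φ) :=
  memW11Zero_of_tendsto hΩ h.integrable.integrableOn h.integrable_gradient.integrableOn
    (φ := fun _ => φ) (fun _ => h) (by simp) (by simp)

lemma IsTestFunction.comp {φ : Space n → ℝ} (h : IsTestFunction Ω φ) {S : ℝ → ℝ}
    (hS : ContDiff ℝ (⊤ : ℕ∞) S) (hS0 : S 0 = 0) : IsTestFunction Ω (fun x => S (φ x)) :=
  ⟨hS.comp h.1, h.2.1.comp_left hS0, 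
    (closure_mono (Function.support_comp_subset hS0 φ)).trans h.2.2⟩

lemma gradient_comp {φ : Space n → ℝ} {S : ℝ → ℝ} {x : Space n} (hφ : DifferentiableAt ℝ φ x)
    (hS : DifferentiableAt ℝ S (φ x)) :
    gradient (fun x => S (φ x)) x = deriv S (φ x) • gradient φ x := by
  have h := (hS.hasDerivAt.comp_hasFDerivAt x hφ.hasFDerivAt).fderiv
  have h' : fderiv ℝ (fun x => S (φ x)) x = deriv S (φ x) • fderiv ℝ φ x := h
  simp [gradient, h']

/-- Chain rule in `W^{1,1}_0`. -/
lemma MemW11Zero.comp (hΩ : MeasurableSet Ω) {v : Space n → ℝ} {H : Space n → Space n}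
    (h : MemW11Zero Ω v H) {S : ℝ → ℝ} (hS : ContDiff ℝ (⊤ : ℕ∞) S) (hS0 : S 0 = 0) {B : ℝ≥0}
    (hB : ∀ s, ‖deriv S s‖ ≤ B) :
    MemW11Zero Ω (fun x => S (v x)) (fun x => deriv S (v x) • H x) := by
  obtain ⟨⟨hv, hH, -⟩, φ, hφ, h1, h2⟩ := h
  have hSd : Differentiable ℝ S := hS.differentiable (by simp)
  have hS' : Continuous (deriv S) := hS.continuous_deriv (by simp)
  have hLip : LipschitzWith B S := lipschitzWith_of_nnnorm_deriv_le hSd fun s => by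
    exact_mod_cast hB s
  have hBe : ∀ s, ‖deriv S s‖ₑ ≤ B := fun s => ENNReal.coe_le_coe.2 (by exact_mod_cast hB s)
  have hd : ∀ k, AEMeasurable (fun x => ‖φ k x - v x‖ₑ) (volume.restrict Ω) := fun k =>
    ((hφ k).integrable.integrableOn.1.sub hv.1).enorm
  -- Almost everywhere convergence of the approximants is needed for the term `(S'(φ) - S'(v)) • H`,
  -- which tends to zero by dominated convergence; the other term, `S'(φ) • (∇φ - H)`, is controlled
  -- by `B`.
  obtain ⟨ns, hns, D, -, -, -, hae⟩ := exists_dominated_subseq hd h1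
  have hae' : ∀ᵐ x ∂volume.restrict Ω, Tendsto (fun k => φ (ns k) x) atTop (𝓝 (v x)) := by
    filter_upwards [hae] with x hx
    rw [tendsto_iff_edist_tendsto_0]
    simpa [edist_eq_enorm_sub] using hx
  have hSv : IntegrableOn (fun x => S (v x)) Ω := by
    refine (hv.norm.const_mul (B : ℝ)).mono' (hS.continuous.comp_aestronglyMeasurable hv.1)
      (ae_of_all _ fun x => ?_)
    simpa [hS0] using hLip.norm_sub_le (v x) 0
  have hSm : AEStronglyMeasurable (fun x => deriv S (v x)) (volume.restrict Ω) :=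
    hS'.comp_aestronglyMeasurable hv.1
  have hSH : IntegrableOn (fun x => deriv S (v x) • H x) Ω :=
    hH.bdd_smul (B : ℝ) hSm (ae_of_all _ fun x => hB _)
  refine memW11Zero_of_tendsto hΩ hSv hSH (φ := fun k x => S (φ (ns k) x))
    (fun k => (hφ _).comp hS hS0) ?_ ?_
  · have hz : Tendsto (fun k => (B : ℝ≥0∞) * ∫⁻ x in Ω, ‖φ (ns k) x - v x‖ₑ) atTop (𝓝 0) := by
      simpa using ENNReal.Tendsto.const_mul (h1.comp hns.tendsto_atTop)
        (Or.inr ENNReal.coe_ne_top)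
    refine tendsto_of_tendsto_of_tendsto_of_le_of_le tendsto_const_nhds hz (fun _ => zero_le)
      fun k => ?_
    dsimp only
    rw [← lintegral_const_mul' _ _ ENNReal.coe_ne_top]
    refine lintegral_mono fun x => ?_
    simpa [edist_eq_enorm_sub] using hLip (φ (ns k) x) (v x)
  · have hz1 : Tendsto (fun k => (B : ℝ≥0∞) * ∫⁻ x in Ω, ‖gradient (φ (ns k)) x - H x‖ₑ) atTop
        (𝓝 0) := by
      simpa using ENNReal.Tendsto.const_mul (h2.comp hns.tendsto_atTop)
        (Or.inr ENNReal.coe_ne_top)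
    have hz2 : Tendsto (fun k => ∫⁻ x in Ω, ‖deriv S (φ (ns k) x) - deriv S (v x)‖ₑ * ‖H x‖ₑ)
        atTop (𝓝 0) := by
      have := tendsto_lintegral_of_dominated_convergence' (μ := volume.restrict Ω)
        (F := fun k x => ‖deriv S (φ (ns k) x) - deriv S (v x)‖ₑ * ‖H x‖ₑ) (f := fun _ => 0)
        (fun x => (B + B : ℝ≥0∞) * ‖H x‖ₑ)
        (fun k => (((hS'.comp_aestronglyMeasurable
          (hφ _).integrable.integrableOn.1).sub hSm).enorm).mul hH.1.enorm)
        (fun k => ae_of_all _ fun x => by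
          exact mul_le_mul_left (enorm_sub_le.trans (add_le_add (hBe _) (hBe _))) _) ?_ ?_
      · simpa using this
      · rw [lintegral_const_mul' _ _ (by simp)]
        exact ENNReal.mul_ne_top (by simp) hH.2.ne
      · filter_upwards [hae'] with x hx
        have h3 : Tendsto (fun k => deriv S (φ (ns k) x)) atTop (𝓝 (deriv S (v x))) :=
          (hS'.tendsto _).comp hx
        rw [tendsto_iff_edist_tendsto_0] at h3
        simp_rw [edist_eq_enorm_sub] at h3
        simpa using ENNReal.Tendsto.mul_const h3 (Or.inr enorm_ne_top)
    have hz := hz1.add hz2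
    rw [add_zero] at hz
    refine tendsto_of_tendsto_of_tendsto_of_le_of_le tendsto_const_nhds hz (fun _ => zero_le)
      fun k => ?_
    dsimp only
    have hm : AEMeasurable (fun x => (B : ℝ≥0∞) * ‖gradient (φ (ns k)) x - H x‖ₑ)
        (volume.restrict Ω) :=
      ((hφ _).integrable_gradient.integrableOn.1.sub hH.1).enorm.const_mul _
    rw [← lintegral_const_mul' _ _ ENNReal.coe_ne_top, ← lintegral_add_left' hm]
    refine lintegral_mono fun x => ?_
    rw [gradient_comp ((hφ _).differentiable x) (hSd _)]
    have : deriv S (φ (ns k) x) • gradient (φ (ns k)) x - deriv S (v x) • H x =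
      deriv S (φ (ns k) x) • (gradient (φ (ns k)) x - H x) +
        (deriv S (φ (ns k) x) - deriv S (v x)) • H x := by
      rw [smul_sub, sub_smul]; abel
    rw [this]
    refine (enorm_add_le _ _).trans ?_
    rw [enorm_smul, enorm_smul]
    gcongr
    exact hBe _

lemma MemW11Zero.integrable_indicator (hΩ : MeasurableSet Ω) {v : Space n → ℝ}
    {H : Space n → Space n} (h : MemW11Zero Ω v H) : Integrable (Ω.indicator v) :=
  (integrable_indicator_iff hΩ).2 h.1.integrable

lemma MemW11Zero.integrable_indicator_grad (hΩ : MeasurableSet Ω) {v : Space n → ℝ}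
    {H : Space n → Space n} (h : MemW11Zero Ω v H) : Integrable (Ω.indicator H) :=
  (integrable_indicator_iff hΩ).2 h.1.integrable_grad

lemma MemW11Zero.isWeakGrad (hΩ : MeasurableSet Ω) {v : Space n → ℝ} {H : Space n → Space n}
    (h : MemW11Zero Ω v H) : IsWeakGrad (Ω.indicator v) (Ω.indicator H) := by
  obtain ⟨⟨hv, hH, -⟩, φ, hφ, h1, h2⟩ := h
  exact isWeakGrad_indicator hΩ hv hH hφ h1 h2

end SobolevZero
end Lavrentiev

namespace Lavrentiev

/-! ### Inward shifts and partitions of unity on Lipschitz domains. -/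

section Geometry

variable {n : ℕ} {Ω : Set (Space n)}

lemma IsBoundedLipschitzDomain.ne_univ (hn : 1 ≤ n) (hΩ : IsBoundedLipschitzDomain Ω) :
    Ω ≠ univ := by
  rintro rfl
  have : Nonempty (Fin n) := ⟨⟨0, hn⟩⟩
  have := hΩ.isBounded
  exact NormedSpace.unbounded_univ ℝ (Space n) this

lemma IsBoundedLipschitzDomain.measurableSet (hΩ : IsBoundedLipschitzDomain Ω) :
    MeasurableSet Ω := hΩ.isOpen.measurableSet

lemma IsBoundedLipschitzDomain.volume_ne_top (hΩ : IsBoundedLipschitzDomain Ω) :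
    volume Ω ≠ ∞ := hΩ.isBounded.measure_lt_top.ne

/-- Near a boundary point, points close to the complement of a Lipschitz domain stay outside the
domain when they are moved along a suitable fixed vector. -/
lemma IsBoundedLipschitzDomain.exists_shift (hΩ : IsBoundedLipschitzDomain Ω) {x₀ : Space n}
    (hx₀ : x₀ ∈ frontier Ω) : ∃ r > 0, ∃ (e : Space n) (δ₀ : ℝ), 0 < δ₀ ∧ ∀ δ ∈ Ioo 0 δ₀,
      ∀ x ∈ Metric.ball x₀ r, ∀ z ∉ Ω, dist x z < δ → ∀ y, ‖x - y - δ • e‖ ≤ δ → y ∉ Ω := by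
  obtain ⟨e, g, K, r, he, hg, hr, hloc⟩ := hΩ.locally_graph x₀ hx₀
  -- Relative to `z`, the height of `y` changes by at most `2 * δ` apart from the drop `δ * κ`, and
  -- the graph function by at most `K * (4 * δ)`. This `κ` makes the drop equal to the sum of the
  -- two.
  set κ : ℝ := 4 * K + 2 with hκ
  have hκ0 : 0 < κ := by positivity
  refine ⟨r / 2, by positivity, κ • e, r / 2 / (κ + 3), by positivity, ?_⟩
  rintro δ ⟨hδ, hδ0⟩ x hx z hz hxz y hy
  rw [lt_div_iff₀ (by positivity)] at hδ0
  rw [Metric.mem_ball] at hx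
  have hzb : z ∈ Metric.ball x₀ r := by
    rw [Metric.mem_ball]
    have := dist_triangle_left z x₀ x
    nlinarith
  have hxy : dist x y ≤ δ * (κ + 1) := by
    rw [dist_eq_norm]
    have h1 := norm_add_le (x - y - δ • κ • e) (δ • κ • e)
    rw [sub_add_cancel, norm_smul, norm_smul, he, Real.norm_of_nonneg hδ.le,
      Real.norm_of_nonneg hκ0.le] at h1
    nlinarith
  have hyb : y ∈ Metric.ball x₀ r := by
    rw [Metric.mem_ball]
    have := dist_triangle_left y x₀ x
    nlinarith
  rw [hloc y hyb, not_lt]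
  have hz' := (not_congr (hloc z hzb)).1 hz
  rw [not_lt] at hz'
  -- `s` is the displacement from `z` to `y` with the vertical shift removed; it is a difference of
  -- two vectors of norm at most `δ`.
  set s : Space n := y - z + (δ * κ) • e with hs
  have hsn : ‖s‖ ≤ 2 * δ := by
    have : s = (x - z) - (x - y - δ • κ • e) := by rw [hs, smul_smul]; abel
    rw [this]
    refine (norm_sub_le _ _).trans ?_
    rw [← dist_eq_norm x z]
    linarith
  have hee : inner ℝ e e = (1 : ℝ) := by rw [real_inner_self_eq_norm_sq, he]; norm_num
  have hes : |inner ℝ e s| ≤ 2 * δ := by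
    have := abs_real_inner_le_norm e s
    rw [he, one_mul] at this
    exact this.trans hsn
  have hy1 : inner ℝ e y = inner ℝ e z + inner ℝ e s - δ * κ := by
    rw [hs, inner_add_right, inner_sub_right, inner_smul_right, hee]
    ring
  have hP : dist (z - inner ℝ e z • e) (y - inner ℝ e y • e) ≤ 4 * δ := by
    have : (z - inner ℝ e z • e) - (y - inner ℝ e y • e) = inner ℝ e s • e - s := by
      rw [hy1, hs]
      module
    rw [dist_eq_norm, this]
    refine (norm_sub_le _ _).trans ?_
    rw [norm_smul, he, Real.norm_eq_abs]
    linarith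
  have hgK := hg.dist_le_mul (z - inner ℝ e z • e) (y - inner ℝ e y • e)
  rw [Real.dist_eq] at hgK
  have h1 := (abs_le.1 hgK).2
  have h2 : (K : ℝ) * dist (z - inner ℝ e z • e) (y - inner ℝ e y • e) ≤ K * (4 * δ) :=
    mul_le_mul_of_nonneg_left hP K.2
  have h3 := (abs_le.1 hes).2
  have h4 : δ * κ = K * (4 * δ) + 2 * δ := by rw [hκ]; ring
  linarith

/-- A smooth partition of unity on a Lipschitz domain together with inward shifts. -/
lemma IsBoundedLipschitzDomain.exists_partition (hΩ : IsBoundedLipschitzDomain Ω) :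
    ∃ (ι : Type) (_ : Fintype ι) (θ : ι → Space n → ℝ) (e : ι → Space n) (δ₀ : ℝ), 0 < δ₀ ∧
      (∀ i, ContDiff ℝ (⊤ : ℕ∞) (θ i)) ∧ (∀ i x, 0 ≤ θ i x) ∧ (∀ x ∈ Ω, ∑ i, θ i x = 1) ∧
      (∃ B, ∀ i, ∀ x ∈ Ω, ‖gradient (θ i) x‖ ≤ B) ∧
      ∀ δ ∈ Ioo 0 δ₀, ∀ i x, θ i x ≠ 0 → ∀ z ∉ Ω, dist x z < δ →
        ∀ y, ‖x - y - δ • e i‖ ≤ δ → y ∉ Ω := by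
  have hcl : IsCompact (closure Ω) := hΩ.isBounded.isCompact_closure
  have hfr : IsCompact (frontier Ω) := hcl.of_isClosed_subset isClosed_frontier frontier_subset_closure
  choose! r hr e δ₀ hδ₀ hsh using fun x₀ hx₀ => hΩ.exists_shift (x₀ := x₀) hx₀
  obtain ⟨t, ht, htc⟩ := hfr.elim_nhds_subcover (fun x => Metric.ball x (r x))
    fun x hx => Metric.ball_mem_nhds x (hr x hx)
  -- The index `none` stands for the interior piece, which needs no shift; the others are boundary
  -- balls.
  let U : Option (Fin t.card) → Set (Space n) := fun o =>
    o.elim Ω fun i => Metric.ball (t.equivFin.symm i : Space n) (r (t.equivFin.symm i))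
  have hUo : ∀ o, IsOpen (U o) := by
    rintro (_ | i)
    · exact hΩ.isOpen
    · exact Metric.isOpen_ball
  have hUc : closure Ω ⊆ ⋃ o, U o := by
    intro x hx
    by_cases hxΩ : x ∈ Ω
    · exact mem_iUnion.2 ⟨none, hxΩ⟩
    · have : x ∈ frontier Ω := by
        rw [hΩ.isOpen.frontier_eq]
        exact ⟨hx, hxΩ⟩
      obtain ⟨y, hy, hxy⟩ := mem_iUnion₂.1 (htc this)
      refine mem_iUnion.2 ⟨some (t.equivFin ⟨y, hy⟩), ?_⟩
      simpa [U] using hxy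
  obtain ⟨f, hf⟩ := SmoothPartitionOfUnity.exists_isSubordinate
    (modelWithCornersSelf ℝ (Space n)) isClosed_closure U hUo hUc
  have hsm : ∀ i, ContDiff ℝ (⊤ : ℕ∞) (f i) := fun i => (f i).contMDiff.contDiff
  obtain ⟨δ₁, hδ₁, hthick⟩ : ∃ δ₁ > 0, Metric.thickening δ₁ (tsupport (f none)) ⊆ Ω := by
    refine IsCompact.exists_thickening_subset_open ?_ hΩ.isOpen (hf none)
    exact hcl.of_isClosed_subset (isClosed_tsupport _) ((hf none).trans subset_closure)
  have hmin : ∃ δm > 0, ∀ x ∈ t, δm ≤ δ₀ x := by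
    by_cases hne : t.Nonempty
    · obtain ⟨x, hx, hxm⟩ := t.exists_min_image δ₀ hne
      exact ⟨δ₀ x, hδ₀ x (ht x hx), hxm⟩
    · exact ⟨1, one_pos, fun x hx => absurd ⟨x, hx⟩ hne⟩
  obtain ⟨δm, hδm, hδmle⟩ := hmin
  refine ⟨Option (Fin t.card), inferInstance, fun i => f i,
    fun o => o.elim 0 fun i => e (t.equivFin.symm i), min δ₁ δm, lt_min hδ₁ hδm, hsm,
    fun i x => f.nonneg i x, fun x hx => ?_, ?_, ?_⟩
  · rw [← finsum_eq_sum_of_fintype]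
    exact f.sum_eq_one (subset_closure hx)
  · have hb : ∀ i, ∃ B, ∀ x ∈ closure Ω, ‖gradient (f i) x‖ ≤ B := fun i => by
      refine hcl.exists_bound_of_continuousOn (Continuous.continuousOn ?_)
      exact (InnerProductSpace.toDual ℝ (Space n)).symm.continuous.comp
        ((hsm i).continuous_fderiv (by simp))
    choose B hB using hb
    refine ⟨∑ i, |B i|, fun i x hx => (hB i x (subset_closure hx)).trans ?_⟩
    exact (le_abs_self _).trans
      (Finset.single_le_sum (f := fun i => |B i|) (fun _ _ => abs_nonneg _) (Finset.mem_univ i))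
  -- For the interior piece the claim is vacuous: its support has a `δ₁`-neighbourhood inside `Ω`,
  -- so no `z ∉ Ω` is that close.
  · rintro δ ⟨hδ, hδlt⟩ (_ | i) x hx z hz hxz y hy
    · refine absurd (hthick ?_) hz
      refine Metric.mem_thickening_iff.2 ⟨x, subset_tsupport _ hx, ?_⟩
      rw [dist_comm]
      exact hxz.trans (hδlt.trans_le (min_le_left _ _))
    · set p := t.equivFin.symm i
      refine hsh p (ht p p.2) δ ⟨hδ, ?_⟩ x (hf (some i) (subset_tsupport _ hx)) z hz hxz y hy
      exact hδlt.trans_le ((min_le_right _ _).trans (hδmle p p.2))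

end Geometry

/-! ### Vanishing boundary values and Hölder continuity of zero extensions. -/

section Boundary

variable {n : ℕ} {Ω : Set (Space n)}

/-- Composition with `S` turns a function exceeding `ℓ` into the constant `1` and keeps zero
boundary values. -/
lemma exists_smoothStep {ℓ : ℝ} (hℓ : 0 < ℓ) : ∃ S : ℝ → ℝ, ContDiff ℝ (⊤ : ℕ∞) S ∧ S 0 = 0 ∧
    (∃ B : ℝ≥0, ∀ s, ‖deriv S s‖ ≤ B) ∧ ∀ s > ℓ, S s = 1 ∧ deriv S s = 0 := by
  let S : ℝ → ℝ := fun s => Real.smoothTransition (s / ℓ)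
  have hS : ContDiff ℝ (⊤ : ℕ∞) S := Real.smoothTransition.contDiff.comp (by fun_prop)
  have h1 : ∀ s > ℓ, S s = 1 := fun s hs =>
    Real.smoothTransition.one_of_one_le ((one_le_div hℓ).2 hs.le)
  have hd1 : ∀ s > ℓ, deriv S s = 0 := fun s hs => by
    have : S =ᶠ[𝓝 s] fun _ => 1 := by
      filter_upwards [lt_mem_nhds hs] with x hx using h1 x hx
    rw [this.deriv_eq, deriv_const]
  have hd0 : ∀ s < 0, deriv S s = 0 := fun s hs => by
    have : S =ᶠ[𝓝 s] fun _ => 0 := by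
      filter_upwards [gt_mem_nhds hs] with x hx
      exact Real.smoothTransition.zero_of_nonpos (div_nonpos_of_nonpos_of_nonneg hx.le hℓ.le)
    rw [this.deriv_eq, deriv_const]
  have hc : HasCompactSupport (deriv S) := by
    refine HasCompactSupport.intro (isCompact_Icc (a := 0) (b := ℓ)) fun s hs => ?_
    rw [mem_Icc, not_and_or, not_le, not_le] at hs
    exact hs.elim (hd0 s) (hd1 s)
  obtain ⟨B, hB⟩ := hc.exists_bound_of_continuous (hS.continuous_deriv (by simp))
  refine ⟨S, hS, by simp [S], ⟨B.toNNReal, fun s => (hB s).trans (Real.le_coe_toNNReal B)⟩,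
    fun s hs => ⟨h1 s hs, hd1 s hs⟩⟩

/-- A function in `W^{1,1}_0` cannot be bounded below by a positive constant near a boundary
point. -/
lemma MemW11Zero.not_ge_near_boundary (hΩ : IsBoundedLipschitzDomain Ω) {v : Space n → ℝ}
    {H : Space n → Space n} (h : MemW11Zero Ω v H) {x₀ : Space n} (hx₀ : x₀ ∈ frontier Ω)
    {ρ ℓ : ℝ} (hρ : 0 < ρ) (hℓ : 0 < ℓ) : ¬ ∀ y ∈ Ω ∩ Metric.ball x₀ ρ, ℓ < v y := by
  intro hge
  obtain ⟨S, hS, hS0, ⟨B, hB⟩, hS1⟩ := exists_smoothStep hℓ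
  have hm := hΩ.measurableSet
  have hw := h.comp hm hS hS0 hB
  -- If `v > ℓ` near `x₀`, the zero extension `w` of `S ∘ v` jumps from `1` to `0` across the
  -- boundary while its weak gradient `G` vanishes in the ball. A shifted mollification of `w` is
  -- then constant near `x₀`, yet is `0` at `x₀` and `1` at a nearby point `z` of `Ω`.
  set w := Ω.indicator fun x => S (v x)
  set G := Ω.indicator fun x => deriv S (v x) • H x
  have hG0 : ∀ y ∈ Metric.ball x₀ ρ, G y = 0 := by
    intro y hy
    by_cases hyΩ : y ∈ Ω
    · simp [G, hyΩ, (hS1 _ (hge y ⟨hyΩ, hy⟩)).2]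
    · simp [G, hyΩ]
  obtain ⟨r, hr, e, δ₀, hδ₀, hsh⟩ := hΩ.exists_shift hx₀
  have hx₀Ω : x₀ ∉ Ω := by
    rw [hΩ.isOpen.frontier_eq] at hx₀
    exact hx₀.2
  obtain ⟨z, hzΩ, hz⟩ : ∃ z ∈ Ω, dist x₀ z < ρ / 2 :=
    Metric.mem_closure_iff.1 (frontier_subset_closure hx₀) _ (by positivity)
  obtain ⟨ε, hε, hεΩ⟩ := Metric.isOpen_iff.1 hΩ.isOpen z hzΩ
  obtain ⟨δ, hδ, hδ0, hδρ, hδε⟩ : ∃ δ > 0, δ < δ₀ ∧ δ * (1 + ‖e‖) < ρ / 2 ∧ δ * (1 + ‖e‖) < ε := by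
    have hc : Tendsto (fun δ : ℝ => δ * (1 + ‖e‖)) (𝓝[>] 0) (𝓝 0) := by
      refine Tendsto.mono_left ?_ nhdsWithin_le_nhds
      have : Continuous fun δ : ℝ => δ * (1 + ‖e‖) := by fun_prop
      simpa using this.tendsto 0
    have h1 : ∀ᶠ δ : ℝ in 𝓝[>] 0, δ < δ₀ :=
      (tendsto_id.mono_right nhdsWithin_le_nhds).eventually_lt_const hδ₀
    obtain ⟨δ, ⟨⟨h1, h2⟩, h3⟩, h4⟩ := (((h1.and (hc.eventually_lt_const (half_pos hρ))).and
      (hc.eventually_lt_const hε)).and self_mem_nhdsWithin).exists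
    exact ⟨δ, h4, h1, h2, h3⟩
  have hnear : ∀ x y, ‖x - y - δ • e‖ ≤ δ → dist x y ≤ δ * (1 + ‖e‖) := by
    intro x y hxy
    have h1 := norm_add_le (x - y - δ • e) (δ • e)
    rw [sub_add_cancel, norm_smul, Real.norm_of_nonneg hδ.le] at h1
    rw [dist_eq_norm]
    nlinarith
  have hgr : ∀ x, HasGradientAt (mollify δ e w) (mollify δ e G x) x :=
    mollify_hasGradientAt hδ e (hw.integrable_indicator hm) (hw.integrable_indicator_grad hm)
      (hw.isWeakGrad hm)
  have hzero : mollify δ e w x₀ = 0 := by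
    refine mollify_eq_zero hδ e x₀ fun y hy => indicator_of_notMem ?_ _
    exact hsh δ ⟨hδ, hδ0⟩ x₀ (Metric.mem_ball_self hr) x₀ hx₀Ω (by simpa using hδ) y hy
  have hzρ : z ∈ Metric.ball x₀ (ρ / 2) := by rwa [Metric.mem_ball, dist_comm]
  have hone : mollify δ e w z = 1 := by
    refine mollify_eq_of_eqOn hδ e z fun y hy => ?_
    have hzy := hnear z y hy
    have hyΩ : y ∈ Ω := hεΩ (by rw [Metric.mem_ball, dist_comm]; linarith)
    have hyρ : y ∈ Metric.ball x₀ ρ := by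
      rw [Metric.mem_ball]
      have := dist_triangle y z x₀
      rw [dist_comm y z, dist_comm z x₀] at this
      linarith
    simp [w, hyΩ, (hS1 _ (hge y ⟨hyΩ, hyρ⟩)).1]
  have hconst := Metric.isOpen_ball.is_const_of_fderiv_eq_zero (𝕜 := ℝ)
    (f := mollify δ e w) (s := Metric.ball x₀ (ρ / 2)) (convex_ball x₀ (ρ / 2)).isPreconnected
    (fun x _ => (hgr x).differentiableAt.differentiableWithinAt) (fun x hx => by
      have h0 : mollify δ e G x = 0 := by
        refine mollify_eq_zero hδ e x fun y hy => hG0 y ?_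
        rw [Metric.mem_ball] at hx ⊢
        have h1 := dist_triangle y x x₀
        have h2 := hnear x y hy
        rw [dist_comm y x] at h1
        linarith
      have := (hasGradientAt_iff_hasFDerivAt.1 (hgr x)).fderiv
      rw [this, h0]
      simp) hzρ (Metric.mem_ball_self (half_pos hρ))
  rw [hzero, hone] at hconst
  exact one_ne_zero hconst

/-- If the bound failed, Hölder continuity measured from `x` would keep `v` above a positive
constant at all points of `Ω` near `x₀`. -/
lemma MemW11Zero.le_of_holder (hΩ : IsBoundedLipschitzDomain Ω) {v : Space n → ℝ}
    {H : Space n → Space n} (h : MemW11Zero Ω v H) {γ C : ℝ} (hγ : 0 < γ)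
    (hv : ∀ x ∈ Ω, ∀ y ∈ Ω, |v x - v y| ≤ C * dist x y ^ γ) {x₀ x : Space n}
    (hx₀ : x₀ ∈ frontier Ω) (hx : x ∈ Ω) : v x ≤ C * dist x x₀ ^ γ := by
  by_contra! hlt
  have hc : Continuous fun y => v x - C * dist x y ^ γ :=
    continuous_const.sub (continuous_const.mul
      ((continuous_const.dist continuous_id).rpow_const fun _ => Or.inr hγ.le))
  set ℓ := (v x - C * dist x x₀ ^ γ) / 2 with hℓdef
  have hℓ : 0 < ℓ := by rw [hℓdef]; linarith
  have hev : ∀ᶠ y in 𝓝 x₀, ℓ < v x - C * dist x y ^ γ :=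
    hc.continuousAt.eventually_const_lt (by dsimp only; linarith)
  obtain ⟨ρ, hρ, hball⟩ := Metric.eventually_nhds_iff_ball.1 hev
  refine h.not_ge_near_boundary hΩ hx₀ hρ hℓ fun y hy => ?_
  have h1 := hball y hy.2
  have h2 := (abs_le.1 (hv x hx y hy.1)).2
  linarith

lemma MemW11Zero.neg (hΩ : MeasurableSet Ω) {v : Space n → ℝ} {H : Space n → Space n}
    (h : MemW11Zero Ω v H) : MemW11Zero Ω (fun x => -v x) fun x => -H x := by
  have := h.comp hΩ (S := fun s => -s) contDiff_neg (by simp) (B := 1) (by simp)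
  simpa using this

/-- The zero extension of a Hölder continuous function in `W^{1,1}_0` is Hölder continuous. -/
lemma MemW11Zero.exists_holder_indicator (hn : 1 ≤ n) (hΩ : IsBoundedLipschitzDomain Ω)
    {v : Space n → ℝ} {H : Space n → Space n} (h : MemW11Zero Ω v H) {γ : ℝ} (hγ : 0 ≤ γ)
    (hv : IsHolder γ Ω v) : ∃ C ≥ 0, (∀ x y, |Ω.indicator v x - Ω.indicator v y| ≤ C * dist x y ^ γ) ∧
      ∀ x, |Ω.indicator v x| ≤ C := by
  obtain ⟨-, C, hC⟩ := hv
  obtain ⟨p, hp⟩ := hΩ.isConnected.nonempty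
  obtain ⟨d, hd⟩ := Metric.isBounded_iff.1 hΩ.isBounded
  have hbd : ∃ B ≥ 0, ∀ x, |Ω.indicator v x| ≤ B := by
    refine ⟨|v p| + |C| * |d| ^ γ, by positivity, fun x => ?_⟩
    by_cases hx : x ∈ Ω
    · rw [indicator_of_mem hx]
      have h1 := hC x hx p hp
      have h2 : C * dist x p ^ γ ≤ |C| * |d| ^ γ := by
        gcongr
        · exact le_abs_self C
        · exact (hd hx hp).trans (le_abs_self d)
      have h3 := abs_sub_abs_le_abs_sub (v x) (v p)
      linarith
    · rw [indicator_of_notMem hx, abs_zero]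
      positivity
  obtain ⟨B, hB0, hB⟩ := hbd
  have hC' : ∀ x ∈ Ω, ∀ y ∈ Ω, |v x - v y| ≤ |C| * dist x y ^ γ := fun x hx y hy =>
    (hC x hx y hy).trans (by gcongr; exact le_abs_self C)
  rcases hγ.eq_or_lt with rfl | hγ
  · refine ⟨2 * B, by positivity, fun x y => ?_, fun x => (hB x).trans (by linarith)⟩
    rw [Real.rpow_zero, mul_one]
    exact (abs_sub _ _).trans (by linarith [hB x, hB y])
  · have hout : ∀ x ∈ Ω, ∀ y ∉ Ω, |v x| ≤ |C| * dist x y ^ γ := by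
      intro x hx y hy
      -- The frontier point nearest to `x` is no farther away than the exterior point `y`, so the
      -- boundary decay at `z` gives the bound at `y`.
      obtain ⟨z, hz, hzd⟩ := exists_mem_frontier_infDist_compl_eq_dist hx (hΩ.ne_univ hn)
      have hzy : dist x z ≤ dist x y := hzd ▸ Metric.infDist_le_dist_of_mem hy
      have hmono : |C| * dist x z ^ γ ≤ |C| * dist x y ^ γ := by gcongr
      refine (abs_le'.2 ⟨h.le_of_holder hΩ hγ hC' hz hx, ?_⟩).trans hmono
      refine (h.neg hΩ.measurableSet).le_of_holder hΩ hγ (fun a ha b hb => ?_) hz hx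
      rw [neg_sub_neg, abs_sub_comm]
      exact hC' a ha b hb
    refine ⟨max |C| B, by positivity, fun x y => ?_, fun x => (hB x).trans (le_max_right _ _)⟩
    refine le_trans ?_ (mul_le_mul_of_nonneg_right (le_max_left |C| B) (by positivity))
    by_cases hx : x ∈ Ω <;> by_cases hy : y ∈ Ω
    · simpa [hx, hy] using hC' x hx y hy
    · simpa [hx, hy] using hout x hx y hy
    · rw [dist_comm]
      simpa [hx, hy] using hout y hy x hx
    · simp only [hx, hy, not_false_eq_true, indicator_of_notMem, sub_self, abs_zero]
      positivity

end Boundary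
end Lavrentiev

namespace Lavrentiev

/-! ### Doubling, balance, and passage to the limit in the energy. -/

section Modular

variable {n : ℕ} {Ω : Set (Space n)} {M : Space n → Space n → ℝ}

/-- The `Δ₂` condition for `M`, uniformly on `Ω`. -/
def IsDoublingOn (Ω : Set (Space n)) (M : Space n → Space n → ℝ) : Prop :=
  ∃ C ≥ 0, ∀ x ∈ Ω, ∀ ξ, M x ((2 : ℝ) • ξ) ≤ C * (M x ξ + 1)

/-- On balls of radius `R δ` and for `‖ξ‖ ≤ R δ ^ (γ - 1)` the function `M` is comparable to a
convex function which does not depend on the point and which is a lower bound for `M`. -/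
def IsBalanced (γ : ℝ) (Ω : Set (Space n)) (M : Space n → Space n → ℝ) : Prop :=
  ∀ R ≥ 1, ∃ C ≥ 0, ∃ δ₀ > 0, ∀ δ ∈ Ioo 0 δ₀, ∀ x ∈ Ω, ∃ m : Space n → ℝ,
    ConvexOn ℝ univ m ∧ (∀ ξ, 0 ≤ m ξ) ∧
    (∀ y ∈ Ω, dist x y ≤ R * δ → ∀ ξ, m ξ ≤ C * (M y ξ + 1)) ∧
    ∀ ξ, ‖ξ‖ ≤ R * δ ^ (γ - 1) → M x ξ ≤ C * (m ξ + 1)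

lemma map_smul_le_of_convexOn {f : Space n → ℝ} (hf : ConvexOn ℝ univ f) (h0 : f 0 = 0)
    (hpos : ∀ ξ, 0 ≤ f ξ) {c : ℝ} (hc0 : 0 ≤ c) (hc : c ≤ 1) (ξ : Space n) :
    f (c • ξ) ≤ f ξ := by
  have h := hf.2 (mem_univ ξ) (mem_univ 0) hc0 (sub_nonneg.2 hc) (by ring)
  simp only [smul_zero, add_zero, h0, smul_eq_mul, mul_zero] at h
  nlinarith [hpos ξ]

lemma map_add_le_of_doubling {f : Space n → ℝ} (hf : ConvexOn ℝ univ f)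
    (hpos : ∀ ξ, 0 ≤ f ξ) {C : ℝ} (hC : 0 ≤ C) (h2 : ∀ ξ, f ((2 : ℝ) • ξ) ≤ C * (f ξ + 1))
    (ξ η : Space n) : f (ξ + η) ≤ C * (f ξ + f η + 1) := by
  have h := hf.2 (mem_univ ξ) (mem_univ η) (show (0 : ℝ) ≤ 1 / 2 by norm_num)
    (show (0 : ℝ) ≤ 1 / 2 by norm_num) (by norm_num)
  have e : ξ + η = (2 : ℝ) • ((1 / 2 : ℝ) • ξ + (1 / 2 : ℝ) • η) := by
    rw [smul_add, smul_smul, smul_smul]; norm_num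
  rw [e]
  refine (h2 _).trans (mul_le_mul_of_nonneg_left ?_ hC)
  simp only [smul_eq_mul] at h
  linarith [hpos ξ, hpos η]

/-- The pointwise properties of a weak `N`-function which hold almost everywhere. -/
structure IsGoodAt (M : Space n → Space n → ℝ) (x : Space n) : Prop where
  zero : M x 0 = 0
  convex : ConvexOn ℝ univ (M x)
  even : ∀ ξ, M x ξ = M x (-ξ)
  nonneg : ∀ ξ, 0 ≤ M x ξ

lemma IsWeakNFunction.ae_good (hM : IsWeakNFunction Ω M) (hΩ : MeasurableSet Ω) :
    ∀ᵐ x ∂volume.restrict Ω, x ∈ Ω ∧ IsGoodAt M x := by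
  filter_upwards [hM.zero, hM.convex, hM.even, ae_restrict_mem hΩ] with x h2 h3 h4 h5
  exact ⟨h5, h2, h3, h4, hM.nonneg x h5⟩

lemma IsWeakNFunction.aemeasurable (hM : IsWeakNFunction Ω M) {G : Space n → Space n}
    (hG : AEStronglyMeasurable G (volume.restrict Ω)) :
    AEMeasurable (fun x => M x (G x)) (volume.restrict Ω) :=
  aemeasurable_caratheodory hM.measurable hM.continuous hG.aemeasurable

lemma lintegral_two_smul_lt_top (hΩ : MeasurableSet Ω) (hvol : volume Ω ≠ ∞)
    (hd : IsDoublingOn Ω M) {G : Space n → Space n}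
    (h : ∫⁻ x in Ω, ENNReal.ofReal (M x (G x)) < ∞) :
    ∫⁻ x in Ω, ENNReal.ofReal (M x ((2 : ℝ) • G x)) < ∞ := by
  obtain ⟨C, hC, h2⟩ := hd
  calc _ ≤ ∫⁻ x in Ω, ENNReal.ofReal C * (ENNReal.ofReal (M x (G x)) + 1) := by
        refine setLIntegral_mono' hΩ fun x hx => ?_
        refine (ENNReal.ofReal_le_ofReal (h2 x hx _)).trans ?_
        rw [ENNReal.ofReal_mul hC, ← ENNReal.ofReal_one]
        exact mul_le_mul_right ENNReal.ofReal_add_le _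
    _ < ∞ := by
        rw [lintegral_const_mul' _ _ ENNReal.ofReal_ne_top, lintegral_add_right _ measurable_const]
        refine ENNReal.mul_lt_top ENNReal.ofReal_lt_top (ENNReal.add_lt_top.2 ⟨h, ?_⟩)
        simpa using hvol.lt_top

/-- Under the `Δ₂` condition the Musielak-Orlicz space is the Musielak-Orlicz class. -/
lemma mem_orliczClass_of_mem_orliczSpace (hΩ : MeasurableSet Ω) (hvol : volume Ω ≠ ∞)
    (hM : IsWeakNFunction Ω M) (hd : IsDoublingOn Ω M) {G : Space n → Space n}
    (hG : G ∈ orliczSpace Ω M) : G ∈ orliczClass Ω M := by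
  have hgood := hM.ae_good hΩ
  refine Submodule.span_induction (p := fun G _ => G ∈ orliczClass Ω M) (fun _ h => h) ?_ ?_ ?_ hG
  · refine ⟨aestronglyMeasurable_const, ?_⟩
    rw [lintegral_congr_ae (g := fun _ => 0)]
    · simp
    · filter_upwards [hgood] with x hx
      simp [hx.2.zero]
  · rintro ξ η - - ⟨hξ, hξi⟩ ⟨hη, hηi⟩
    refine ⟨hξ.add hη, ?_⟩
    obtain ⟨C, hC, h2⟩ := hd
    calc _ ≤ ∫⁻ x in Ω, ENNReal.ofReal C *
          (ENNReal.ofReal (M x (ξ x)) + (ENNReal.ofReal (M x (η x)) + 1)) := by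
          refine lintegral_mono_ae ?_
          filter_upwards [hgood] with x hx
          have := map_add_le_of_doubling hx.2.convex hx.2.nonneg hC (h2 x hx.1) (ξ x) (η x)
          refine (ENNReal.ofReal_le_ofReal this).trans ?_
          rw [ENNReal.ofReal_mul hC, ← ENNReal.ofReal_one, ← add_assoc]
          exact mul_le_mul_right (ENNReal.ofReal_add_le.trans
            (add_le_add_left ENNReal.ofReal_add_le _)) _
      _ < ∞ := by
          rw [lintegral_const_mul' _ _ ENNReal.ofReal_ne_top,
            lintegral_add_left' (hM.aemeasurable hξ).ennreal_ofReal,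
            lintegral_add_right _ measurable_const]
          refine ENNReal.mul_lt_top ENNReal.ofReal_lt_top (ENNReal.add_lt_top.2 ⟨hξi,
            ENNReal.add_lt_top.2 ⟨hηi, ?_⟩⟩)
          simpa using hvol.lt_top
  · rintro c ξ - ⟨hξ, hξi⟩
    refine ⟨hξ.const_smul c, ?_⟩
    -- Scalars are reached by iterating the doubling until `2 ^ k > |c|`; evenness reduces `c` to
    -- `|c|`, and convexity with `M x 0 = 0` lets `|c| / 2 ^ k ≤ 1` be dropped.
    have hpow : ∀ k : ℕ, ∫⁻ x in Ω, ENNReal.ofReal (M x ((2 : ℝ) ^ k • ξ x)) < ∞ := by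
      intro k
      induction k with
      | zero => simpa using hξi
      | succ k ih =>
        simp_rw [pow_succ', mul_smul]
        exact lintegral_two_smul_lt_top hΩ hvol hd ih
    obtain ⟨k, hk⟩ := pow_unbounded_of_one_lt |c| (one_lt_two (α := ℝ))
    refine lt_of_le_of_lt (lintegral_mono_ae ?_) (hpow k)
    filter_upwards [hgood] with x hx
    refine ENNReal.ofReal_le_ofReal ?_
    have h1 : M x (c • ξ x) = M x (|c| • ξ x) := by
      rcases abs_choice c with h | h
      · rw [h]
      · rw [h, neg_smul, ← hx.2.even]
    have hp : (0 : ℝ) < 2 ^ k := by positivity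
    have h2 : |c| • ξ x = (|c| / 2 ^ k) • ((2 : ℝ) ^ k • ξ x) := by
      rw [smul_smul, div_mul_cancel₀ _ hp.ne']
    rw [Pi.smul_apply, h1, h2]
    exact map_smul_le_of_convexOn hx.2.convex hx.2.zero hx.2.nonneg (by positivity)
      ((div_le_one hp).2 hk.le) _

lemma integrableOn_of_mem_orliczClass (hΩ : MeasurableSet Ω) (hM : IsWeakNFunction Ω M)
    {G : Space n → Space n} (hG : G ∈ orliczClass Ω M) : IntegrableOn (fun x => M x (G x)) Ω := by
  refine ⟨(hM.aemeasurable hG.1).aestronglyMeasurable, ?_⟩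
  rw [hasFiniteIntegral_iff_ofReal]
  · exact hG.2
  · filter_upwards [ae_restrict_mem hΩ] with x hx using hM.nonneg x hx _

/-- A weak `N`-function is bounded on bounded sets of `ξ`, uniformly in `x`. -/
lemma IsWeakNFunction.exists_le (hM : IsWeakNFunction Ω M) (b : ℝ) :
    ∃ B, ∀ᵐ x ∂volume.restrict Ω, ∀ ξ, ‖ξ‖ ≤ b → M x ξ ≤ B := by
  obtain ⟨m₁, m₂, -, hm₂, -, -, -, h⟩ := hM.bounds
  -- `m₂` is convex but not assumed monotone, so both endpoints of `[0, b]` enter.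
  refine ⟨max (m₂ 0) (m₂ b), ?_⟩
  filter_upwards [h] with x hx ξ hξ
  exact (hx ξ).2.trans (hm₂.le_max_of_mem_Icc (mem_Ici.2 le_rfl)
    ((norm_nonneg ξ).trans hξ) ⟨norm_nonneg ξ, hξ⟩)

variable {F : Space n → ℝ → Space n → ℝ}

/-- Continuity of the energy along almost everywhere convergent sequences whose modulars are
dominated. -/
lemma tendsto_energy (hΩ : MeasurableSet Ω) (hvol : volume Ω ≠ ∞) (hF : IsCaratheodory Ω F)
    (hFM : HasGrowth Ω M F) {u : ℕ → Space n → ℝ} {G : ℕ → Space n → Space n}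
    {u₀ : Space n → ℝ} {G₀ : Space n → Space n}
    (hu : ∀ k, AEStronglyMeasurable (u k) (volume.restrict Ω))
    (hG : ∀ k, AEStronglyMeasurable (G k) (volume.restrict Ω))
    (hu₀ : ∀ᵐ x ∂volume.restrict Ω, Tendsto (fun k => u k x) atTop (𝓝 (u₀ x)))
    (hG₀ : ∀ᵐ x ∂volume.restrict Ω, Tendsto (fun k => G k x) atTop (𝓝 (G₀ x)))
    {D : Space n → ℝ≥0∞} (hD : ∫⁻ x in Ω, D x ≠ ∞)
    (hGD : ∀ k, ∀ᵐ x ∂volume.restrict Ω, ENNReal.ofReal (M x (G k x)) ≤ D x) :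
    Tendsto (fun k => energy Ω F (u k) (G k)) atTop (𝓝 (energy Ω F u₀ G₀)) := by
  obtain ⟨ν, -, β, -, L, hL, hgr⟩ := hFM
  have hL0 : 0 ≤ L := by linarith
  refine tendsto_lintegral_of_dominated_convergence' (fun x => ENNReal.ofReal L * (D x + 1))
    (fun k => ?_) (fun k => ?_) ?_ ?_
  · refine AEMeasurable.ennreal_ofReal ?_
    exact aemeasurable_caratheodory (f := fun x (w : ℝ × Space n) => F x w.1 w.2)
      (w := fun x => (u k x, G k x)) (fun w => hF.measurable w.1 w.2)
      (by filter_upwards [ae_restrict_mem hΩ] with x hx using hF.continuous x hx)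
      ((hu k).aemeasurable.prodMk (hG k).aemeasurable)
  · filter_upwards [hGD k, ae_restrict_mem hΩ] with x hx hxΩ
    refine (ENNReal.ofReal_le_ofReal (hgr x hxΩ _ _).2).trans ?_
    rw [ENNReal.ofReal_mul hL0]
    refine mul_le_mul_right (ENNReal.ofReal_add_le.trans ?_) _
    rw [ENNReal.ofReal_one]
    exact add_le_add_left hx _
  · rw [lintegral_const_mul' _ _ ENNReal.ofReal_ne_top, lintegral_add_right _ measurable_const]
    refine ENNReal.mul_ne_top ENNReal.ofReal_ne_top (ENNReal.add_ne_top.2 ⟨hD, ?_⟩)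
    simpa using hvol
  · filter_upwards [hu₀, hG₀, ae_restrict_mem hΩ] with x h1 h2 hx
    exact (ENNReal.continuous_ofReal.tendsto _).comp
      (((hF.continuous x hx).tendsto (u₀ x, G₀ x)).comp (h1.prodMk_nhds h2))

end Modular
end Lavrentiev

namespace Lavrentiev

/-! ### Approximation by test functions with dominated modulars. -/

section Approximation

variable {n : ℕ} {Ω : Set (Space n)} {M : Space n → Space n → ℝ}

/-- Mollifying along a partition of unity with inward shifts gives test functions. -/
lemma isTestFunction_sum_mollify (hΩ : Bornology.IsBounded Ω) {ι : Type} [Fintype ι]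
    {θ : ι → Space n → ℝ} {e : ι → Space n} {δ : ℝ} (hδ : 0 < δ)
    (hθ : ∀ i, ContDiff ℝ (⊤ : ℕ∞) (θ i))
    (hsh : ∀ i x, θ i x ≠ 0 → ∀ z ∉ Ω, dist x z < δ → ∀ y, ‖x - y - δ • e i‖ ≤ δ → y ∉ Ω)
    {v : Space n → ℝ} (hv : Integrable (Ω.indicator v)) :
    IsTestFunction Ω fun x => ∑ i, θ i x * mollify δ (e i) (Ω.indicator v) x := by
  set w : Space n → ℝ := fun x => ∑ i, θ i x * mollify δ (e i) (Ω.indicator v) x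
  -- `T` is the closed set of points at distance at least `δ` from every exterior point; off `T`
  -- each active kernel samples only the exterior, where the extension is zero.
  let T : Set (Space n) := {x | ∀ z ∉ Ω, δ ≤ dist x z}
  have hT : IsClosed T := by
    have : T = ⋂ z ∈ Ωᶜ, {x | δ ≤ dist x z} := by ext x; simp [T]
    rw [this]
    exact isClosed_biInter fun z _ => isClosed_le continuous_const (by fun_prop)
  have hTΩ : T ⊆ Ω := fun x hx => by
    by_contra h
    have := hx x h
    rw [dist_self] at this
    linarith
  have hsupp : tsupport w ⊆ T := by
    refine closure_minimal (fun x hx => ?_) hT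
    by_contra hxT
    simp only [T, mem_ofPred_eq, not_forall, not_le] at hxT
    obtain ⟨z, hz, hxz⟩ := hxT
    refine hx (Finset.sum_eq_zero fun i _ => ?_)
    by_cases hi : θ i x = 0
    · simp [hi]
    · rw [mollify_eq_zero hδ (e i) x fun y hy => indicator_of_notMem (hsh i x hi z hz hxz y hy) _,
        mul_zero]
  refine ⟨?_, ?_, hsupp.trans hTΩ⟩
  · exact ContDiff.sum fun i _ => (hθ i).mul (mollify_contDiff hδ (e i) hv)
  · exact HasCompactSupport.of_support_subset_isCompact hΩ.isCompact_closure
      ((subset_tsupport w).trans ((hsupp.trans hTΩ).trans subset_closure))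

lemma gradient_sum_mul {ι : Type} [Fintype ι] {θ f : ι → Space n → ℝ} {g : ι → Space n}
    {x : Space n} (hθ : ∀ i, DifferentiableAt ℝ (θ i) x) (hf : ∀ i, HasGradientAt (f i) (g i) x) :
    gradient (fun x => ∑ i, θ i x * f i x) x =
      ∑ i, θ i x • g i + ∑ i, f i x • gradient (θ i) x := by
  refine HasGradientAt.gradient ?_
  rw [hasGradientAt_iff_hasFDerivAt]
  have h := HasFDerivAt.fun_sum (u := Finset.univ) fun i _ =>
    (hθ i).hasGradientAt.hasFDerivAt.mul (hf i).hasFDerivAt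
  refine h.congr_fderiv ?_
  rw [map_add, map_sum, map_sum, Finset.sum_add_distrib]
  simp only [map_smul]

/-- Because of this, the product-rule terms `v • ∇θ i` cancel in the limit. -/
lemma sum_gradient_eq_zero (hΩ : IsOpen Ω) {ι : Type} [Fintype ι] {θ : ι → Space n → ℝ}
    (hθ : ∀ i, Differentiable ℝ (θ i)) (h1 : ∀ x ∈ Ω, ∑ i, θ i x = 1) {x : Space n} (hx : x ∈ Ω) :
    ∑ i, gradient (θ i) x = 0 := by
  have h2 : HasGradientAt (fun x => ∑ i, θ i x) (∑ i, gradient (θ i) x) x := by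
    rw [hasGradientAt_iff_hasFDerivAt, map_sum]
    exact HasFDerivAt.fun_sum fun i _ => (hθ i x).hasGradientAt.hasFDerivAt
  have h3 : (fun x => ∑ i, θ i x) =ᶠ[𝓝 x] fun _ => (1 : ℝ) := by
    filter_upwards [hΩ.mem_nhds hx] with y hy using h1 y hy
  exact h2.unique ((hasGradientAt_const x (1 : ℝ)).congr_of_eventuallyEq h3)

/-- Pointwise bound for the modular of a mollified gradient. -/
lemma map_mollify_grad_le {γ R C δ : ℝ} (hδ : 0 < δ) (hC : 0 ≤ C) (hR : 0 ≤ R) {x e : Space n}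
    (hxΩ : x ∈ Ω) (hx0 : M x 0 = 0) {H : Space n → Space n}
    (hH : Integrable (Ω.indicator H)) (hg : Integrable (Ω.indicator fun y => M y (H y)))
    (he : 1 + ‖e‖ ≤ R) (hmH : ‖mollify δ e (Ω.indicator H) x‖ ≤ R * δ ^ (γ - 1))
    (hm : ∃ m : Space n → ℝ, ConvexOn ℝ univ m ∧ (∀ ξ, 0 ≤ m ξ) ∧
      (∀ y ∈ Ω, dist x y ≤ R * δ → ∀ ξ, m ξ ≤ C * (M y ξ + 1)) ∧
      ∀ ξ, ‖ξ‖ ≤ R * δ ^ (γ - 1) → M x ξ ≤ C * (m ξ + 1)) :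
    M x (mollify δ e (Ω.indicator H) x) ≤
      C * (C * (mollify δ e (Ω.indicator fun y => M y (H y)) x + 1) + 1) := by
  obtain ⟨m, hmc, hm0, hmle, hmge⟩ := hm
  refine (hmge _ hmH).trans (mul_le_mul_of_nonneg_left (add_le_add_left ?_ _) hC)
  refine map_mollify_le hδ e x hH hmc hm0 hg fun y hy => ?_
  have hxy : dist x y ≤ R * δ := by
    have h1 := norm_add_le (x - y - δ • e) (δ • e)
    rw [sub_add_cancel, norm_smul, Real.norm_of_nonneg hδ.le] at h1
    rw [dist_eq_norm]
    nlinarith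
  by_cases hyΩ : y ∈ Ω
  · simpa [hyΩ] using hmle y hyΩ hxy (H y)
  -- Outside `Ω` the extended gradient is zero. The bound on `m 0` comes from the comparison at the
  -- centre `x` itself, where `M x 0 = 0`.
  · have := hmle x hxΩ (by rw [dist_self]; positivity) 0
    simpa [hyΩ, hx0] using this

/-- Functions in `W^{1,1}_0` whose zero extension is Hölder continuous are limits of test functions
with dominated modulars. -/
theorem exists_test_approx (hΩ : IsBoundedLipschitzDomain Ω) (hM : IsWeakNFunction Ω M)
    {γ : ℝ} (hγ : 0 ≤ γ) (hd : IsDoublingOn Ω M) (hb : IsBalanced γ Ω M) {v : Space n → ℝ}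
    {H : Space n → Space n} (hv : MemW11Zero Ω v H) (hH : H ∈ orliczClass Ω M) {C : ℝ}
    (hC : 0 ≤ C) (hvh : ∀ x y, |Ω.indicator v x - Ω.indicator v y| ≤ C * dist x y ^ γ)
    (hvb : ∀ x, |Ω.indicator v x| ≤ C) :
    ∃ w : ℕ → Space n → ℝ, (∀ k, IsTestFunction Ω (w k)) ∧
      (∀ᵐ x ∂volume.restrict Ω, Tendsto (fun k => w k x) atTop (𝓝 (v x))) ∧
      (∀ᵐ x ∂volume.restrict Ω, Tendsto (fun k => gradient (w k) x) atTop (𝓝 (H x))) ∧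
      ∃ D : Space n → ℝ≥0∞, ∫⁻ x in Ω, D x ≠ ∞ ∧
        ∀ k, ∀ᵐ x ∂volume.restrict Ω, ENNReal.ofReal (M x (gradient (w k) x)) ≤ D x := by
  have hm := hΩ.measurableSet
  obtain ⟨ι, _, θ, e, δ₀, hδ₀, hθ, hθ0, hθ1, ⟨Bθ, hBθ⟩, hsh⟩ := hΩ.exists_partition
  have hBθ0 : ∀ x ∈ Ω, ∀ i, 0 ≤ Bθ := fun x hx i => (norm_nonneg _).trans (hBθ i x hx)
  have hK := bumpConst_nonneg (n := n)
  -- One constant serves two purposes: `R * δ` exceeds the reach `δ * (1 + ‖e i‖)` of every kernel,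
  -- and `R * δ ^ (γ - 1)` exceeds the mollified gradients.
  set R : ℝ := 1 + C * bumpConst n + ∑ i, ‖e i‖ with hR
  have hsum0 : 0 ≤ ∑ i, ‖e i‖ := Finset.sum_nonneg fun _ _ => norm_nonneg _
  have hCK : 0 ≤ C * bumpConst n := mul_nonneg hC hK
  have hR1 : 1 ≤ R := by linarith
  have heR : ∀ i, 1 + ‖e i‖ ≤ R := fun i => by
    have := Finset.single_le_sum (f := fun i => ‖e i‖) (fun _ _ => norm_nonneg _)
      (Finset.mem_univ i)
    linarith
  obtain ⟨Cb, hCb, δ₁, hδ₁, hbal⟩ := hb R hR1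
  obtain ⟨Cd, hCd, hdb⟩ := hd
  set g : Space n → ℝ := fun y => M y (H y) with hgdef
  have hgi : Integrable (Ω.indicator g) :=
    (integrable_indicator_iff hm).2 (integrableOn_of_mem_orliczClass hm hM hH)
  have hvi := hv.integrable_indicator hm
  have hHi := hv.integrable_indicator_grad hm
  have hwk := hv.isWeakGrad hm
  -- The denominator `k + 2` makes already the first scale strictly smaller than both thresholds.
  set δs : ℕ → ℝ := fun k => min δ₀ δ₁ / (k + 2) with hδs
  have hmin : 0 < min δ₀ δ₁ := lt_min hδ₀ hδ₁
  have hδs0 : ∀ k, 0 < δs k := fun k => by positivity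
  have hδslt : ∀ k, δs k < min δ₀ δ₁ := fun k => by
    have : (0 : ℝ) ≤ k := k.cast_nonneg
    rw [hδs, div_lt_iff₀ (by positivity)]
    nlinarith
  have hδst : Tendsto δs atTop (𝓝[>] 0) := by
    refine tendsto_nhdsWithin_iff.2 ⟨?_, Eventually.of_forall hδs0⟩
    exact tendsto_const_nhds.div_atTop
      (tendsto_atTop_add_const_right _ _ tendsto_natCast_atTop_atTop)
  -- The errors of `v`, of `H` and of the modular density `g`, over all pieces, are collected so
  -- that a single subsequence handles them.
  set d : ℕ → Space n → ℝ≥0∞ := fun k x => ∑ i,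
    (‖mollify (δs k) (e i) (Ω.indicator v) x - Ω.indicator v x‖ₑ +
    (‖mollify (δs k) (e i) (Ω.indicator H) x - Ω.indicator H x‖ₑ +
    ‖mollify (δs k) (e i) (Ω.indicator g) x - Ω.indicator g x‖ₑ)) with hdd
  have hgrad : ∀ k i x, HasGradientAt (mollify (δs k) (e i) (Ω.indicator v))
      (mollify (δs k) (e i) (Ω.indicator H) x) x := fun k i =>
    mollify_hasGradientAt (hδs0 k) (e i) hvi hHi hwk
  have hm1 : ∀ k i, AEMeasurable
      (fun x => ‖mollify (δs k) (e i) (Ω.indicator v) x - Ω.indicator v x‖ₑ) volume := fun k i =>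
    ((mollify_contDiff (hδs0 k) (e i) hvi).continuous.aestronglyMeasurable.sub hvi.1).enorm
  have hm2 : ∀ k i, AEMeasurable
      (fun x => ‖mollify (δs k) (e i) (Ω.indicator H) x - Ω.indicator H x‖ₑ) volume := fun k i => by
    refine (AEStronglyMeasurable.sub (Continuous.aestronglyMeasurable ?_) hHi.1).enorm
    have : mollify (δs k) (e i) (Ω.indicator H) =
        gradient (mollify (δs k) (e i) (Ω.indicator v)) := by
      ext1 x
      exact (hgrad k i x).gradient.symm
    rw [this]
    exact (InnerProductSpace.toDual ℝ (Space n)).symm.continuous.comp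
      ((mollify_contDiff (hδs0 k) (e i) hvi).continuous_fderiv (by simp))
  have hm3 : ∀ k i, AEMeasurable
      (fun x => ‖mollify (δs k) (e i) (Ω.indicator g) x - Ω.indicator g x‖ₑ) volume := fun k i =>
    ((mollify_contDiff (hδs0 k) (e i) hgi).continuous.aestronglyMeasurable.sub hgi.1).enorm
  have hm23 := fun k i => (hm2 k i).add (hm3 k i)
  have hdm : ∀ k, AEMeasurable (d k) volume := fun k =>
    Finset.aemeasurable_fun_sum _ fun i _ => (hm1 k i).add (hm23 k i)
  have hdt : Tendsto (fun k => ∫⁻ x, d k x) atTop (𝓝 0) := by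
    have : ∀ k, ∫⁻ x, d k x = ∑ i,
        ((∫⁻ x, ‖mollify (δs k) (e i) (Ω.indicator v) x - Ω.indicator v x‖ₑ) +
        ((∫⁻ x, ‖mollify (δs k) (e i) (Ω.indicator H) x - Ω.indicator H x‖ₑ) +
        ∫⁻ x, ‖mollify (δs k) (e i) (Ω.indicator g) x - Ω.indicator g x‖ₑ)) := by
      intro k
      rw [hdd]
      refine (lintegral_finsetSum' _ fun i _ => (hm1 k i).add (hm23 k i)).trans ?_
      refine Finset.sum_congr rfl fun i _ => ?_
      refine (lintegral_add_left' (hm1 k i) _).trans ?_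
      rw [← lintegral_add_left' (hm2 k i)]
      rfl
    simp_rw [this]
    rw [show (0 : ℝ≥0∞) = ∑ _i : ι, (0 + (0 + 0)) by simp]
    exact tendsto_finsetSum _ fun i _ => ((tendsto_mollify hvi (e i)).comp hδst).add
      (((tendsto_mollify hHi (e i)).comp hδst).add ((tendsto_mollify hgi (e i)).comp hδst))
  obtain ⟨ns, hns, D₀, hD₀m, hD₀, hdD, hdae⟩ := exists_dominated_subseq hdm hdt
  have hdi : ∀ k i x, ‖mollify (δs k) (e i) (Ω.indicator v) x - Ω.indicator v x‖ₑ ≤ d k x ∧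
      ‖mollify (δs k) (e i) (Ω.indicator H) x - Ω.indicator H x‖ₑ ≤ d k x ∧
      ‖mollify (δs k) (e i) (Ω.indicator g) x - Ω.indicator g x‖ₑ ≤ d k x := by
    intro k i x
    have := Finset.single_le_sum (f := fun i =>
      (‖mollify (δs k) (e i) (Ω.indicator v) x - Ω.indicator v x‖ₑ +
      (‖mollify (δs k) (e i) (Ω.indicator H) x - Ω.indicator H x‖ₑ +
      ‖mollify (δs k) (e i) (Ω.indicator g) x - Ω.indicator g x‖ₑ))) (fun _ _ => zero_le)
      (Finset.mem_univ i)
    exact ⟨le_self_add.trans this, (le_self_add.trans le_add_self).trans this,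
      (le_add_self.trans le_add_self).trans this⟩
  set w : ℕ → Space n → ℝ := fun k x => ∑ i, θ i x * mollify (δs (ns k)) (e i) (Ω.indicator v) x
    with hw
  have hθd : ∀ i, Differentiable ℝ (θ i) := fun i => (hθ i).differentiable (by simp)
  have hwg : ∀ k x, gradient (w k) x =
      ∑ i, θ i x • mollify (δs (ns k)) (e i) (Ω.indicator H) x +
      ∑ i, mollify (δs (ns k)) (e i) (Ω.indicator v) x • gradient (θ i) x := fun k x =>
    gradient_sum_mul (fun i => hθd i x) fun i => hgrad (ns k) i x
  have hlim : ∀ᵐ x ∂volume.restrict Ω, x ∈ Ω ∧ ∀ i,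
      Tendsto (fun k => mollify (δs (ns k)) (e i) (Ω.indicator v) x) atTop (𝓝 (v x)) ∧
      Tendsto (fun k => mollify (δs (ns k)) (e i) (Ω.indicator H) x) atTop (𝓝 (H x)) := by
    filter_upwards [ae_restrict_of_ae hdae, ae_restrict_mem hm] with x hx hxΩ
    refine ⟨hxΩ, fun i => ⟨?_, ?_⟩⟩
    · rw [tendsto_iff_edist_tendsto_0]
      refine tendsto_of_tendsto_of_tendsto_of_le_of_le tendsto_const_nhds hx (fun _ => zero_le)
        fun k => ?_
      simpa [edist_eq_enorm_sub, hxΩ] using (hdi (ns k) i x).1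
    · rw [tendsto_iff_edist_tendsto_0]
      refine tendsto_of_tendsto_of_tendsto_of_le_of_le tendsto_const_nhds hx (fun _ => zero_le)
        fun k => ?_
      simpa [edist_eq_enorm_sub, hxΩ] using (hdi (ns k) i x).2.1
  obtain ⟨Bm, hBm⟩ := hM.exists_le (∑ _i : ι, C * Bθ)
  refine ⟨w, fun k => ?_, ?_, ?_, ?_⟩
  · exact isTestFunction_sum_mollify hΩ.isBounded (hδs0 _) hθ
      (hsh _ ⟨hδs0 _, (hδslt _).trans_le (min_le_left _ _)⟩) hvi
  · filter_upwards [hlim] with x hx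
    have := tendsto_finsetSum Finset.univ fun i _ => ((hx.2 i).1.const_mul (θ i x))
    rwa [← Finset.sum_mul, hθ1 x hx.1, one_mul] at this
  · filter_upwards [hlim] with x hx
    simp_rw [hwg]
    have h1 := tendsto_finsetSum Finset.univ fun i _ => ((hx.2 i).2.const_smul (θ i x))
    have h2 := tendsto_finsetSum Finset.univ fun i _ => ((hx.2 i).1.smul_const (gradient (θ i) x))
    have h3 := h1.add h2
    rwa [← Finset.sum_smul, hθ1 x hx.1, one_smul, ← Finset.smul_sum,
      sum_gradient_eq_zero hΩ.isOpen hθd hθ1 hx.1, smul_zero, add_zero] at h3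
  · set N : ℝ≥0∞ := (Fintype.card ι : ℝ≥0∞)
    have hN : N ≠ ∞ := ENNReal.natCast_ne_top _
    set Q := Cd * (Cb * Cb) with hQ
    set Q' := Cd * (Cb * (Cb + 1) + |Bm| + 1) with hQ'
    have hQ0 : 0 ≤ Q := by positivity
    have hQ'0 : 0 ≤ Q' := by positivity
    refine ⟨fun x => ENNReal.ofReal Q * (N * (‖Ω.indicator g x‖ₑ + D₀ x)) + ENNReal.ofReal Q',
      ?_, fun k => ?_⟩
    · rw [lintegral_add_right _ measurable_const, lintegral_const_mul' _ _ ENNReal.ofReal_ne_top,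
        lintegral_const_mul' _ _ hN, lintegral_add_left' hgi.1.enorm.restrict]
      refine ENNReal.add_ne_top.2 ⟨ENNReal.mul_ne_top ENNReal.ofReal_ne_top
        (ENNReal.mul_ne_top hN (ENNReal.add_ne_top.2 ⟨?_, ?_⟩)), ?_⟩
      · exact ((setLIntegral_le_lintegral Ω _).trans_lt hgi.2).ne
      · exact ((setLIntegral_le_lintegral Ω _).trans_lt hD₀.lt_top).ne
      · simpa using ENNReal.mul_ne_top ENNReal.ofReal_ne_top hΩ.volume_ne_top
    · filter_upwards [hM.ae_good hm, hBm] with x hx hxB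
      obtain ⟨hxΩ, hx⟩ := hx
      have hδk := hδs0 (ns k)
      set gi : ι → ℝ := fun i => mollify (δs (ns k)) (e i) (Ω.indicator g) x with hgi'
      set s := ∑ i, |gi i| with hs
      have hgis : ∀ i, gi i ≤ s := fun i => (le_abs_self _).trans
        (Finset.single_le_sum (f := fun i => |gi i|) (fun _ _ => abs_nonneg _) (Finset.mem_univ i))
      have hHb : ∀ i, M x (mollify (δs (ns k)) (e i) (Ω.indicator H) x) ≤
          Cb * (Cb * (s + 1) + 1) := by
        intro i
        refine (map_mollify_grad_le hδk hCb (by linarith) hxΩ hx.zero hHi hgi (heR i) ?_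
          (hbal _ ⟨hδk, (hδslt _).trans_le (min_le_right _ _)⟩ x hxΩ)).trans ?_
        · refine (norm_mollify_grad_le hδk (e i) hvi hHi hwk hγ hC hvh x).trans ?_
          exact mul_le_mul_of_nonneg_right (by linarith) (by positivity)
        · gcongr
          exact hgis i
      -- The main part of the gradient is a convex combination of mollified gradients, each
      -- controlled by balance and Jensen's inequality.
      have hA : M x (∑ i, θ i x • mollify (δs (ns k)) (e i) (Ω.indicator H) x) ≤
          Cb * (Cb * (s + 1) + 1) := by
        refine (hx.convex.map_sum_le (fun i _ => hθ0 i x) (hθ1 x hxΩ) (by simp)).trans ?_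
        calc _ ≤ ∑ i, θ i x • (Cb * (Cb * (s + 1) + 1)) :=
              Finset.sum_le_sum fun i _ => mul_le_mul_of_nonneg_left (hHb i) (hθ0 i x)
          _ = _ := by rw [← Finset.sum_smul, hθ1 x hxΩ, one_smul]
      -- The product-rule part has norm at most the sum of the `C * Bθ`, and `M` is uniformly
      -- bounded on such vectors. Doubling adds the two parts.
      have hB : M x (∑ i, mollify (δs (ns k)) (e i) (Ω.indicator v) x • gradient (θ i) x) ≤
          |Bm| := by
        refine (hxB _ ((norm_sum_le _ _).trans (Finset.sum_le_sum fun i _ => ?_))).trans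
          (le_abs_self _)
        rw [norm_smul]
        exact mul_le_mul (norm_mollify_le hδk (e i) x hvb) (hBθ i x hxΩ) (norm_nonneg _) hC
      have hfinal : M x (gradient (w k) x) ≤ Q * s + Q' := by
        rw [hwg]
        refine (map_add_le_of_doubling hx.convex hx.nonneg hCd (hdb x hxΩ) _ _).trans ?_
        have := mul_le_mul_of_nonneg_left (add_le_add hA hB) hCd
        rw [hQ, hQ']
        nlinarith
      have hse : ENNReal.ofReal s ≤ N * (‖Ω.indicator g x‖ₑ + D₀ x) := by
        rw [hs, ENNReal.ofReal_sum_of_nonneg fun _ _ => abs_nonneg _]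
        calc _ ≤ ∑ _i : ι, (‖Ω.indicator g x‖ₑ + D₀ x) := by
              refine Finset.sum_le_sum fun i _ => ?_
              rw [← Real.norm_eq_abs, ofReal_norm]
              have h1 : gi i = Ω.indicator g x + (gi i - Ω.indicator g x) := by ring
              rw [h1]
              refine (enorm_add_le _ _).trans (add_le_add_right ?_ _)
              exact ((hdi (ns k) i x).2.2).trans (hdD k x)
          _ = _ := by rw [Finset.sum_const, nsmul_eq_mul, Finset.card_univ]
      refine (ENNReal.ofReal_le_ofReal hfinal).trans (ENNReal.ofReal_add_le.trans ?_)
      rw [ENNReal.ofReal_mul hQ0]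
      gcongr

end Approximation
end Lavrentiev

namespace Lavrentiev

/-! ### Absence of the gap for balanced doubling functions. -/

section NoGap

variable {n : ℕ} {Ω : Set (Space n)} {M : Space n → Space n → ℝ} {F : Space n → ℝ → Space n → ℝ}

/-- The test approximations of `v` yield competitors `u₀ + w k` whose energies converge to that of
`u₀ + v`; doubling provides a majorant for the modular of `G₀ + ∇(w k)`. -/
lemma smoothInf_le_energy (hΩ : IsBoundedLipschitzDomain Ω) (hM : IsWeakNFunction Ω M)
    (hF : IsCaratheodory Ω F) (hFM : HasGrowth Ω M F) {γ : ℝ} (hγ : 0 ≤ γ)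
    (hd : IsDoublingOn Ω M) (hb : IsBalanced γ Ω M) {u₀ : Space n → ℝ} {G₀ : Space n → Space n}
    (hu : MemV Ω M u₀ G₀) {v : Space n → ℝ} {H : Space n → Space n} (hv : MemW11Zero Ω v H)
    (hH : H ∈ orliczClass Ω M) {C : ℝ} (hC : 0 ≤ C)
    (hvh : ∀ x y, |Ω.indicator v x - Ω.indicator v y| ≤ C * dist x y ^ γ)
    (hvb : ∀ x, |Ω.indicator v x| ≤ C) :
    smoothInf Ω F u₀ G₀ ≤ energy Ω F (fun x => u₀ x + v x) fun x => G₀ x + H x := by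
  have hm := hΩ.measurableSet
  obtain ⟨w, hw, hwv, hwH, D, hD, hwD⟩ := exists_test_approx hΩ hM hγ hd hb hv hH hC hvh hvb
  have hG₀ := mem_orliczClass_of_mem_orliczSpace hm hΩ.volume_ne_top hM hd hu.2
  obtain ⟨Cd, hCd, hdb⟩ := hd
  have hlim := tendsto_energy hm hΩ.volume_ne_top hF hFM (u := fun k x => u₀ x + w k x)
    (G := fun k x => G₀ x + gradient (w k) x) (u₀ := fun x => u₀ x + v x)
    (G₀ := fun x => G₀ x + H x)
    (D := fun x => ENNReal.ofReal Cd * (ENNReal.ofReal (M x (G₀ x)) + (D x + 1)))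
    (fun k => hu.1.integrable.1.add (hw k).integrable.integrableOn.1)
    (fun k => hG₀.1.add (hw k).integrable_gradient.integrableOn.1)
    (by filter_upwards [hwv] with x hx using hx.const_add _)
    (by filter_upwards [hwH] with x hx using hx.const_add _) ?_ fun k => ?_
  · exact ge_of_tendsto' hlim fun k => iInf₂_le (w k) (hw k)
  · rw [lintegral_const_mul' _ _ ENNReal.ofReal_ne_top,
      lintegral_add_left' (hM.aemeasurable hG₀.1).ennreal_ofReal,
      lintegral_add_right _ measurable_const]
    refine ENNReal.mul_ne_top ENNReal.ofReal_ne_top (ENNReal.add_ne_top.2 ⟨hG₀.2.ne,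
      ENNReal.add_ne_top.2 ⟨hD, ?_⟩⟩)
    simpa using hΩ.volume_ne_top
  · filter_upwards [hM.ae_good hm, hwD k] with x hx hxD
    have := map_add_le_of_doubling hx.2.convex hx.2.nonneg hCd (hdb x hx.1) (G₀ x)
      (gradient (w k) x)
    refine (ENNReal.ofReal_le_ofReal this).trans ?_
    rw [ENNReal.ofReal_mul hCd, ← ENNReal.ofReal_one, add_assoc]
    refine mul_le_mul_right (ENNReal.ofReal_add_le.trans (add_le_add_right ?_ _)) _
    exact ENNReal.ofReal_add_le.trans (add_le_add_left hxD _)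

lemma IsTestFunction.gradient_mem_orliczClass (hΩ : IsBoundedLipschitzDomain Ω)
    (hM : IsWeakNFunction Ω M) {φ : Space n → ℝ} (h : IsTestFunction Ω φ) :
    gradient φ ∈ orliczClass Ω M := by
  obtain ⟨b, hb⟩ := h.hasCompactSupport_gradient.exists_bound_of_continuous h.continuous_gradient
  obtain ⟨B, hB⟩ := hM.exists_le b
  refine ⟨h.continuous_gradient.aestronglyMeasurable, ?_⟩
  calc _ ≤ ∫⁻ _x in Ω, ENNReal.ofReal B := by
        refine lintegral_mono_ae ?_
        filter_upwards [hB] with x hx using ENNReal.ofReal_le_ofReal (hx _ (hb x))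
    _ < ∞ := by
        simpa using ENNReal.mul_lt_top ENNReal.ofReal_lt_top hΩ.volume_ne_top.lt_top

lemma IsTestFunction.memVZero (hΩ : IsBoundedLipschitzDomain Ω) (hM : IsWeakNFunction Ω M)
    {φ : Space n → ℝ} (h : IsTestFunction Ω φ) : MemVZero Ω M φ (gradient φ) :=
  ⟨h.memW11Zero hΩ.measurableSet, Submodule.subset_span (h.gradient_mem_orliczClass hΩ hM)⟩

lemma IsTestFunction.isHolder (hΩ : Bornology.IsBounded Ω) {φ : Space n → ℝ}
    (h : IsTestFunction Ω φ) {γ : ℝ} (hγ : γ ∈ Ico (0 : ℝ) 1) : IsHolder γ Ω φ := by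
  obtain ⟨K, hK⟩ := h.1.lipschitzWith_of_hasCompactSupport h.2.1 (by simp)
  obtain ⟨d, hd⟩ := Metric.isBounded_iff.1 hΩ
  refine ⟨h.1.continuous.continuousOn, K * |d| ^ (1 - γ), fun x hx y hy => ?_⟩
  have h1 := hK.dist_le_mul x y
  rw [Real.dist_eq] at h1
  have h2 : dist x y = dist x y ^ (1 - γ) * dist x y ^ γ := by
    rw [← Real.rpow_add_of_nonneg dist_nonneg (by linarith [hγ.2]) hγ.1]
    simp
  have h3 : dist x y ^ (1 - γ) ≤ |d| ^ (1 - γ) :=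
    Real.rpow_le_rpow dist_nonneg ((hd hx hy).trans (le_abs_self d)) (by linarith [hγ.2])
  rw [mul_assoc]
  refine h1.trans (mul_le_mul_of_nonneg_left ?_ K.2)
  conv_lhs => rw [h2]
  gcongr

/-- Absence of the Lavrentiev gap with Hölder continuous competitors. -/
theorem noGapHolder_of_isBalanced (hn : 1 ≤ n) (hΩ : IsBoundedLipschitzDomain Ω)
    (hM : IsWeakNFunction Ω M) (hF : IsCaratheodory Ω F) (hFM : HasGrowth Ω M F) {γ : ℝ}
    (hγ : γ ∈ Ico (0 : ℝ) 1) (hd : IsDoublingOn Ω M) (hb : IsBalanced γ Ω M) :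
    NoGapHolder γ Ω M F := by
  intro u₀ G₀ hu _
  refine le_antisymm ?_ ?_
  · refine le_iInf₂ fun φ hφ => ?_
    exact iInf_le_of_le φ (iInf_le_of_le (gradient φ)
      (iInf_le _ ⟨hφ.memVZero hΩ hM, hφ.isHolder hΩ.isBounded hγ⟩))
  · refine le_iInf fun v => le_iInf fun H => le_iInf fun hv => ?_
    obtain ⟨C, hC, hvh, hvb⟩ := hv.1.1.exists_holder_indicator hn hΩ hγ.1 hv.2
    exact smoothInf_le_energy hΩ hM hF hFM hγ.1 hd hb hu hv.1.1
      (mem_orliczClass_of_mem_orliczSpace hΩ.measurableSet hΩ.volume_ne_top hM hd hv.1.2)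
      hC hvh hvb

/-- A smooth bounded truncation. -/
noncomputable def truncation (k : ℝ) (s : ℝ) : ℝ := k * Real.arctan (s / k)

lemma truncation_contDiff (k : ℝ) : ContDiff ℝ (⊤ : ℕ∞) (truncation k) :=
  contDiff_const.mul (Real.contDiff_arctan.comp (by fun_prop))

lemma deriv_truncation {k : ℝ} (hk : 0 < k) (s : ℝ) :
    deriv (truncation k) s = 1 / (1 + (s / k) ^ 2) := by
  have h := (((hasDerivAt_id s).div_const k).arctan).const_mul k
  refine h.deriv.trans ?_
  simp only [id_eq]
  field_simp

/-- `k * arctan (s / k)` is a rescaled difference quotient of `arctan` at `0`, where the derivative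
is `1`. -/
lemma tendsto_truncation (s : ℝ) :
    Tendsto (fun j : ℕ => truncation (j + 1) s) atTop (𝓝 s) := by
  have hc : Tendsto (fun j : ℕ => ‖(j + 1 : ℝ)‖) atTop atTop := by
    refine tendsto_norm_atTop_atTop.comp ?_
    exact tendsto_atTop_add_const_right _ _ tendsto_natCast_atTop_atTop
  have h := (Real.hasDerivAt_arctan 0).hasFDerivAt.lim s hc
  convert h using 2 with j
  · simp [truncation, div_eq_inv_mul]
  · simp

lemma tendsto_deriv_truncation (s : ℝ) :
    Tendsto (fun j : ℕ => deriv (truncation (j + 1)) s) atTop (𝓝 1) := by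
  have h0 : Tendsto (fun j : ℕ => s / ((j : ℝ) + 1)) atTop (𝓝 0) :=
    tendsto_const_nhds.div_atTop (tendsto_atTop_add_const_right _ _ tendsto_natCast_atTop_atTop)
  have h1 : Tendsto (fun j : ℕ => 1 / (1 + (s / ((j : ℝ) + 1)) ^ 2)) atTop (𝓝 (1 / (1 + 0 ^ 2))) :=
    tendsto_const_nhds.div (tendsto_const_nhds.add (h0.pow 2)) (by norm_num)
  simp only [ne_eq, OfNat.ofNat_ne_zero, not_false_eq_true, zero_pow, add_zero, div_one] at h1
  refine h1.congr fun j => ?_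
  rw [deriv_truncation (by positivity)]

/-- Absence of the Lavrentiev gap. -/
theorem noGap_of_isBalanced (hΩ : IsBoundedLipschitzDomain Ω)
    (hM : IsWeakNFunction Ω M) (hF : IsCaratheodory Ω F) (hFM : HasGrowth Ω M F)
    (hd : IsDoublingOn Ω M) (hb : IsBalanced 0 Ω M) : NoGap Ω M F := by
  have hm := hΩ.measurableSet
  intro u₀ G₀ hu
  refine le_antisymm ?_ ?_
  · refine le_iInf₂ fun φ hφ => ?_
    exact iInf_le_of_le φ (iInf_le_of_le (gradient φ) (iInf_le _ (hφ.memVZero hΩ hM)))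
  refine le_iInf fun v => le_iInf fun H => le_iInf fun hv => ?_
  have hH := mem_orliczClass_of_mem_orliczSpace hm hΩ.volume_ne_top hM hd hv.2
  have hG₀ := mem_orliczClass_of_mem_orliczSpace hm hΩ.volume_ne_top hM hd hu.2
  have hd1 : ∀ (j : ℕ) s, 0 ≤ deriv (truncation (j + 1)) s ∧ deriv (truncation (j + 1)) s ≤ 1 := by
    intro j s
    rw [deriv_truncation (by positivity)]
    refine ⟨by positivity, ?_⟩
    rw [div_le_one (by positivity)]
    nlinarith [sq_nonneg (s / ((j : ℝ) + 1))]
  have hvj : ∀ j : ℕ, MemW11Zero Ω (fun x => truncation (j + 1) (v x))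
      fun x => deriv (truncation (j + 1)) (v x) • H x := fun j =>
    hv.1.comp hm (truncation_contDiff _) (by simp [truncation]) (B := 1) fun s => by
      rw [Real.norm_of_nonneg (hd1 j s).1]
      exact (hd1 j s).2
  have hMle : ∀ j : ℕ, ∀ᵐ x ∂volume.restrict Ω,
      M x (deriv (truncation (j + 1)) (v x) • H x) ≤ M x (H x) := fun j => by
    filter_upwards [hM.ae_good hm] with x hx
    exact map_smul_le_of_convexOn hx.2.convex hx.2.zero hx.2.nonneg (hd1 j _).1 (hd1 j _).2 _
  have hHj : ∀ j : ℕ, (fun x => deriv (truncation (j + 1)) (v x) • H x) ∈ orliczClass Ω M := by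
    refine fun j => ⟨(hvj j).1.integrable_grad.1, lt_of_le_of_lt (lintegral_mono_ae ?_) hH.2⟩
    filter_upwards [hMle j] with x hx using ENNReal.ofReal_le_ofReal hx
  have hle : ∀ j : ℕ, smoothInf Ω F u₀ G₀ ≤ energy Ω F (fun x => u₀ x + truncation (j + 1) (v x))
      fun x => G₀ x + deriv (truncation (j + 1)) (v x) • H x := by
    intro j
    have hbd : ∀ x, |Ω.indicator (fun x => truncation (j + 1) (v x)) x| ≤ (j + 1) * Real.pi := by
      intro x
      have hpi := Real.pi_pos
      by_cases hx : x ∈ Ω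
      · rw [indicator_of_mem hx, truncation, abs_mul, abs_of_nonneg (by positivity)]
        gcongr
        rw [abs_le]
        constructor
        · linarith [Real.neg_pi_div_two_lt_arctan (v x / (j + 1))]
        · linarith [Real.arctan_lt_pi_div_two (v x / (j + 1))]
      · rw [indicator_of_notMem hx, abs_zero]
        positivity
    -- Hölder continuity of order `0` only asks for bounded oscillation, at most twice the sup bound
    -- `(j + 1) * π`; no boundary regularity of `v` is involved.
    refine smoothInf_le_energy hΩ hM hF hFM le_rfl hd hb hu (hvj j) (hHj j)
      (C := 2 * ((j + 1) * Real.pi)) (by positivity) (fun x y => ?_) fun x => (hbd x).trans ?_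
    · rw [Real.rpow_zero, mul_one]
      exact (abs_sub _ _).trans (by linarith [hbd x, hbd y])
    · have := Real.pi_pos
      nlinarith [show (0 : ℝ) ≤ (j + 1) * Real.pi by positivity]
  obtain ⟨Cd, hCd, hdb⟩ := hd
  have hlim := tendsto_energy hm hΩ.volume_ne_top hF hFM
    (u := fun (j : ℕ) x => u₀ x + truncation (j + 1) (v x))
    (G := fun (j : ℕ) x => G₀ x + deriv (truncation (j + 1)) (v x) • H x)
    (u₀ := fun x => u₀ x + v x) (G₀ := fun x => G₀ x + H x)
    (D := fun x => ENNReal.ofReal Cd * (ENNReal.ofReal (M x (G₀ x)) +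
      (ENNReal.ofReal (M x (H x)) + 1)))
    (fun j => hu.1.integrable.1.add (hvj j).1.integrable.1)
    (fun j => hG₀.1.add (hHj j).1)
    (ae_of_all _ fun x => (tendsto_truncation (v x)).const_add _)
    (ae_of_all _ fun x => by
      have := ((tendsto_deriv_truncation (v x)).smul_const (H x)).const_add (G₀ x)
      rwa [one_smul] at this) ?_ fun j => ?_
  · exact ge_of_tendsto' hlim hle
  · rw [lintegral_const_mul' _ _ ENNReal.ofReal_ne_top,
      lintegral_add_left' (hM.aemeasurable hG₀.1).ennreal_ofReal,
      lintegral_add_right _ measurable_const]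
    refine ENNReal.mul_ne_top ENNReal.ofReal_ne_top (ENNReal.add_ne_top.2 ⟨hG₀.2.ne,
      ENNReal.add_ne_top.2 ⟨hH.2.ne, ?_⟩⟩)
    simpa using hΩ.volume_ne_top
  · filter_upwards [hM.ae_good hm, hMle j] with x hx hxD
    have := map_add_le_of_doubling hx.2.convex hx.2.nonneg hCd (hdb x hx.1) (G₀ x)
      (deriv (truncation (j + 1)) (v x) • H x)
    refine (ENNReal.ofReal_le_ofReal this).trans ?_
    rw [ENNReal.ofReal_mul hCd, ← ENNReal.ofReal_one, add_assoc]
    refine mul_le_mul_right (ENNReal.ofReal_add_le.trans (add_le_add_right ?_ _)) _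
    exact ENNReal.ofReal_add_le.trans (add_le_add_left (ENNReal.ofReal_le_ofReal hxD) _)

end NoGap
end Lavrentiev

namespace Lavrentiev

/-! ### Stability of regularity under sums and seminorms. -/

section Regular

variable {n : ℕ} {Ω : Set (Space n)} {γ : ℝ}

/-- Nonnegativity, doubling and balance for a function of `(x, ξ)`. -/
structure IsRegular (γ : ℝ) (Ω : Set (Space n)) (M : Space n → Space n → ℝ) : Prop where
  nonneg : ∀ x ∈ Ω, ∀ ξ, 0 ≤ M x ξ
  doubling : IsDoublingOn Ω M
  balanced : IsBalanced γ Ω M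

/-- Nonnegativity, doubling and balance for a function of `(x, t)`, `t ≥ 0`. -/
structure IsRegularFun (γ : ℝ) (Ω : Set (Space n)) (f : Space n → ℝ → ℝ) : Prop where
  nonneg : ∀ x ∈ Ω, ∀ t ≥ 0, 0 ≤ f x t
  doubling : ∃ C ≥ 0, ∀ x ∈ Ω, ∀ t ≥ 0, f x (2 * t) ≤ C * (f x t + 1)
  balanced : ∀ R ≥ 1, ∃ C ≥ 0, ∃ δ₀ > 0, ∀ δ ∈ Ioo 0 δ₀, ∀ x ∈ Ω, ∃ m : ℝ → ℝ,
    ConvexOn ℝ (Ici 0) m ∧ MonotoneOn m (Ici 0) ∧ (∀ t ≥ 0, 0 ≤ m t) ∧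
    (∀ y ∈ Ω, dist x y ≤ R * δ → ∀ t ≥ 0, m t ≤ C * (f y t + 1)) ∧
    ∀ t ≥ 0, t ≤ R * δ ^ (γ - 1) → f x t ≤ C * (m t + 1)

lemma IsRegular.congr {M M' : Space n → Space n → ℝ} (h : IsRegular γ Ω M')
    (hMM' : ∀ x ∈ Ω, ∀ ξ, M x ξ = M' x ξ) : IsRegular γ Ω M := by
  refine ⟨fun x hx ξ => hMM' x hx ξ ▸ h.nonneg x hx ξ, ?_, fun R hR => ?_⟩
  · obtain ⟨C, hC, h2⟩ := h.doubling
    refine ⟨C, hC, fun x hx ξ => ?_⟩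
    rw [hMM' x hx, hMM' x hx]
    exact h2 x hx ξ
  · obtain ⟨C, hC, δ₀, hδ₀, hb⟩ := h.balanced R hR
    refine ⟨C, hC, δ₀, hδ₀, fun δ hδ x hx => ?_⟩
    obtain ⟨m, h1, h2, h3, h4⟩ := hb δ hδ x hx
    refine ⟨m, h1, h2, fun y hy hxy ξ => ?_, fun ξ hξ => ?_⟩
    · rw [hMM' y hy]
      exact h3 y hy hxy ξ
    · rw [hMM' x hx]
      exact h4 ξ hξ

lemma IsRegular.add {M M' : Space n → Space n → ℝ} (h : IsRegular γ Ω M)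
    (h' : IsRegular γ Ω M') : IsRegular γ Ω fun x ξ => M x ξ + M' x ξ := by
  refine ⟨fun x hx ξ => add_nonneg (h.nonneg x hx ξ) (h'.nonneg x hx ξ), ?_, fun R hR => ?_⟩
  · obtain ⟨C, hC, h2⟩ := h.doubling
    obtain ⟨C', hC', h2'⟩ := h'.doubling
    refine ⟨C + C', by positivity, fun x hx ξ => ?_⟩
    nlinarith [h2 x hx ξ, h2' x hx ξ, mul_nonneg hC (h'.nonneg x hx ξ),
      mul_nonneg hC' (h.nonneg x hx ξ)]
  · obtain ⟨C, hC, δ₀, hδ₀, hb⟩ := h.balanced R hR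
    obtain ⟨C', hC', δ₀', hδ₀', hb'⟩ := h'.balanced R hR
    refine ⟨C + C', by positivity, min δ₀ δ₀', lt_min hδ₀ hδ₀', fun δ hδ x hx => ?_⟩
    obtain ⟨m, h1, h2, h3, h4⟩ := hb δ ⟨hδ.1, hδ.2.trans_le (min_le_left _ _)⟩ x hx
    obtain ⟨m', h1', h2', h3', h4'⟩ := hb' δ ⟨hδ.1, hδ.2.trans_le (min_le_right _ _)⟩ x hx
    refine ⟨fun ξ => m ξ + m' ξ, h1.add h1', fun ξ => add_nonneg (h2 ξ) (h2' ξ),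
      fun y hy hxy ξ => ?_, fun ξ hξ => ?_⟩
    · nlinarith [h3 y hy hxy ξ, h3' y hy hxy ξ, mul_nonneg hC (h'.nonneg y hy ξ),
        mul_nonneg hC' (h.nonneg y hy ξ)]
    · nlinarith [h4 ξ hξ, h4' ξ hξ, mul_nonneg hC (h2' ξ), mul_nonneg hC' (h2 ξ)]

lemma IsRegular.zero : IsRegular γ Ω fun _ _ => 0 :=
  ⟨fun _ _ _ => le_rfl, ⟨0, le_rfl, by simp⟩, fun _ _ => ⟨1, zero_le_one, 1, one_pos,
    fun _ _ _ _ => ⟨fun _ => 0, convexOn_const 0 convex_univ, by simp, by simp, by simp⟩⟩⟩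

lemma IsRegular.sum {ι : Type*} (s : Finset ι) {M : ι → Space n → Space n → ℝ}
    (h : ∀ i, IsRegular γ Ω (M i)) : IsRegular γ Ω fun x ξ => ∑ i ∈ s, M i x ξ := by
  classical
  induction s using Finset.induction_on with
  | empty => simpa using IsRegular.zero
  | insert i s hi ih =>
    refine ((h i).add ih).congr fun x _ ξ => ?_
    rw [Finset.sum_insert hi]

/-- Regularity is inherited by the composition with a seminorm bounded by the norm. -/
lemma IsRegularFun.comp_seminorm {f : Space n → ℝ → ℝ} (h : IsRegularFun γ Ω f)
    (N : Seminorm ℝ (Space n)) (hN : ∀ ξ, N ξ ≤ ‖ξ‖) :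
    IsRegular γ Ω fun x ξ => f x (N ξ) := by
  refine ⟨fun x hx ξ => h.nonneg x hx _ (apply_nonneg N ξ), ?_, fun R hR => ?_⟩
  · obtain ⟨C, hC, h2⟩ := h.doubling
    refine ⟨C, hC, fun x hx ξ => ?_⟩
    dsimp only
    rw [map_smul_eq_mul, Real.norm_of_nonneg zero_le_two]
    exact h2 x hx _ (apply_nonneg N ξ)
  · obtain ⟨C, hC, δ₀, hδ₀, hb⟩ := h.balanced R hR
    refine ⟨C, hC, δ₀, hδ₀, fun δ hδ x hx => ?_⟩
    obtain ⟨m, h1, h1', h2, h3, h4⟩ := hb δ hδ x hx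
    refine ⟨fun ξ => m (N ξ), ⟨convex_univ, fun ξ _ η _ a b ha hb hab => ?_⟩,
      fun ξ => h2 _ (apply_nonneg N ξ), fun y hy hxy ξ => h3 y hy hxy _ (apply_nonneg N ξ),
      fun ξ hξ => h4 _ (apply_nonneg N ξ) ((hN ξ).trans hξ)⟩
    -- Monotonicity of the scalar comparison function is demanded for this step: with the triangle
    -- inequality it makes `m ∘ N` convex.
    have hab' : N (a • ξ + b • η) ≤ a • N ξ + b • N η := by
      refine (map_add_le_add N _ _).trans_eq ?_
      rw [map_smul_eq_mul, map_smul_eq_mul, Real.norm_of_nonneg ha, Real.norm_of_nonneg hb]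
      rfl
    have h0 := apply_nonneg N (a • ξ + b • η)
    exact (h1' h0 (h0.trans hab') hab').trans
      (h1.2 (apply_nonneg N ξ) (apply_nonneg N η) ha hb hab)

lemma IsRegularFun.comp_norm {f : Space n → ℝ → ℝ} (h : IsRegularFun γ Ω f) :
    IsRegular γ Ω fun x ξ => f x ‖ξ‖ :=
  h.comp_seminorm (normSeminorm ℝ (Space n)) fun _ => le_rfl

lemma IsRegularFun.comp_abs_apply {f : Space n → ℝ → ℝ} (h : IsRegularFun γ Ω f) (i : Fin n) :
    IsRegular γ Ω fun x ξ => f x |ξ i| :=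
  h.comp_seminorm ((normSeminorm ℝ ℝ).comp (EuclideanSpace.proj i : Space n →L[ℝ] ℝ).toLinearMap)
    fun ξ => PiLp.norm_apply_le ξ i

end Regular

/-! ### Local infima and oscillation of exponents and coefficients. -/

section Oscillation

variable {n : ℕ} {Ω : Set (Space n)}

/-- A bounded set has a finite `s`-net, and `a` differs by at most `K` from its value at some point
of the net. -/
lemma exists_bound_of_osc (hΩ : Bornology.IsBounded Ω) {a : Space n → ℝ} {s K : ℝ} (hs : 0 < s)
    (h : ∀ x ∈ Ω, ∀ y ∈ Ω, dist x y ≤ s → |a x - a y| ≤ K) : ∃ A ≥ 0, ∀ x ∈ Ω, |a x| ≤ A := by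
  obtain ⟨t, htΩ, ht, hc⟩ := Metric.finite_approx_of_totallyBounded
    (hΩ.isCompact_closure.totallyBounded.subset subset_closure) s hs
  refine ⟨∑ c ∈ ht.toFinset, |a c| + |K|, by positivity, fun x hx => ?_⟩
  obtain ⟨c, hct, hxc⟩ := mem_iUnion₂.1 (hc hx)
  have h1 := h x hx c (htΩ hct) (Metric.mem_ball.1 hxc).le
  have h2 := Finset.single_le_sum (f := fun c => |a c|) (fun _ _ => abs_nonneg _)
    (ht.mem_toFinset.2 hct)
  have h3 := abs_sub_abs_le_abs_sub (a x) (a c)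
  linarith [le_abs_self K]

/-- `c` is the frozen value of `a` on the ball, its infimum. Membership in the closure of the range
is what later transfers convexity to the frozen function. -/
lemma exists_local_inf {a : Space n → ℝ} {b K r : ℝ} {x : Space n} (hx : x ∈ Ω) (hr : 0 ≤ r)
    (hb : ∀ y ∈ Ω, b ≤ a y) (h : ∀ y ∈ Ω, dist x y ≤ r → |a x - a y| ≤ K) :
    ∃ c, b ≤ c ∧ (∀ y ∈ Ω, dist x y ≤ r → c ≤ a y) ∧ a x ≤ c + K ∧ c ∈ closure (a '' Ω) := by
  set S := a '' {y | y ∈ Ω ∧ dist x y ≤ r} with hS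
  have hne : S.Nonempty := ⟨a x, x, ⟨hx, by simpa using hr⟩, rfl⟩
  have hbd : BddBelow S := ⟨b, by rintro _ ⟨y, hy, rfl⟩; exact hb y hy.1⟩
  refine ⟨sInf S, le_csInf hne ?_, fun y hy hxy => csInf_le hbd ⟨y, ⟨hy, hxy⟩, rfl⟩, ?_, ?_⟩
  · rintro _ ⟨y, hy, rfl⟩
    exact hb y hy.1
  · rw [← sub_le_iff_le_add]
    refine le_csInf hne ?_
    rintro _ ⟨y, hy, rfl⟩
    linarith [(abs_le.1 (h y hy.1 hy.2)).2]
  · exact closure_mono (image_mono fun y hy => hy.1) (csInf_mem_closure hne hbd)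

/-- At scale `δ` the logarithms of `δ⁻¹` and of its multiples are comparable. -/
lemma exists_log_le {R : ℝ} (hR : 1 ≤ R) : ∃ δ₀ > 0, ∀ δ ∈ Ioo 0 δ₀, δ < 1 ∧ R * δ < 1 ∧
    0 < Real.log (1 / (R * δ)) ∧
    Real.log (Real.exp 1 + R * δ⁻¹) ≤ 2 * Real.log (1 / (R * δ)) := by
  have hR3 : 1 ≤ R ^ 3 := one_le_pow₀ hR
  -- The logarithmic inequality amounts to `exp 1 * (R * δ) ^ 2 + R ^ 3 * δ ≤ 1`; with this `δ₀` the
  -- last summand is below `1 / 10`.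
  refine ⟨1 / (10 * R ^ 3), by positivity, fun δ ⟨hδ, hδlt⟩ => ?_⟩
  rw [lt_div_iff₀ (by positivity)] at hδlt
  have h1 : R ^ 3 * δ < 1 / 10 := by linarith
  have hRle : R ≤ R ^ 3 := le_self_pow₀ hR (by norm_num)
  have hRδ : R * δ < 1 / 10 := lt_of_le_of_lt (mul_le_mul_of_nonneg_right hRle hδ.le) h1
  have hδ1 : δ < 1 / 10 := by nlinarith
  have hRδ0 : 0 < R * δ := by positivity
  refine ⟨by linarith, by linarith, Real.log_pos ?_, ?_⟩
  · rw [lt_div_iff₀ hRδ0]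
    linarith
  · rw [show (2 : ℝ) = ((2 : ℕ) : ℝ) by norm_num, ← Real.log_pow]
    refine Real.log_le_log (by positivity) ?_
    rw [div_pow, one_pow, le_div_iff₀ (by positivity)]
    have he := Real.exp_one_lt_d9
    have e1 : (Real.exp 1 + R * δ⁻¹) * (R * δ) ^ 2 = Real.exp 1 * (R * δ) ^ 2 + R ^ 3 * δ := by
      field_simp
    rw [e1]
    have h2 : (R * δ) ^ 2 ≤ 1 / 100 := by nlinarith
    have h3 : Real.exp 1 * (R * δ) ^ 2 ≤ 3 * (1 / 100) :=
      mul_le_mul (by linarith) h2 (by positivity) (by norm_num)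
    linarith

lemma rpow_sub_one_le_inv {γ δ : ℝ} (hγ : 0 ≤ γ) (hδ : 0 < δ) (hδ1 : δ ≤ 1) :
    δ ^ (γ - 1) ≤ δ⁻¹ := by
  rw [← Real.rpow_neg_one]
  exact Real.rpow_le_rpow_of_exponent_ge hδ hδ1 (by linarith)

lemma IsLogHolder.exists_osc_le {p : Space n → ℝ} (hp : IsLogHolder Ω p) : ∃ c ≥ 0, ∃ r > 0,
    ∀ s ∈ Ioo 0 r, ∀ x ∈ Ω, ∀ y ∈ Ω, dist x y ≤ s → |p x - p y| ≤ c / Real.log (1 / s) := by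
  obtain ⟨c, hc, r, hr, h⟩ := hp
  refine ⟨c, hc.le, r, hr.1, fun s hs x hx y hy hxy => ?_⟩
  have hs1 : s < 1 := hs.2.trans hr.2
  have hlog : 0 < Real.log (1 / s) := Real.log_pos ((one_lt_div hs.1).2 hs1)
  rcases (dist_nonneg (x := x) (y := y)).eq_or_lt with h0 | h0
  · rw [dist_eq_zero.1 h0.symm, sub_self, abs_zero]
    positivity
  · refine (h x hx y hy (hxy.trans_lt hs.2)).trans ?_
    exact div_le_div_of_nonneg_left hc.le hlog
      (Real.log_le_log (one_div_pos.2 hs.1) (one_div_le_one_div_of_le h0 hxy))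

lemma IsLogHolder.exists_bound (hΩ : Bornology.IsBounded Ω) {p : Space n → ℝ}
    (hp : IsLogHolder Ω p) : ∃ A ≥ 0, ∀ x ∈ Ω, |p x| ≤ A := by
  obtain ⟨c, -, r, hr, h⟩ := hp.exists_osc_le
  exact exists_bound_of_osc hΩ (half_pos hr) (h (r / 2) ⟨half_pos hr, half_lt_self hr⟩)

lemma IsHolder.exists_osc_le {α : ℝ} (hα : 0 ≤ α) {a : Space n → ℝ} (ha : IsHolder α Ω a) :
    ∃ C ≥ 0, ∀ s, ∀ x ∈ Ω, ∀ y ∈ Ω, dist x y ≤ s → |a x - a y| ≤ C * s ^ α := by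
  obtain ⟨-, C, hC⟩ := ha
  refine ⟨|C|, abs_nonneg C, fun s x hx y hy hxy => (hC x hx y hy).trans ?_⟩
  gcongr
  exact le_abs_self C

lemma IsHolder.exists_bound (hΩ : Bornology.IsBounded Ω) {α : ℝ} (hα : 0 ≤ α) {a : Space n → ℝ}
    (ha : IsHolder α Ω a) : ∃ A ≥ 0, ∀ x ∈ Ω, |a x| ≤ A := by
  obtain ⟨C, -, hC⟩ := ha.exists_osc_le hα
  exact exists_bound_of_osc hΩ one_pos (hC 1)

end Oscillation

/-! ### Power-type double phase with variable exponents. -/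

section Power

variable {n : ℕ} {Ω : Set (Space n)}

lemma rpow_le_rpow_add_one {t r s : ℝ} (ht : 0 ≤ t) (hr : 0 ≤ r) (hrs : r ≤ s) :
    t ^ r ≤ t ^ s + 1 := by
  rcases le_total t 1 with h | h
  · linarith [Real.rpow_le_one ht h hr, Real.rpow_nonneg ht s]
  · linarith [Real.rpow_le_rpow_of_exponent_le h hrs]

/-- An exponent error `c / Λ` costs at most `t ^ (c / Λ)`, which is bounded when `log t ≤ 2 * Λ`;
this is where the logarithmic modulus is exactly sufficient. -/
lemma rpow_le_exp_mul_rpow {t Λ c p q : ℝ} (ht : 1 ≤ t) (hΛ : 0 < Λ)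
    (hlog : Real.log t ≤ 2 * Λ) (hc : 0 ≤ c) (hqp : q ≤ p + c / Λ) :
    t ^ q ≤ Real.exp (2 * c) * t ^ p := by
  have ht0 : 0 < t := by linarith
  have hl : 0 ≤ Real.log t := Real.log_nonneg ht
  rw [Real.rpow_def_of_pos ht0, Real.rpow_def_of_pos ht0, ← Real.exp_add]
  refine Real.exp_le_exp.2 ?_
  have h1 : Real.log t * q ≤ Real.log t * (p + c / Λ) := mul_le_mul_of_nonneg_left hqp hl
  have h2 : Real.log t * (c / Λ) ≤ 2 * Λ * (c / Λ) := mul_le_mul_of_nonneg_right hlog (by positivity)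
  have h3 : 2 * Λ * (c / Λ) = 2 * c := by field_simp
  linarith

/-- The comparison function is `κ * t ^ p₁ + a₁ * t ^ q₁` with all data frozen at their local
infima. The factor `κ` allows one power to be shared among several phases. -/
lemma isRegularFun_power {γ : ℝ} (hγ : γ ∈ Ico (0 : ℝ) 1) (hΩ : Bornology.IsBounded Ω)
    {κ α : ℝ} (hκ : 0 < κ) (hα : 0 ≤ α) {p q a : Space n → ℝ} (hp : IsLogHolder Ω p)
    (hq : IsLogHolder Ω q) (hpq : ∀ x ∈ Ω, 1 ≤ p x ∧ p x ≤ q x) (ha : IsHolder α Ω a)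
    (ha0 : ∀ x ∈ Ω, 0 ≤ a x) (hqp : ∀ x ∈ Ω, q x - p x ≤ α / (1 - γ)) :
    IsRegularFun γ Ω fun x t => κ * t ^ p x + a x * t ^ q x := by
  have hγ1 : 0 < 1 - γ := by linarith [hγ.2]
  obtain ⟨P, hP0, hP⟩ := hp.exists_bound hΩ
  obtain ⟨Q, hQ0, hQ⟩ := hq.exists_bound hΩ
  obtain ⟨A, hA0, hA⟩ := ha.exists_bound hΩ hα
  have hnn : ∀ x ∈ Ω, ∀ t ≥ 0, 0 ≤ κ * t ^ p x + a x * t ^ q x := fun x hx t ht =>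
    add_nonneg (mul_nonneg hκ.le (Real.rpow_nonneg ht _))
      (mul_nonneg (ha0 x hx) (Real.rpow_nonneg ht _))
  refine ⟨hnn, ⟨2 ^ P + 2 ^ Q, by positivity, fun x hx t ht => ?_⟩, fun R hR => ?_⟩
  · rw [Real.mul_rpow zero_le_two ht, Real.mul_rpow zero_le_two ht]
    have h1 : (2 : ℝ) ^ p x ≤ 2 ^ P + 2 ^ Q :=
      (Real.rpow_le_rpow_of_exponent_le one_le_two ((le_abs_self _).trans (hP x hx))).trans
        (le_add_of_nonneg_right (by positivity))
    have h2 : (2 : ℝ) ^ q x ≤ 2 ^ P + 2 ^ Q :=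
      (Real.rpow_le_rpow_of_exponent_le one_le_two ((le_abs_self _).trans (hQ x hx))).trans
        (le_add_of_nonneg_left (by positivity))
    have h3 := mul_le_mul_of_nonneg_right h1 (mul_nonneg hκ.le (Real.rpow_nonneg ht (p x)))
    have h4 := mul_le_mul_of_nonneg_right h2
      (mul_nonneg (ha0 x hx) (Real.rpow_nonneg ht (q x)))
    have h5 : (0 : ℝ) ≤ 2 ^ P + 2 ^ Q := by positivity
    nlinarith
  · obtain ⟨cp, hcp, rp, hrp, hposc⟩ := hp.exists_osc_le
    obtain ⟨cq, hcq, rq, hrq, hqosc⟩ := hq.exists_osc_le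
    obtain ⟨Ca, hCa, haosc⟩ := ha.exists_osc_le hα
    obtain ⟨δ₁, hδ₁, hlog⟩ := exists_log_le hR
    have hR0 : 0 < R := by linarith
    set β := α / (1 - γ) with hβ
    have hβ0 : 0 ≤ β := by positivity
    set E := Real.exp (2 * cp)
    set E' := Real.exp (2 * cq)
    set T := Ca * R ^ α * R ^ β
    have hE1 : 1 ≤ E := Real.one_le_exp (by positivity)
    have hE'1 : 1 ≤ E' := Real.one_le_exp (by positivity)
    have hT0 : 0 ≤ T := by positivity
    -- The part `1 + κ + A` serves the lower comparison and the range `t ≤ 1`; `E + T * E / κ` and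
    -- `E'` are the factors of `κ * t ^ p₁` and `a₁ * t ^ q₁` for `t ≥ 1`.
    refine ⟨1 + κ + A + (E + T * E / κ) + E', by positivity, min δ₁ (min (rp / R) (rq / R)),
      by positivity, fun δ ⟨hδ, hδlt⟩ x hx => ?_⟩
    set C := 1 + κ + A + (E + T * E / κ) + E' with hC
    have hTE : 0 ≤ T * E / κ := by positivity
    obtain ⟨hδ1, hRδ1, hΛ, hΛ2⟩ := hlog δ ⟨hδ, hδlt.trans_le (min_le_left _ _)⟩
    have hRδ : 0 < R * δ := by positivity
    have hrpδ : R * δ < rp := by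
      have := hδlt.trans_le ((min_le_right _ _).trans (min_le_left _ _))
      rw [lt_div_iff₀ hR0] at this
      linarith
    have hrqδ : R * δ < rq := by
      have := hδlt.trans_le ((min_le_right _ _).trans (min_le_right _ _))
      rw [lt_div_iff₀ hR0] at this
      linarith
    obtain ⟨p₁, hp1, hpy, hpx, -⟩ := exists_local_inf hx hRδ.le (fun y hy => (hpq y hy).1)
      (hposc (R * δ) ⟨hRδ, hrpδ⟩ x hx)
    obtain ⟨q₁, hq1, hqy, hqx, -⟩ := exists_local_inf hx hRδ.le
      (fun y hy => (hpq y hy).1.trans (hpq y hy).2) (hqosc (R * δ) ⟨hRδ, hrqδ⟩ x hx)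
    obtain ⟨a₁, ha1, hay, hax, -⟩ := exists_local_inf hx hRδ.le ha0 (haosc (R * δ) x hx)
    have hconv : ConvexOn ℝ (Ici 0) fun t : ℝ => κ * t ^ p₁ + a₁ * t ^ q₁ :=
      ((convexOn_rpow hp1).smul hκ.le).add ((convexOn_rpow hq1).smul ha1)
    have hmono : MonotoneOn (fun t : ℝ => κ * t ^ p₁ + a₁ * t ^ q₁) (Ici 0) := by
      intro s hs t _ hst
      have hs : 0 ≤ s := hs
      have h1 : s ^ p₁ ≤ t ^ p₁ := Real.rpow_le_rpow hs hst (by linarith)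
      have h2 : s ^ q₁ ≤ t ^ q₁ := Real.rpow_le_rpow hs hst (by linarith)
      exact add_le_add (mul_le_mul_of_nonneg_left h1 hκ.le) (mul_le_mul_of_nonneg_left h2 ha1)
    refine ⟨_, hconv, hmono, fun t ht => add_nonneg (mul_nonneg hκ.le (Real.rpow_nonneg ht _))
      (mul_nonneg ha1 (Real.rpow_nonneg ht _)), fun y hy hxy t ht => ?_, fun t ht htδ => ?_⟩
    · have h1 := mul_le_mul_of_nonneg_left
        (rpow_le_rpow_add_one ht (by linarith) (hpy y hy hxy)) hκ.le
      have h2 : a₁ * t ^ q₁ ≤ a y * (t ^ q y + 1) :=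
        mul_le_mul (hay y hy hxy) (rpow_le_rpow_add_one ht (by linarith) (hqy y hy hxy))
          (Real.rpow_nonneg ht _) (ha0 y hy)
      have h3 : a y ≤ A := (le_abs_self _).trans (hA y hy)
      have h4 := hnn y hy t ht
      have h5 : 1 + κ + A ≤ C := by rw [hC]; linarith
      have h6 : (1 + κ + A) * (κ * t ^ p y + a y * t ^ q y + 1) ≤
          C * (κ * t ^ p y + a y * t ^ q y + 1) := mul_le_mul_of_nonneg_right h5 (by linarith)
      nlinarith [mul_nonneg hκ.le h4, mul_nonneg hA0 h4]
    · have hm0 : 0 ≤ κ * t ^ p₁ := mul_nonneg hκ.le (Real.rpow_nonneg ht _)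
      have hm0' : 0 ≤ a₁ * t ^ q₁ := mul_nonneg ha1 (Real.rpow_nonneg ht _)
      rcases le_total t 1 with ht1 | ht1
      · have h1 := Real.rpow_le_one ht ht1 (by linarith [(hpq x hx).1] : 0 ≤ p x)
        have h2 := Real.rpow_le_one ht ht1
          (by linarith [(hpq x hx).1, (hpq x hx).2] : 0 ≤ q x)
        have h3 : a x ≤ A := (le_abs_self _).trans (hA x hx)
        have h4 : a x * t ^ q x ≤ A * 1 :=
          mul_le_mul h3 h2 (Real.rpow_nonneg ht _) hA0
        have h5 : κ * t ^ p x ≤ κ * 1 := mul_le_mul_of_nonneg_left h1 hκ.le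
        have h6 : C ≤ C * (κ * t ^ p₁ + a₁ * t ^ q₁ + 1) :=
          le_mul_of_one_le_right (by positivity) (by linarith)
        linarith
      · have htR : t ≤ R * δ⁻¹ := htδ.trans
          (mul_le_mul_of_nonneg_left (rpow_sub_one_le_inv hγ.1 hδ hδ1.le) hR0.le)
        have hlogt : Real.log t ≤ 2 * Real.log (1 / (R * δ)) :=
          (Real.log_le_log (by linarith) (by linarith [Real.exp_pos 1])).trans hΛ2
        have h1 : t ^ p x ≤ E * t ^ p₁ := rpow_le_exp_mul_rpow ht1 hΛ hlogt hcp hpx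
        have h2 : t ^ q x ≤ E' * t ^ q₁ := rpow_le_exp_mul_rpow ht1 hΛ hlogt hcq hqx
        -- The gap condition enters here: `t ^ (q x - p x) ≤ (R * δ ^ (γ - 1)) ^ β`, and `(γ - 1) *
        -- β = -α` cancels the oscillation `δ ^ α` of the coefficient.
        have h3 : (R * δ) ^ α * t ^ q x ≤ R ^ α * R ^ β * t ^ p x := by
          have e1 : t ^ q x = t ^ (q x - p x) * t ^ p x := by
            rw [← Real.rpow_add (by linarith)]
            congr 1
            ring
          have e2 : t ^ (q x - p x) ≤ R ^ β * δ ^ (-α) := by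
            calc t ^ (q x - p x) ≤ t ^ β := Real.rpow_le_rpow_of_exponent_le ht1 (hqp x hx)
              _ ≤ (R * δ ^ (γ - 1)) ^ β := Real.rpow_le_rpow ht htδ hβ0
              _ = R ^ β * δ ^ (-α) := by
                rw [Real.mul_rpow hR0.le (by positivity), ← Real.rpow_mul hδ.le]
                congr 2
                rw [hβ]
                field_simp
                ring
          have e3 : δ ^ α * δ ^ (-α) = 1 := by
            rw [← Real.rpow_add hδ]
            simp
          rw [e1, Real.mul_rpow hR0.le hδ.le]
          calc R ^ α * δ ^ α * (t ^ (q x - p x) * t ^ p x)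
              = R ^ α * δ ^ α * t ^ p x * t ^ (q x - p x) := by ring
            _ ≤ R ^ α * δ ^ α * t ^ p x * (R ^ β * δ ^ (-α)) :=
                mul_le_mul_of_nonneg_left e2 (by positivity)
            _ = R ^ α * R ^ β * t ^ p x * (δ ^ α * δ ^ (-α)) := by ring
            _ = R ^ α * R ^ β * t ^ p x := by rw [e3, mul_one]
        have h4 : a x * t ^ q x ≤ a₁ * (E' * t ^ q₁) + T * (E * t ^ p₁) := by
          calc a x * t ^ q x ≤ (a₁ + Ca * (R * δ) ^ α) * t ^ q x :=
                mul_le_mul_of_nonneg_right hax (Real.rpow_nonneg ht _)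
            _ = a₁ * t ^ q x + Ca * ((R * δ) ^ α * t ^ q x) := by ring
            _ ≤ a₁ * (E' * t ^ q₁) + Ca * (R ^ α * R ^ β * t ^ p x) :=
                add_le_add (mul_le_mul_of_nonneg_left h2 ha1) (mul_le_mul_of_nonneg_left h3 hCa)
            _ = a₁ * (E' * t ^ q₁) + T * t ^ p x := by ring
            _ ≤ _ := by gcongr
        have h5 : κ * t ^ p x ≤ κ * (E * t ^ p₁) := mul_le_mul_of_nonneg_left h1 hκ.le
        have h6 : T * (E * t ^ p₁) = T * E / κ * (κ * t ^ p₁) := by field_simp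
        have h7 : (E + T * E / κ) * (κ * t ^ p₁) ≤ C * (κ * t ^ p₁) :=
          mul_le_mul_of_nonneg_right (by rw [hC]; linarith) hm0
        have h8 : E' * (a₁ * t ^ q₁) ≤ C * (a₁ * t ^ q₁) :=
          mul_le_mul_of_nonneg_right (by rw [hC]; linarith) hm0'
        have h9 : 0 ≤ C := by positivity
        linarith

end Power
end Lavrentiev

namespace Lavrentiev

/-! ### Orlicz double phase and convexity of frozen functions. -/

section OrliczBlock

variable {n : ℕ} {Ω : Set (Space n)}

lemma isClosed_setOf_convexOn_add_mul (f g : ℝ → ℝ) :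
    IsClosed {c : ℝ | ConvexOn ℝ univ fun s => f s + c * g s} := by
  have : {c : ℝ | ConvexOn ℝ univ fun s => f s + c * g s} =
      ⋂ (x : ℝ) (y : ℝ) (a : ℝ) (b : ℝ) (_ : 0 ≤ a) (_ : 0 ≤ b) (_ : a + b = 1),
        {c : ℝ | f (a • x + b • y) + c * g (a • x + b • y) ≤
          a • (f x + c * g x) + b • (f y + c * g y)} := by
    ext c
    simp only [mem_iInter]
    exact ⟨fun h x y a b ha hb hab => h.2 (mem_univ x) (mem_univ y) ha hb hab,
      fun h => ⟨convex_univ, fun x _ y _ a b ha hb hab => h x y a b ha hb hab⟩⟩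
  rw [this]
  refine isClosed_iInter fun x => isClosed_iInter fun y => isClosed_iInter fun a =>
    isClosed_iInter fun b => isClosed_iInter fun _ => isClosed_iInter fun _ =>
    isClosed_iInter fun _ => isClosed_le (by fun_prop) (by fun_prop)

/-- Convexity for almost every value of a continuous coefficient implies convexity for all values in
the closure of its range. -/
lemma convexOn_of_mem_closure_image (hΩ : IsOpen Ω) {a : Space n → ℝ} (ha : ContinuousOn a Ω)
    {f g : ℝ → ℝ} (h : ∀ᵐ x ∂volume.restrict Ω, ConvexOn ℝ univ fun s => f s + a x * g s) {c : ℝ}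
    (hc : c ∈ closure (a '' Ω)) : ConvexOn ℝ univ fun s => f s + c * g s := by
  set S := {c : ℝ | ConvexOn ℝ univ fun s => f s + c * g s}
  have hS : IsClosed S := isClosed_setOf_convexOn_add_mul f g
  -- A set of full measure in the open set `Ω` is dense there, so by continuity of `a` the closed
  -- set `S` catches every value of `a`.
  have hd : Dense {x | x ∈ Ω → a x ∈ S} :=
    Measure.dense_of_ae ((ae_restrict_iff' hΩ.measurableSet).1 h)
  refine closure_minimal ?_ hS hc
  rintro _ ⟨x, hx, rfl⟩
  have hx' : x ∈ closure (Ω ∩ {x | x ∈ Ω → a x ∈ S}) := hd.open_subset_closure_inter hΩ hx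
  have h1 := ((ha x hx).mono inter_subset_left).mem_closure_image hx'
  refine closure_minimal ?_ hS h1
  rintro _ ⟨y, hy, rfl⟩
  exact hy.2 hy.1

lemma exists_doubling_pow {ψ : ℝ → ℝ} {C : ℝ} (hC : 0 ≤ C) (hψ0 : ∀ t ≥ 0, 0 ≤ ψ t)
    (h : ∀ t ≥ 0, ψ (2 * t) ≤ C * (ψ t + 1)) (k : ℕ) :
    ∃ K ≥ 0, ∀ t ≥ 0, ψ (2 ^ k * t) ≤ K * (ψ t + 1) := by
  induction k with
  | zero => exact ⟨1, zero_le_one, fun t _ => by simp⟩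
  | succ k ih =>
    obtain ⟨K, hK, ih⟩ := ih
    refine ⟨C * (K + 1), by positivity, fun t ht => ?_⟩
    have h1 := h (2 ^ k * t) (by positivity)
    have h2 := mul_le_mul_of_nonneg_left (add_le_add_left (ih t ht) 1) hC
    rw [pow_succ', mul_assoc]
    have h3 := mul_nonneg hC (hψ0 t ht)
    linarith

/-- `φ` and `ψ` need not be convex separately; only their combination is, at almost every `x`. The
frozen `φ + c * ψ` inherits convexity because `c` lies in the closure of the range of `a`, and
replacing `a x` by `c` costs `K * ψ`, absorbed by `φ`. -/
lemma isRegularFun_orlicz {γ : ℝ} (hΩ : IsOpen Ω) {φ ψ : ℝ → ℝ} {a : Space n → ℝ}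
    (hφ0 : ∀ t ≥ 0, 0 ≤ φ t) (hψ0 : ∀ t ≥ 0, 0 ≤ ψ t)
    (hφ : ∃ C ≥ 0, ∀ t ≥ 0, φ (2 * t) ≤ C * (φ t + 1))
    (hψ : ∃ C ≥ 0, ∀ t ≥ 0, ψ (2 * t) ≤ C * (ψ t + 1))
    (ha : ContinuousOn a Ω) (ha0 : ∀ x ∈ Ω, 0 ≤ a x) (haA : ∃ A ≥ 0, ∀ x ∈ Ω, |a x| ≤ A)
    (hconv : ∀ᵐ x ∂volume.restrict Ω, ConvexOn ℝ univ fun s : ℝ => φ |s| + a x * ψ |s|)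
    (hosc : ∀ R ≥ 1, ∃ C ≥ 0, ∃ δ₀ > 0, ∀ δ ∈ Ioo 0 δ₀, ∃ K ≥ 0,
      (∀ x ∈ Ω, ∀ y ∈ Ω, dist x y ≤ R * δ → |a x - a y| ≤ K) ∧
      ∀ t ≥ 0, t ≤ R * δ ^ (γ - 1) → K * ψ t ≤ C * (φ t + 1)) :
    IsRegularFun γ Ω fun x t => φ t + a x * ψ t := by
  obtain ⟨A, hA0, hA⟩ := haA
  have hnn : ∀ x ∈ Ω, ∀ t ≥ 0, 0 ≤ φ t + a x * ψ t := fun x hx t ht =>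
    add_nonneg (hφ0 t ht) (mul_nonneg (ha0 x hx) (hψ0 t ht))
  refine ⟨hnn, ?_, fun R hR => ?_⟩
  · obtain ⟨C₁, hC₁, h1⟩ := hφ
    obtain ⟨C₂, hC₂, h2⟩ := hψ
    refine ⟨C₁ + C₂ + C₂ * A, by positivity, fun x hx t ht => ?_⟩
    have hax := ha0 x hx
    have haA := (le_abs_self _).trans (hA x hx)
    have h3 := mul_le_mul_of_nonneg_left (h2 t ht) hax
    have h4 := h1 t ht
    have p1 := mul_nonneg hC₁ (mul_nonneg hax (hψ0 t ht))
    have p2 := mul_nonneg hC₂ (hφ0 t ht)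
    have p3 := mul_nonneg (mul_nonneg hC₂ hA0) (hnn x hx t ht)
    have p4 := mul_le_mul_of_nonneg_left haA hC₂
    nlinarith
  · obtain ⟨C, hC, δ₀, hδ₀, hb⟩ := hosc R hR
    refine ⟨1 + C, by positivity, δ₀, hδ₀, fun δ hδ x hx => ?_⟩
    obtain ⟨K, hK, hosc, hKψ⟩ := hb δ hδ
    obtain ⟨c, hc0, hcy, hcx, hcl⟩ := exists_local_inf hx (mul_nonneg (by linarith) hδ.1.le) ha0
      (hosc x hx)
    have hconvc := convexOn_of_mem_closure_image (f := fun s => φ |s|) (g := fun s => ψ |s|) hΩ ha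
      hconv hcl
    refine ⟨fun t => φ t + c * ψ t, ?_, ?_, fun t ht => add_nonneg (hφ0 t ht)
      (mul_nonneg hc0 (hψ0 t ht)), fun y hy hxy t ht => ?_, fun t ht htδ => ?_⟩
    · refine (hconvc.subset (subset_univ _) (convex_Ici 0)).congr fun t ht => ?_
      simp only [abs_of_nonneg (show 0 ≤ t from ht)]
    · intro s hs t ht hst
      have hs : 0 ≤ s := hs
      have ht : 0 ≤ t := ht
      -- An even convex function is nondecreasing on the half-line: its value at `s` is at most the
      -- larger of the equal values at `-t` and `t`.
      have := hconvc.le_max_of_mem_Icc (mem_univ (-t)) (mem_univ t) (z := s) ⟨by linarith, hst⟩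
      simpa [abs_of_nonneg hs, abs_of_nonneg ht] using this
    · have h1 : c * ψ t ≤ a y * ψ t := mul_le_mul_of_nonneg_right (hcy y hy hxy) (hψ0 t ht)
      have h2 := hnn y hy t ht
      nlinarith [mul_nonneg hC h2]
    · have h1 : a x * ψ t ≤ (c + K) * ψ t := mul_le_mul_of_nonneg_right hcx (hψ0 t ht)
      have h2 := hKψ t ht htδ
      have h3 := mul_nonneg hC (mul_nonneg hc0 (hψ0 t ht))
      nlinarith [hφ0 t ht, mul_nonneg hC (hφ0 t ht), mul_nonneg hc0 (hψ0 t ht)]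

end OrliczBlock

/-! ### Modulus of continuity against the quotient of two Young functions. -/

section YoungBlock

variable {n : ℕ} {Ω : Set (Space n)}

lemma IsYoungFunction.nonneg {φ : ℝ → ℝ} (h : IsYoungFunction φ) {t : ℝ} (ht : 0 ≤ t) :
    0 ≤ φ t := by
  rcases ht.eq_or_lt with rfl | ht
  · rw [h.2.1]
  · exact (h.2.2 t ht).le

lemma IsYoungFunction.mono {φ : ℝ → ℝ} (h : IsYoungFunction φ) {s t : ℝ} (hs : 0 ≤ s)
    (hst : s ≤ t) : φ s ≤ φ t := by
  have := h.1.le_max_of_mem_Icc (mem_Ici.2 le_rfl) (mem_Ici.2 (hs.trans hst)) ⟨hs, hst⟩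
  rwa [h.2.1, max_eq_right (h.nonneg (hs.trans hst))] at this

lemma IsYoungFunction.exists_doubling {φ : ℝ → ℝ} (h : IsYoungFunction φ) (h2 : IsDoubling φ) :
    ∃ C ≥ 0, ∀ t ≥ 0, φ (2 * t) ≤ C * (φ t + 1) := by
  obtain ⟨c, hc, T, hT, b, hb, h2⟩ := h2
  have hφT := h.nonneg (show 0 ≤ 2 * T by linarith)
  refine ⟨c + b + φ (2 * T), by positivity, fun t ht => ?_⟩
  have h0 := h.nonneg ht
  rcases le_or_gt t T with htT | htT
  · have := h.mono (show 0 ≤ 2 * t by linarith) (show 2 * t ≤ 2 * T by linarith)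
    nlinarith [mul_nonneg hc.le h0, mul_nonneg hb h0, mul_nonneg hφT h0]
  · nlinarith [h2 t htT, mul_nonneg hc.le h0, mul_nonneg hb h0, mul_nonneg hφT h0]

/-- The interplay of a modulus of continuity with two Young functions. -/
lemma exists_osc_of_modulus {γ : ℝ} (hγ : γ ∈ Ico (0 : ℝ) 1) {φ ψ ω : ℝ → ℝ} {a : Space n → ℝ}
    (hφ : IsYoungFunction φ) (hψ : IsYoungFunction ψ) (hψ2 : IsDoubling ψ)
    (hω : IsModulusOfContinuity Ω a ω)
    (hle : ∀ᶠ t in 𝓝[>] (0 : ℝ), ω t ≤ φ (t ^ (γ - 1)) / ψ (t ^ (γ - 1))) :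
    ∀ R ≥ 1, ∃ C ≥ 0, ∃ δ₀ > 0, ∀ δ ∈ Ioo 0 δ₀, ∃ K ≥ 0,
      (∀ x ∈ Ω, ∀ y ∈ Ω, dist x y ≤ R * δ → |a x - a y| ≤ K) ∧
      ∀ t ≥ 0, t ≤ R * δ ^ (γ - 1) → K * ψ t ≤ C * (φ t + 1) := by
  intro R hR
  have hR0 : 0 < R := by linarith
  have hγ1 : γ - 1 < 0 := by linarith [hγ.2]
  obtain ⟨t₀, ht₀, hle⟩ := (nhdsGT_basis (0 : ℝ)).eventually_iff.1 hle
  have hω0 : ω 0 = 0 := tendsto_nhds_unique (tendsto_pure_nhds ω 0)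
    (hω.tendsto_zero.mono_left (pure_le_nhdsWithin (mem_Ici.2 le_rfl)))
  have hωnn : ∀ t ≥ 0, 0 ≤ ω t := fun t ht => hω0 ▸ hω.mono (mem_Ici.2 le_rfl) ht ht
  obtain ⟨C₂, hC₂, hd⟩ := hψ.exists_doubling hψ2
  -- Dividing `t ≤ R * δ ^ (γ - 1)` by `2 ^ k > R ^ 2` brings it below `(R * δ) ^ (γ - 1)`, because
  -- `R⁻¹ ≤ R ^ (γ - 1)`; `k` doublings of `ψ` undo the division.
  obtain ⟨k, hk⟩ := pow_unbounded_of_one_lt (R ^ 2) (one_lt_two (α := ℝ))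
  obtain ⟨D, hD, hdk⟩ := exists_doubling_pow hC₂ (fun t => hψ.nonneg) hd k
  -- Half of `t₀`, so that points up to and including `t₁` lie strictly inside the range of the
  -- hypothesis.
  set t₁ := t₀ / 2 with ht₁
  have ht₁0 : 0 < t₁ := half_pos ht₀
  set T := t₁ ^ (γ - 1) with hT
  have hT0 : 0 < T := Real.rpow_pos_of_pos ht₁0 _
  set B := ω t₁ * ψ T with hB
  have hω1 := hωnn t₁ ht₁0.le
  have hB0 : 0 ≤ B := mul_nonneg hω1 (hψ.nonneg hT0.le)
  refine ⟨D * (1 + B + ω t₁), by positivity, t₁ / R, by positivity, fun δ ⟨hδ, hδlt⟩ => ?_⟩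
  rw [lt_div_iff₀ hR0] at hδlt
  set τ := R * δ with hτ
  have hτ0 : 0 < τ := by positivity
  have hτ1 : τ ≤ t₁ := by linarith
  have hωτ := hω.mono hτ0.le ht₁0.le hτ1
  have hωτ0 := hωnn τ hτ0.le
  refine ⟨ω τ, hωτ0, fun x hx y hy hxy =>
    (hω.bound x hx y hy).trans (hω.mono dist_nonneg hτ0.le hxy), fun t ht htδ => ?_⟩
  -- The quotient `φ / ψ` is not assumed monotone, so the hypothesis is applied not at `τ` but at
  -- the `s₁ ≥ τ` with `s₁ ^ (γ - 1) = s`, and `ω τ ≤ ω s₁`. Values `s ≤ T` are covered by the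
  -- constant `B`.
  have hclaim : ∀ s ≥ 0, s ≤ τ ^ (γ - 1) → ω τ * ψ s ≤ φ s + B := by
    intro s hs hsτ
    rcases le_or_gt s T with hsT | hsT
    · have h1 := mul_le_mul hωτ (hψ.mono hs hsT) (hψ.nonneg hs) hω1
      linarith [hφ.nonneg hs]
    · have hs0 : 0 < s := hT0.trans hsT
      set s₁ := s ^ (γ - 1)⁻¹ with hs₁
      have hinv : (γ - 1)⁻¹ ≤ 0 := inv_nonpos.2 hγ1.le
      have e1 : s₁ ^ (γ - 1) = s := Real.rpow_inv_rpow hs hγ1.ne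
      have h1 : τ ≤ s₁ := by
        have := Real.rpow_le_rpow_of_nonpos hs0 hsτ hinv
        rwa [Real.rpow_rpow_inv hτ0.le hγ1.ne] at this
      have h2 : s₁ ≤ t₁ := by
        have := Real.rpow_le_rpow_of_nonpos hT0 hsT.le hinv
        rwa [hT, Real.rpow_rpow_inv ht₁0.le hγ1.ne] at this
      have h3 := hle ⟨hτ0.trans_le h1, show s₁ < t₀ by rw [ht₁] at h2; linarith⟩
      rw [e1, le_div_iff₀ (hψ.2.2 s hs0)] at h3
      have h4 := hω.mono hτ0.le (hτ0.le.trans h1) h1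
      have h5 := mul_le_mul_of_nonneg_right h4 (hψ.nonneg hs)
      linarith
  have hp : (0 : ℝ) < 2 ^ k := by positivity
  set s := t / 2 ^ k with hs
  have hs0 : 0 ≤ s := by positivity
  have hts : 2 ^ k * s = t := mul_div_cancel₀ t hp.ne'
  have hst : s ≤ t := div_le_self ht (one_le_pow₀ one_le_two)
  have hsτ : s ≤ τ ^ (γ - 1) := by
    rw [hs, div_le_iff₀ hp]
    refine htδ.trans ?_
    rw [hτ, Real.mul_rpow hR0.le hδ.le]
    have h1 : R⁻¹ ≤ R ^ (γ - 1) := by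
      rw [← Real.rpow_neg_one]
      exact Real.rpow_le_rpow_of_exponent_le hR (by linarith [hγ.1])
    have h2 : R = R⁻¹ * R ^ 2 := by field_simp
    have h3 : R ≤ R ^ (γ - 1) * 2 ^ k := by
      conv_lhs => rw [h2]
      exact mul_le_mul h1 hk.le (by positivity) (by positivity)
    have h4 : 0 < δ ^ (γ - 1) := Real.rpow_pos_of_pos hδ _
    nlinarith
  have h1 := hdk s hs0
  rw [hts] at h1
  have h2 := hclaim s hs0 hsτ
  have h3 := hφ.mono hs0 hst
  have h4 := hφ.nonneg ht
  calc ω τ * ψ t ≤ ω τ * (D * (ψ s + 1)) := mul_le_mul_of_nonneg_left h1 hωτ0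
    _ = D * (ω τ * ψ s + ω τ) := by ring
    _ ≤ D * (φ t + B + ω t₁) := mul_le_mul_of_nonneg_left (by linarith) hD
    _ ≤ D * ((1 + B + ω t₁) * (φ t + 1)) := by
        refine mul_le_mul_of_nonneg_left ?_ hD
        nlinarith [mul_nonneg hB0 h4, mul_nonneg hω1 h4]
    _ = _ := by ring

end YoungBlock

/-! ### Logarithmic perturbations of a power. -/

section LogBlock

variable {n : ℕ} {Ω : Set (Space n)}

lemma one_le_log_exp_add {t : ℝ} (ht : 0 ≤ t) : 1 ≤ Real.log (Real.exp 1 + t) := by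
  rw [Real.le_log_iff_exp_le (by positivity)]
  linarith

lemma log_exp_add_two_mul_le {t : ℝ} (ht : 0 ≤ t) :
    Real.log (Real.exp 1 + 2 * t) ≤ 2 * Real.log (Real.exp 1 + t) := by
  rw [show (2 : ℝ) * Real.log (Real.exp 1 + t) = ((2 : ℕ) : ℝ) * Real.log (Real.exp 1 + t) by
    norm_num, ← Real.log_pow]
  refine Real.log_le_log (by positivity) ?_
  have := Real.add_one_le_exp 1
  nlinarith

/-- A logarithmic double phase with a coefficient of logarithmic modulus of continuity. -/
lemma isRegularFun_log {γ : ℝ} (hγ : γ ∈ Ico (0 : ℝ) 1) (hΩ : IsOpen Ω)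
    {p α β : ℝ} (hα : 0 ≤ α) (hβ : 0 ≤ β) {a : Space n → ℝ}
    (ha : ContinuousOn a Ω) (ha0 : ∀ x ∈ Ω, 0 ≤ a x) (haA : ∃ A ≥ 0, ∀ x ∈ Ω, |a x| ≤ A)
    (hconv : ∀ᵐ x ∂volume.restrict Ω, ConvexOn ℝ univ fun s : ℝ =>
      |s| ^ p * Real.log (Real.exp 1 + |s|) ^ (-β) +
        a x * (|s| ^ p * Real.log (Real.exp 1 + |s|) ^ α))
    (hosc : ∃ c ≥ 0, ∃ r > 0, ∀ s ∈ Ioo 0 r, ∃ K ≥ 0,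
      (∀ x ∈ Ω, ∀ y ∈ Ω, dist x y ≤ s → |a x - a y| ≤ K) ∧
      K * Real.log (1 / s) ^ (α + β) ≤ c) :
    IsRegularFun γ Ω fun x t => t ^ p * Real.log (Real.exp 1 + t) ^ (-β) +
      a x * (t ^ p * Real.log (Real.exp 1 + t) ^ α) := by
  have hL : ∀ t ≥ 0, 0 < Real.log (Real.exp 1 + t) := fun t ht =>
    one_pos.trans_le (one_le_log_exp_add ht)
  have hφ0 : ∀ t ≥ (0 : ℝ), 0 ≤ t ^ p * Real.log (Real.exp 1 + t) ^ (-β) := fun t ht =>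
    mul_nonneg (Real.rpow_nonneg ht _) (Real.rpow_nonneg (hL t ht).le _)
  have hψ0 : ∀ t ≥ (0 : ℝ), 0 ≤ t ^ p * Real.log (Real.exp 1 + t) ^ α := fun t ht =>
    mul_nonneg (Real.rpow_nonneg ht _) (Real.rpow_nonneg (hL t ht).le _)
  refine isRegularFun_orlicz (φ := fun t => t ^ p * Real.log (Real.exp 1 + t) ^ (-β))
    (ψ := fun t => t ^ p * Real.log (Real.exp 1 + t) ^ α) hΩ hφ0 hψ0 ?_ ?_ ha ha0 haA hconv ?_
  · refine ⟨2 ^ p, by positivity, fun t ht => ?_⟩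
    have h1 : Real.log (Real.exp 1 + 2 * t) ^ (-β) ≤ Real.log (Real.exp 1 + t) ^ (-β) :=
      Real.rpow_le_rpow_of_nonpos (hL t ht)
        (Real.log_le_log (by positivity) (by linarith)) (by linarith)
    have h2 : (0 : ℝ) < 2 ^ p := by positivity
    rw [Real.mul_rpow zero_le_two ht, mul_assoc]
    refine mul_le_mul_of_nonneg_left ?_ h2.le
    have := mul_le_mul_of_nonneg_left h1 (Real.rpow_nonneg ht p)
    linarith
  · refine ⟨2 ^ p * 2 ^ α, by positivity, fun t ht => ?_⟩
    have h1 : Real.log (Real.exp 1 + 2 * t) ^ α ≤ 2 ^ α * Real.log (Real.exp 1 + t) ^ α := by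
      rw [← Real.mul_rpow zero_le_two (hL t ht).le]
      exact Real.rpow_le_rpow (hL (2 * t) (by positivity)).le (log_exp_add_two_mul_le ht) hα
    have h2 : (0 : ℝ) < 2 ^ p * 2 ^ α := by positivity
    have h3 : (0 : ℝ) ≤ 2 ^ p * t ^ p := mul_nonneg (by positivity) (Real.rpow_nonneg ht p)
    rw [Real.mul_rpow zero_le_two ht]
    have := mul_le_mul_of_nonneg_left h1 h3
    nlinarith
  · intro R hR
    have hR0 : 0 < R := by linarith
    obtain ⟨c, hc, r, hr, hosc⟩ := hosc
    obtain ⟨δ₁, hδ₁, hlog⟩ := exists_log_le hR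
    refine ⟨2 ^ (α + β) * c, by positivity, min δ₁ (r / R), by positivity, fun δ ⟨hδ, hδlt⟩ => ?_⟩
    obtain ⟨hδ1, -, hΛ, hΛ2⟩ := hlog δ ⟨hδ, hδlt.trans_le (min_le_left _ _)⟩
    have hRδ : R * δ < r := by
      have := hδlt.trans_le (min_le_right _ _)
      rw [lt_div_iff₀ hR0] at this
      linarith
    obtain ⟨K, hK, hKosc, hKc⟩ := hosc (R * δ) ⟨by positivity, hRδ⟩
    refine ⟨K, hK, hKosc, fun t ht htδ => ?_⟩
    have hLt := hL t ht
    have htR : t ≤ R * δ⁻¹ := htδ.trans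
      (mul_le_mul_of_nonneg_left (rpow_sub_one_le_inv hγ.1 hδ hδ1.le) hR0.le)
    -- Only `t ≤ R * δ⁻¹` is used: logarithms do not feel the power `γ - 1`, hence the condition on
    -- `a` is the same for all `γ`.
    have h1 : Real.log (Real.exp 1 + t) ≤ 2 * Real.log (1 / (R * δ)) :=
      (Real.log_le_log (by positivity) (by linarith)).trans hΛ2
    have h2 : Real.log (Real.exp 1 + t) ^ (α + β) ≤
        2 ^ (α + β) * Real.log (1 / (R * δ)) ^ (α + β) := by
      rw [← Real.mul_rpow zero_le_two hΛ.le]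
      exact Real.rpow_le_rpow hLt.le h1 (by positivity)
    have e1 : Real.log (Real.exp 1 + t) ^ α =
        Real.log (Real.exp 1 + t) ^ (α + β) * Real.log (Real.exp 1 + t) ^ (-β) := by
      rw [← Real.rpow_add hLt]
      congr 1
      ring
    have h3 : K * Real.log (Real.exp 1 + t) ^ (α + β) ≤ 2 ^ (α + β) * c := by
      calc _ ≤ K * (2 ^ (α + β) * Real.log (1 / (R * δ)) ^ (α + β)) :=
            mul_le_mul_of_nonneg_left h2 hK
        _ = 2 ^ (α + β) * (K * Real.log (1 / (R * δ)) ^ (α + β)) := by ring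
        _ ≤ _ := mul_le_mul_of_nonneg_left hKc (by positivity)
    have h4 := mul_le_mul_of_nonneg_right h3 (hφ0 t ht)
    have h5 : (0 : ℝ) ≤ 2 ^ (α + β) * c := by positivity
    rw [e1]
    nlinarith

/-- The exponent `1 + 0` is `α + β` for the mild double phase, with `α = 1` and `β = 0`. -/
lemma IsLogHolder.exists_osc_mul_log_le {a : Space n → ℝ} (ha : IsLogHolder Ω a) :
    ∃ c ≥ 0, ∃ r > 0, ∀ s ∈ Ioo 0 r, ∃ K ≥ 0,
      (∀ x ∈ Ω, ∀ y ∈ Ω, dist x y ≤ s → |a x - a y| ≤ K) ∧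
      K * Real.log (1 / s) ^ (1 + 0 : ℝ) ≤ c := by
  obtain ⟨c, hc, r, hr, h⟩ := ha.exists_osc_le
  refine ⟨c, hc, min r 1, by positivity, fun s ⟨hs, hsr⟩ => ?_⟩
  have hlog : 0 < Real.log (1 / s) :=
    Real.log_pos ((one_lt_div hs).2 (hsr.trans_le (min_le_right _ _)))
  refine ⟨c / Real.log (1 / s), by positivity, h s ⟨hs, hsr.trans_le (min_le_left _ _)⟩, ?_⟩
  rw [add_zero, Real.rpow_one, div_mul_cancel₀ _ hlog.ne']

lemma IsModulusOfContinuity.exists_osc_mul_log_le {a : Space n → ℝ} {ω : ℝ → ℝ}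
    (hω : IsModulusOfContinuity Ω a ω) {σ : ℝ} (hσ : 0 ≤ σ)
    (hle : ∀ᶠ t in 𝓝[>] (0 : ℝ), ω t ≤ Real.log (Real.exp 1 + 1 / t) ^ (-σ)) :
    ∃ c ≥ 0, ∃ r > 0, ∀ s ∈ Ioo 0 r, ∃ K ≥ 0,
      (∀ x ∈ Ω, ∀ y ∈ Ω, dist x y ≤ s → |a x - a y| ≤ K) ∧ K * Real.log (1 / s) ^ σ ≤ c := by
  obtain ⟨t₀, ht₀, hle⟩ := (nhdsGT_basis (0 : ℝ)).eventually_iff.1 hle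
  refine ⟨1, zero_le_one, min t₀ 1, by positivity, fun s ⟨hs, hsr⟩ => ?_⟩
  have h1 := hle ⟨hs, hsr.trans_le (min_le_left _ _)⟩
  have hlog : 0 < Real.log (1 / s) :=
    Real.log_pos ((one_lt_div hs).2 (hsr.trans_le (min_le_right _ _)))
  have hs' : 0 < 1 / s := one_div_pos.2 hs
  refine ⟨Real.log (1 / s) ^ (-σ), by positivity, fun x hx y hy hxy =>
    ((hω.bound x hx y hy).trans (hω.mono dist_nonneg hs.le hxy)).trans (h1.trans ?_), ?_⟩
  · exact Real.rpow_le_rpow_of_nonpos hlog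
      (Real.log_le_log hs' (by linarith [Real.exp_pos 1])) (by linarith)
  · rw [← Real.rpow_add hlog]
    simp

lemma IsModulusOfContinuity.exists_bound (hΩ : Bornology.IsBounded Ω) {a : Space n → ℝ}
    {ω : ℝ → ℝ} (hω : IsModulusOfContinuity Ω a ω) : ∃ A ≥ 0, ∀ x ∈ Ω, |a x| ≤ A :=
  exists_bound_of_osc hΩ one_pos fun x hx y hy hxy =>
    (hω.bound x hx y hy).trans (hω.mono dist_nonneg (mem_Ici.2 zero_le_one) hxy)

lemma IsLogHolder.continuousOn {a : Space n → ℝ} (ha : IsLogHolder Ω a) : ContinuousOn a Ω := by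
  obtain ⟨c, hc, r, hr, h⟩ := ha.exists_osc_le
  intro x hx
  rw [ContinuousWithinAt, Metric.tendsto_nhdsWithin_nhds]
  intro ε hε
  have ht : Tendsto (fun s : ℝ => c / Real.log (1 / s)) (𝓝[>] 0) (𝓝 0) := by
    have h0 : Tendsto (fun s : ℝ => 1 / s) (𝓝[>] 0) atTop := by
      simpa only [one_div] using tendsto_inv_nhdsGT_zero (𝕜 := ℝ)
    exact tendsto_const_nhds.div_atTop (Real.tendsto_log_atTop.comp h0)
  obtain ⟨s, h1, h2⟩ := ((ht.eventually_lt_const hε).and (Ioo_mem_nhdsGT hr)).exists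
  exact ⟨s, h2.1, fun y hy hxy => (h s h2 y hy x hx hxy.le).trans_lt h1⟩

end LogBlock
end Lavrentiev

namespace Lavrentiev

/-! ### Reduction of the listed models to the scalar blocks. -/

section Cases

variable {n : ℕ} {Ω : Set (Space n)} {M : Space n → Space n → ℝ} {F : Space n → ℝ → Space n → ℝ}

lemma isLogHolder_const (c : ℝ) : IsLogHolder Ω fun _ => c := by
  refine ⟨1, one_pos, 1 / 2, by norm_num, fun x _ y _ hxy => ?_⟩
  rw [sub_self, abs_zero]
  refine div_nonneg zero_le_one ?_
  rcases (dist_nonneg (x := x) (y := y)).eq_or_lt with h | h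
  · simp [← h]
  · exact Real.log_nonneg ((one_le_div h).2 (by linarith))

lemma isHolder_zero (α : ℝ) : IsHolder α Ω fun _ => 0 :=
  ⟨continuousOn_const, 0, by simp⟩

lemma isRegularFun_rpow {γ : ℝ} (hγ : γ ∈ Ico (0 : ℝ) 1) (hΩ : Bornology.IsBounded Ω)
    {p : Space n → ℝ} (hp : IsLogHolder Ω p) (hp1 : ∀ x ∈ Ω, 1 ≤ p x) :
    IsRegularFun γ Ω fun x t => t ^ p x := by
  simpa using isRegularFun_power hγ hΩ one_pos le_rfl hp hp (fun x hx => ⟨hp1 x hx, le_rfl⟩)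
    (isHolder_zero 0) (fun _ _ => le_rfl) (by simp)

lemma isRegularFun_doublePhase {γ : ℝ} (hγ : γ ∈ Ico (0 : ℝ) 1) (hΩ : Bornology.IsBounded Ω)
    {α : ℝ} (hα : α ∈ Ioc (0 : ℝ) 1) {p q a : Space n → ℝ} (hp : IsLogHolder Ω p)
    (hq : IsLogHolder Ω q) (hpq : ∀ x ∈ Ω, 1 ≤ p x ∧ p x ≤ q x) (ha : IsHolder α Ω a)
    (ha0 : ∀ x ∈ Ω, 0 ≤ a x) (hqp : ∀ x ∈ Ω, q x - p x ≤ α / (1 - γ)) :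
    IsRegularFun γ Ω fun x t => t ^ p x + a x * t ^ q x := by
  simpa using isRegularFun_power hγ hΩ one_pos hα.1.le hp hq hpq ha ha0 hqp

lemma IsWeakNFunction.convexOn_line (hM : IsWeakNFunction Ω M) (e : Space n) :
    ∀ᵐ x ∂volume.restrict Ω, ConvexOn ℝ univ fun s : ℝ => M x (s • e) := by
  filter_upwards [hM.convex] with x hx
  exact hx.comp_linearMap (LinearMap.toSpanSingleton ℝ (Space n) e)

lemma IsWeakNFunction.convexOn_norm (hn : 1 ≤ n) (hΩ : MeasurableSet Ω)
    (hM : IsWeakNFunction Ω M) {f : Space n → ℝ → ℝ} (hf : ∀ x ∈ Ω, ∀ ξ, M x ξ = f x ‖ξ‖) :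
    ∀ᵐ x ∂volume.restrict Ω, ConvexOn ℝ univ fun s : ℝ => f x |s| := by
  filter_upwards [hM.convexOn_line (EuclideanSpace.single ⟨0, hn⟩ 1), ae_restrict_mem hΩ]
    with x hx hxΩ
  refine hx.congr fun s _ => ?_
  simp [hf x hxΩ, norm_smul]

/-- On the `i`-th coordinate axis all other summands vanish, so convexity of `M x` passes to each
summand. -/
lemma IsWeakNFunction.convexOn_apply (hΩ : MeasurableSet Ω) (hM : IsWeakNFunction Ω M)
    {f : Fin n → Space n → ℝ → ℝ} (hf : ∀ x ∈ Ω, ∀ ξ, M x ξ = ∑ i, f i x |ξ i|)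
    (hf0 : ∀ i, ∀ x ∈ Ω, f i x 0 = 0) (i : Fin n) :
    ∀ᵐ x ∂volume.restrict Ω, ConvexOn ℝ univ fun s : ℝ => f i x |s| := by
  filter_upwards [hM.convexOn_line (EuclideanSpace.single i 1), ae_restrict_mem hΩ]
    with x hx hxΩ
  refine hx.congr fun s _ => ?_
  beta_reduce
  rw [hf x hxΩ, Finset.sum_eq_single i]
  · simp
  · intro j _ hj
    simp [hj, hf0 j x hxΩ]
  · simp

lemma IsRegular.noGap (hΩ : IsBoundedLipschitzDomain Ω) (hM : IsWeakNFunction Ω M)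
    (hF : IsCaratheodory Ω F) (hFM : HasGrowth Ω M F) (h : IsRegular 0 Ω M) : NoGap Ω M F :=
  noGap_of_isBalanced hΩ hM hF hFM h.doubling h.balanced

lemma IsRegular.noGapHolder (hn : 1 ≤ n) (hΩ : IsBoundedLipschitzDomain Ω)
    (hM : IsWeakNFunction Ω M) (hF : IsCaratheodory Ω F) (hFM : HasGrowth Ω M F) {γ : ℝ}
    (hγ : γ ∈ Ico (0 : ℝ) 1) (h : IsRegular γ Ω M) : NoGapHolder γ Ω M F :=
  noGapHolder_of_isBalanced hn hΩ hM hF hFM hγ h.doubling h.balanced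

lemma noGap_and_noGapHolder (hn : 1 ≤ n) (hΩ : IsBoundedLipschitzDomain Ω)
    (hM : IsWeakNFunction Ω M) (hF : IsCaratheodory Ω F) (hFM : HasGrowth Ω M F) {γ : ℝ}
    (hγ : γ ∈ Ico (0 : ℝ) 1) (h : ∀ γ' ∈ Ico (0 : ℝ) 1, IsRegular γ' Ω M) :
    NoGap Ω M F ∧ NoGapHolder γ Ω M F :=
  ⟨(h 0 ⟨le_rfl, one_pos⟩).noGap hΩ hM hF hFM, (h γ hγ).noGapHolder hn hΩ hM hF hFM hγ⟩

/-- `S γ'` is the model's gap condition at Hölder exponent `γ'`; statement (A) uses it at `0` and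
(B) at `γ`. -/
lemma noGap_imp_and_noGapHolder_imp (hn : 1 ≤ n) (hΩ : IsBoundedLipschitzDomain Ω)
    (hM : IsWeakNFunction Ω M) (hF : IsCaratheodory Ω F) (hFM : HasGrowth Ω M F) {γ : ℝ}
    (hγ : γ ∈ Ico (0 : ℝ) 1) {P P' : Prop} {S : ℝ → Prop} (hP : P → S 0) (hP' : P' → S γ)
    (h : ∀ γ' ∈ Ico (0 : ℝ) 1, S γ' → IsRegular γ' Ω M) :
    (P → NoGap Ω M F) ∧ (P' → NoGapHolder γ Ω M F) :=
  ⟨fun hp => (h 0 ⟨le_rfl, one_pos⟩ (hP hp)).noGap hΩ hM hF hFM,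
    fun hp => (h γ hγ (hP' hp)).noGapHolder hn hΩ hM hF hFM hγ⟩

end Cases
end Lavrentiev

open Lavrentiev

theorem mainTheorem3 {n : ℕ} (hn : 1 ≤ n) (Ω : Set (Space n))
    (hΩ : IsBoundedLipschitzDomain Ω) (γ : ℝ) (hγ : γ ∈ Ico (0 : ℝ) 1)
    (M : Space n → Space n → ℝ) (hM : IsWeakNFunction Ω M)
    (F : Space n → ℝ → Space n → ℝ) (hF : IsCaratheodory Ω F) (hFM : HasGrowth Ω M F) :
    -- isotropic: variable exponent
    (∀ p : Space n → ℝ, IsLogHolder Ω p → (∀ x ∈ Ω, 1 ≤ p x) →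
      (∀ x ∈ Ω, ∀ ξ, M x ξ = ‖ξ‖ ^ p x) →
      NoGap Ω M F ∧ NoGapHolder γ Ω M F) ∧
    -- isotropic: mild double phase
    (∀ (p : ℝ) (a : Space n → ℝ), 1 ≤ p → IsLogHolder Ω a → (∀ x ∈ Ω, 0 ≤ a x) →
      (∀ x ∈ Ω, ∀ ξ, M x ξ = ‖ξ‖ ^ p + a x * (‖ξ‖ ^ p * Real.log (Real.exp 1 + ‖ξ‖))) →
      NoGap Ω M F ∧ NoGapHolder γ Ω M F) ∧
    -- isotropic: double phase
    (∀ (p q α : ℝ) (a : Space n → ℝ), 1 ≤ p → p ≤ q → α ∈ Ioc (0 : ℝ) 1 → IsHolder α Ω a →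
      (∀ x ∈ Ω, 0 ≤ a x) →
      (∀ x ∈ Ω, ∀ ξ, M x ξ = ‖ξ‖ ^ p + a x * ‖ξ‖ ^ q) →
      (q ≤ p + α → NoGap Ω M F) ∧
      (q ≤ p + α / (1 - γ) → NoGapHolder γ Ω M F)) ∧
    -- isotropic: variable exponent double phase
    (∀ (p q : Space n → ℝ) (α : ℝ) (a : Space n → ℝ), IsLogHolder Ω p → IsLogHolder Ω q →
      (∀ x ∈ Ω, 1 ≤ p x ∧ p x ≤ q x) → α ∈ Ioc (0 : ℝ) 1 → IsHolder α Ω a →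
      (∀ x ∈ Ω, 0 ≤ a x) →
      (∀ x ∈ Ω, ∀ ξ, M x ξ = ‖ξ‖ ^ p x + a x * ‖ξ‖ ^ q x) →
      ((∀ x ∈ Ω, q x - p x ≤ α) → NoGap Ω M F) ∧
      ((∀ x ∈ Ω, q x - p x ≤ α / (1 - γ)) → NoGapHolder γ Ω M F)) ∧
    -- isotropic: multi-phase
    (∀ (p : ℝ) (q α : Fin n → ℝ) (a : Fin n → Space n → ℝ), 1 ≤ p → (∀ i, p ≤ q i) →
      (∀ i, α i ∈ Ioc (0 : ℝ) 1) → (∀ i, IsHolder (α i) Ω (a i)) →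
      (∀ i, ∀ x ∈ Ω, 0 ≤ a i x) →
      (∀ x ∈ Ω, ∀ ξ, M x ξ = ‖ξ‖ ^ p + ∑ i, a i x * ‖ξ‖ ^ q i) →
      ((∀ i, q i ≤ p + α i) → NoGap Ω M F) ∧
      ((∀ i, q i ≤ p + α i / (1 - γ)) → NoGapHolder γ Ω M F)) ∧
    -- isotropic: Orlicz double phase
    (∀ (φ ψ : ℝ → ℝ) (a : Space n → ℝ) (ω : ℝ → ℝ), IsYoungFunction φ → IsYoungFunction ψ →
      IsDoubling φ → IsDoubling ψ → Tendsto (fun t => ψ t / φ t) atTop atTop →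
      ContinuousOn a Ω → (∀ x ∈ Ω, 0 ≤ a x) → IsModulusOfContinuity Ω a ω →
      (∀ x ∈ Ω, ∀ ξ, M x ξ = φ ‖ξ‖ + a x * ψ ‖ξ‖) →
      ((∀ᶠ t in 𝓝[>] (0 : ℝ), ω t ≤ φ t⁻¹ / ψ t⁻¹) → NoGap Ω M F) ∧
      ((∀ᶠ t in 𝓝[>] (0 : ℝ), ω t ≤ φ (t ^ (γ - 1)) / ψ (t ^ (γ - 1))) →
        NoGapHolder γ Ω M F)) ∧
    -- isotropic: the logarithmic instance of the Orlicz double phase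
    (∀ (p α β : ℝ) (a : Space n → ℝ) (ω : ℝ → ℝ), 1 < p → 0 ≤ α → 0 ≤ β →
      ContinuousOn a Ω → (∀ x ∈ Ω, 0 ≤ a x) → IsModulusOfContinuity Ω a ω →
      (∀ x ∈ Ω, ∀ ξ, M x ξ = ‖ξ‖ ^ p * Real.log (Real.exp 1 + ‖ξ‖) ^ (-β) +
        a x * (‖ξ‖ ^ p * Real.log (Real.exp 1 + ‖ξ‖) ^ α)) →
      (∀ᶠ t in 𝓝[>] (0 : ℝ), ω t ≤ Real.log (Real.exp 1 + 1 / t) ^ (-(α + β))) →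
      NoGap Ω M F ∧ NoGapHolder γ Ω M F) ∧
    -- orthotropic: variable exponents
    (∀ p : Fin n → Space n → ℝ, (∀ i, IsLogHolder Ω (p i)) → (∀ i, ∀ x ∈ Ω, 1 ≤ p i x) →
      (∀ x ∈ Ω, ∀ ξ, M x ξ = ∑ i, |ξ i| ^ p i x) →
      NoGap Ω M F ∧ NoGapHolder γ Ω M F) ∧
    -- orthotropic: double phase
    (∀ (p q α : Fin n → ℝ) (a : Fin n → Space n → ℝ), (∀ i, 1 ≤ p i ∧ p i ≤ q i) →
      (∀ i, α i ∈ Ioc (0 : ℝ) 1) → (∀ i, IsHolder (α i) Ω (a i)) →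
      (∀ i, ∀ x ∈ Ω, 0 ≤ a i x) →
      (∀ x ∈ Ω, ∀ ξ, M x ξ = ∑ i, |ξ i| ^ p i + ∑ i, a i x * |ξ i| ^ q i) →
      ((∀ i, q i ≤ p i + α i) → NoGap Ω M F) ∧
      ((∀ i, q i ≤ p i + α i / (1 - γ)) → NoGapHolder γ Ω M F)) ∧
    -- orthotropic: mild double phase
    (∀ (p : Fin n → ℝ) (a : Fin n → Space n → ℝ), (∀ i, 1 ≤ p i) →
      (∀ i, IsLogHolder Ω (a i)) → (∀ i, ∀ x ∈ Ω, 0 ≤ a i x) →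
      (∀ x ∈ Ω, ∀ ξ, M x ξ = ∑ i, |ξ i| ^ p i +
        ∑ i, a i x * (|ξ i| ^ p i * Real.log (Real.exp 1 + |ξ i|))) →
      NoGap Ω M F ∧ NoGapHolder γ Ω M F) ∧
    -- orthotropic: variable exponent double phase
    (∀ (p q : Fin n → Space n → ℝ) (α : Fin n → ℝ) (a : Fin n → Space n → ℝ),
      (∀ i, IsLogHolder Ω (p i)) → (∀ i, IsLogHolder Ω (q i)) →
      (∀ i, ∀ x ∈ Ω, 1 ≤ p i x ∧ p i x ≤ q i x) →
      (∀ i, α i ∈ Ioc (0 : ℝ) 1) → (∀ i, IsHolder (α i) Ω (a i)) →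
      (∀ i, ∀ x ∈ Ω, 0 ≤ a i x) →
      (∀ x ∈ Ω, ∀ ξ, M x ξ = ∑ i, |ξ i| ^ p i x + ∑ i, a i x * |ξ i| ^ q i x) →
      ((∀ i, ∀ x ∈ Ω, q i x - p i x ≤ α i) → NoGap Ω M F) ∧
      ((∀ i, ∀ x ∈ Ω, q i x - p i x ≤ α i / (1 - γ)) → NoGapHolder γ Ω M F)) := by
  have hb := hΩ.isBounded
  have hm := hΩ.measurableSet
  refine ⟨?_, ?_, ?_, ?_, ?_, ?_, ?_, ?_, ?_, ?_, ?_⟩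
  · intro p hp hp1 hMp
    exact noGap_and_noGapHolder hn hΩ hM hF hFM hγ fun γ' hγ' =>
      (isRegularFun_rpow hγ' hb hp hp1).comp_norm.congr hMp
  · intro p a _ ha ha0 hMp
    -- The mild double phase is the logarithmic model with `α = 1` and `β = 0`.
    have hMp' : ∀ x ∈ Ω, ∀ ξ, M x ξ = ‖ξ‖ ^ p * Real.log (Real.exp 1 + ‖ξ‖) ^ (-0 : ℝ) +
        a x * (‖ξ‖ ^ p * Real.log (Real.exp 1 + ‖ξ‖) ^ (1 : ℝ)) := by
      simpa using hMp
    have hc := hM.convexOn_norm hn hm (f := fun x t => t ^ p * Real.log (Real.exp 1 + t) ^ (-0 : ℝ) +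
        a x * (t ^ p * Real.log (Real.exp 1 + t) ^ (1 : ℝ))) hMp'
    exact noGap_and_noGapHolder hn hΩ hM hF hFM hγ fun γ' hγ' =>
      (isRegularFun_log hγ' hΩ.isOpen zero_le_one le_rfl ha.continuousOn ha0 (ha.exists_bound hb) hc
        ha.exists_osc_mul_log_le).comp_norm.congr hMp'
  · intro p q α a hp hpq hα ha ha0 hMp
    refine noGap_imp_and_noGapHolder_imp hn hΩ hM hF hFM hγ
      (S := fun γ' => q - p ≤ α / (1 - γ')) (fun h => ?_) (fun h => by linarith) fun γ' hγ' h =>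
      (isRegularFun_doublePhase hγ' hb hα (isLogHolder_const p) (isLogHolder_const q)
        (fun _ _ => ⟨hp, hpq⟩) ha ha0 fun _ _ => h).comp_norm.congr hMp
    rw [sub_zero, div_one]
    linarith
  · intro p q α a hp hq hpq hα ha ha0 hMp
    exact noGap_imp_and_noGapHolder_imp hn hΩ hM hF hFM hγ
      (S := fun γ' => ∀ x ∈ Ω, q x - p x ≤ α / (1 - γ')) (fun h => by simpa using h) (fun h => h)
      fun γ' hγ' h =>
        (isRegularFun_doublePhase hγ' hb hα hp hq hpq ha ha0 h).comp_norm.congr hMp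
  · intro p q α a hp hpq hα ha ha0 hMp
    have hn0 : (0 : ℝ) < n := by exact_mod_cast hn
    refine noGap_imp_and_noGapHolder_imp hn hΩ hM hF hFM hγ
      (S := fun γ' => ∀ i, q i - p ≤ α i / (1 - γ')) (fun h i => ?_)
      (fun h i => by linarith [h i]) fun γ' hγ' h => ?_
    · rw [sub_zero, div_one]
      linarith [h i]
    -- The common term `‖ξ‖ ^ p` is split into `n` equal shares, one for each phase, so that every
    -- summand is a double phase with `κ = n⁻¹`.
    · refine (IsRegular.sum Finset.univ fun i => (isRegularFun_power hγ' hb (inv_pos.2 hn0)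
        (hα i).1.le (isLogHolder_const p) (isLogHolder_const (q i)) (fun _ _ => ⟨hp, hpq i⟩)
        (ha i) (ha0 i) fun _ _ => h i).comp_norm).congr fun x hx ξ => ?_
      rw [hMp x hx, Finset.sum_add_distrib, Finset.sum_const, Finset.card_univ, Fintype.card_fin,
        nsmul_eq_mul, mul_inv_cancel_left₀ hn0.ne']
  · intro φ ψ a ω hφ hψ hφ2 hψ2 _ ha ha0 hω hMp
    have hc := hM.convexOn_norm hn hm (f := fun x t => φ t + a x * ψ t) hMp
    refine noGap_imp_and_noGapHolder_imp hn hΩ hM hF hFM hγ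
      (S := fun γ' => ∀ᶠ t in 𝓝[>] (0 : ℝ), ω t ≤ φ (t ^ (γ' - 1)) / ψ (t ^ (γ' - 1)))
      (fun h => ?_) (fun h => h) fun γ' hγ' h =>
      (isRegularFun_orlicz hΩ.isOpen (fun t => hφ.nonneg) (fun t => hψ.nonneg)
        (hφ.exists_doubling hφ2) (hψ.exists_doubling hψ2) ha ha0 (hω.exists_bound hb) hc
        (exists_osc_of_modulus hγ' hφ hψ hψ2 hω h)).comp_norm.congr hMp
    simpa only [zero_sub, Real.rpow_neg_one] using h
  · intro p α β a ω _ hα hβ ha ha0 hω hMp hle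
    have hc := hM.convexOn_norm hn hm (f := fun x t => t ^ p * Real.log (Real.exp 1 + t) ^ (-β) +
        a x * (t ^ p * Real.log (Real.exp 1 + t) ^ α)) hMp
    exact noGap_and_noGapHolder hn hΩ hM hF hFM hγ fun γ' hγ' =>
      (isRegularFun_log hγ' hΩ.isOpen hα hβ ha ha0 (hω.exists_bound hb) hc
        (hω.exists_osc_mul_log_le (add_nonneg hα hβ) hle)).comp_norm.congr hMp
  · intro p hp hp1 hMp
    exact noGap_and_noGapHolder hn hΩ hM hF hFM hγ fun γ' hγ' =>
      (IsRegular.sum Finset.univ fun i =>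
        (isRegularFun_rpow hγ' hb (hp i) (hp1 i)).comp_abs_apply i).congr hMp
  · intro p q α a hpq hα ha ha0 hMp
    refine noGap_imp_and_noGapHolder_imp hn hΩ hM hF hFM hγ
      (S := fun γ' => ∀ i, q i - p i ≤ α i / (1 - γ')) (fun h i => ?_)
      (fun h i => by linarith [h i]) fun γ' hγ' h =>
      (IsRegular.sum Finset.univ fun i => (isRegularFun_doublePhase hγ' hb (hα i)
        (isLogHolder_const (p i)) (isLogHolder_const (q i)) (fun _ _ => hpq i) (ha i) (ha0 i)
        fun _ _ => h i).comp_abs_apply i).congr fun x hx ξ => ?_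
    · rw [sub_zero, div_one]
      linarith [h i]
    · rw [hMp x hx, Finset.sum_add_distrib]
  · intro p a hp ha ha0 hMp
    -- Each coordinate again carries the logarithmic model with `α = 1` and `β = 0`.
    have hMp' : ∀ x ∈ Ω, ∀ ξ, M x ξ = ∑ i, (|ξ i| ^ p i *
        Real.log (Real.exp 1 + |ξ i|) ^ (-0 : ℝ) +
        a i x * (|ξ i| ^ p i * Real.log (Real.exp 1 + |ξ i|) ^ (1 : ℝ))) := by
      intro x hx ξ
      simp [hMp x hx, Finset.sum_add_distrib]
    have hc := hM.convexOn_apply hm (f := fun i x t => t ^ p i *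
        Real.log (Real.exp 1 + t) ^ (-0 : ℝ) +
        a i x * (t ^ p i * Real.log (Real.exp 1 + t) ^ (1 : ℝ))) hMp' fun i x _ => by
      simp [Real.zero_rpow (by linarith [hp i] : p i ≠ 0)]
    exact noGap_and_noGapHolder hn hΩ hM hF hFM hγ fun γ' hγ' =>
      (IsRegular.sum Finset.univ fun i => (isRegularFun_log hγ' hΩ.isOpen zero_le_one le_rfl
        (ha i).continuousOn (ha0 i) ((ha i).exists_bound hb) (hc i)
        (ha i).exists_osc_mul_log_le).comp_abs_apply i).congr hMp'
  · intro p q α a hp hq hpq hα ha ha0 hMp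
    refine noGap_imp_and_noGapHolder_imp hn hΩ hM hF hFM hγ
      (S := fun γ' => ∀ i, ∀ x ∈ Ω, q i x - p i x ≤ α i / (1 - γ')) (fun h => by simpa using h)
      (fun h => h) fun γ' hγ' h =>
      (IsRegular.sum Finset.univ fun i => (isRegularFun_doublePhase hγ' hb (hα i) (hp i) (hq i)
        (hpq i) (ha i) (ha0 i) (h i)).comp_abs_apply i).congr fun x hx ξ => ?_
    rw [hMp x hx, Finset.sum_add_distrib]
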